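/- **Setting.** For $(x,v)\in\mathbb R^3\times\mathbb R^3$ put $L=|x\times v|^2=|x|^2|v|^2-(x\cdot v)^2$. A function $f=f(x,v)$ is spherically symmetric if $f(Ax,Av)=f(x,v)$ (almost everywhere) for every $A\in \mathrm{SO}(3)$. For such $f$ and $r=|x|$ let $$\rho_f(x)=\int f(x,v)\,dv,\quad m_f(r)=\int_{|y|\le r}\rho_f(y)\,dy,\quad \nabla U_f(x)=\frac{m_f(r)}{r^2}\frac{x}{r},\quad U_f(r)=-\int_r^\infty\frac{m_f(s)}{s^2}\,ds .$$ Let $l>-1$, $\gamma\ge 0$, $M>0$, let $Q\ge0$ be a function on $[0,\infty)$, and define $$\mathcal P(f)=\gamma\iint L f\,dv\,dx+\iint Q(L^{-l}f)L^l\,dv\,dx+\frac12\iint|v|^2f\,dv\,dx,\qquad \mathcal D(f)=\mathcal P(f)-\frac1{8\pi}\int|\nabla U_f|^2dx,$$ $$\mathcal F_M=\Bigl\{f\in L^1(\mathbb R^6): f\ge0,\ \iint f\,dv\,dx=M,\ \mathcal P(f)<\infty,\ f \text{ spherically symmetric}\Bigr\}.$$ Assume that $Q\in C^1([0,\infty))\cap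 C^2((0,\infty))$, $Q\ge 0$, and that there are constants $C_1,C_2,F_0>0$ and $0<k_1,k_2,k_3<l+\frac32$ such that - (Q1) $Q(y)\ge C_1y^{1+1/k_1}$ for $y\ge0$ (if $l=0$, for $y\ge F_0$ only); - (Q2) $Q(y)\le C_2y^{1+1/k_2}$ for $0\le y\le F_0$; - (Q3) $Q(\lambda y)\ge\lambda^{1+1/k_3}Q(y)$ for $y\ge0$, $0\le\lambda\le1$; - (Q4) $Q''(y)>0$ for $y>0$, and $Q'(0)=0$. For a minimizer $f_0$ of $\mathcal D$ over $\mathcal F_M$ write $U_0=U_{f_0}$, $E=\frac12|v|^2+U_0(x)$, $E_0=\frac1M\iint\bigl(Q'(L^{-l}f_0)+E+\gamma L\bigr)f_0\,dv\,dx$, and $$d(f,f_0)=\iint\Bigl[Q(L^{-l}f)L^l-Q(L^{-l}f_0)L^l+(E+\gamma L-E_0)(f-f_0)\Bigr]dv\,dx .$$ A (classical) solution of the Vlasov–Poisson system is a function $f\ge 0$ in $C^1([0,\infty)\times\mathbb R^6)$ with a potential $U$ such that, for all $t\ge 0$, $f(t,x,\cdot)$ is integrable for every $x$, $U(t,\cdot)\in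 C^2(\mathbb R^3)$, $U(t,x)\to0$ as $|x|\to\infty$, $\nabla_xU$ is bounded on $[0,T]\times\mathbb R^3$ for every $T>0$, and $$\partial_tf+v\cdot\nabla_xf-\nabla_xU\cdot\nabla_vf=0,\qquad \Delta U=4\pi\rho,\qquad \rho(t,x)=\int f(t,x,v)\,dv .$$ **Theorem 5.1.** Let $l$, $Q$, $M$ be as above. Then for all sufficiently small $\gamma\ge0$, i.e. for all $0\le\gamma<\gamma_0$ with some $\gamma_0>0$ depending only on $l$, $Q$, $M$, the following hold. (a) Assume that $f_0$ is the unique minimizer (up to null sets) of $\mathcal D$ in $\mathcal F_M$. Then for every $\varepsilon>0$ there is $\delta>0$ such that for any solution $f(t)$ of the Vlasov–Poisson system with $f(0)\in C^1_c(\mathbb R^6)\cap\mathcal F_M$, $$d(f(0),f_0)+\frac1{8\pi}\|\nabla U_{f(0)}-\nabla U_0\|_2^2<\delta$$ implies $$d(f(t),f_0)+\frac1{8\pi}\|\nabla U_{f(t)}-\nabla U_0\|_2^2<\varepsilon\quad\text{for all } t\ge0 .$$ (b) Without assuming uniqueness, let $\mathcal M_M$ be the set of all minimizers of $\mathcal D$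 in $\mathcal F_M$. Then for every $\varepsilon>0$ there is $\delta>0$ such that for any solution $f(t)$ of the Vlasov–Poisson system with $f(0)\in C^1_c(\mathbb R^6)\cap\mathcal F_M$, $$\inf_{f_0\in\mathcal M_M}\Bigl[d(f(0),f_0)+\frac1{8\pi}\|\nabla U_{f(0)}-\nabla U_{f_0}\|_2^2\Bigr]<\delta$$ implies $$\inf_{f_0\in\mathcal M_M}\Bigl[d(f(t),f_0)+\frac1{8\pi}\|\nabla U_{f(t)}-\nabla U_{f_0}\|_2^2\Bigr]<\varepsilon\quad\text{for all } t\ge0 .$$ -/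

import Mathlib

open MeasureTheory Filter Topology Set
open scoped RealInnerProductSpace

noncomputable section

namespace CammStability

/-- Physical space, and also velocity space. -/
abbrev E3 : Type := EuclideanSpace ℝ (Fin 3)

/-- Phase space; a point is a pair `(x, v)` of a position and a velocity. -/
abbrev Phase : Type := E3 × E3

/-- The modulus of angular momentum squared, `L = |x × v|² = |x|²|v|² - (x · v)²`. -/
def angL (z : Phase) : ℝ := ‖z.1‖ ^ 2 * ‖z.2‖ ^ 2 - ⟪z.1, z.2⟫ ^ 2

/-- The spatial density `ρ_f(x) = ∫ f(x,v) dv`. -/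
def rho (f : Phase → ℝ) (x : E3) : ℝ := ∫ v, f (x, v)

/-- The mass `m_f(r)` inside the ball of radius `r`. -/
def massIn (f : Phase → ℝ) (r : ℝ) : ℝ := ∫ y in Metric.closedBall (0 : E3) r, rho f y

/-- The field `∇U_f(x) = (m_f(r) / r²) (x / r)`, `r = |x|`, of a spherically symmetric `f`. -/
def fieldOf (f : Phase → ℝ) (x : E3) : E3 := (massIn f ‖x‖ / ‖x‖ ^ 2) • (‖x‖⁻¹ • x)

/-- The potential `U_f(x) = - ∫_r^∞ m_f(s) / s² ds`, `r = |x|`, of a spherically symmetric `f`. -/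
def potOf (f : Phase → ℝ) (x : E3) : ℝ := -∫ s in Ioi ‖x‖, massIn f s / s ^ 2

/-- The square of the `L²` distance of the fields, `‖∇U_f - ∇U_g‖₂²`. -/
def fieldDistSq (f g : Phase → ℝ) : ℝ := ∫ x, ‖fieldOf f x - fieldOf g x‖ ^ 2

def Ekin (f : Phase → ℝ) : ℝ := (1 / 2) * ∫ z, ‖z.2‖ ^ 2 * f z

def Epot (f : Phase → ℝ) : ℝ := -(1 / (8 * Real.pi)) * ∫ x, ‖fieldOf f x‖ ^ 2

/-- The integrand `Q(L^{-l} f) L^l` of the Casimir functional. -/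
def casimirDensity (l : ℝ) (Q : ℝ → ℝ) (f : Phase → ℝ) (z : Phase) : ℝ :=
  Q (angL z ^ (-l) * f z) * angL z ^ l

def casimir (l : ℝ) (Q : ℝ → ℝ) (f : Phase → ℝ) : ℝ := ∫ z, casimirDensity l Q f z

/-- The positive part `P` of the energy-Casimir functional. -/
def posPart (l : ℝ) (Q : ℝ → ℝ) (γ : ℝ) (f : Phase → ℝ) : ℝ :=
  γ * (∫ z, angL z * f z) + casimir l Q f + Ekin f

/-- The energy-Casimir functional `D`. -/
def energyCasimir (l : ℝ) (Q : ℝ → ℝ) (γ : ℝ) (f : Phase → ℝ) : ℝ :=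
  posPart l Q γ f + Epot f

/-- Spherical symmetry: for every `A` in `SO(3)`, `f(Ax, Av) = f(x,v)` for almost all `(x,v)`. -/
def SphericallySymmetric (f : Phase → ℝ) : Prop :=
  ∀ A : E3 ≃ₗᵢ[ℝ] E3, LinearMap.det (A.toLinearEquiv : E3 →ₗ[ℝ] E3) = 1 →
    ∀ᵐ z : Phase, f (A z.1, A z.2) = f z

/-- The constraint set `F_M`. Since `f ≥ 0` and `Q ≥ 0`, all three terms of `P(f)` are
integrals of nonnegative functions, and `P(f) < ∞` says that each of them converges
(for `γ = 0` the first one imposes nothing). -/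
structure MemF (l : ℝ) (Q : ℝ → ℝ) (γ M : ℝ) (f : Phase → ℝ) : Prop where
  integrable : Integrable f
  nonneg : ∀ᵐ z : Phase, 0 ≤ f z
  mass : ∫ z, f z = M
  finite_angL : Integrable fun z : Phase => γ * (angL z * f z)
  finite_casimir : Integrable (casimirDensity l Q f)
  finite_kin : Integrable fun z : Phase => ‖z.2‖ ^ 2 * f z
  symm : SphericallySymmetric f

/-- The assumptions on `Q`: regularity, nonnegativity, growth and scaling bounds, strict convexity. -/
structure CasimirAssumptions (l : ℝ) (Q : ℝ → ℝ) : Prop where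
  contDiff_one : ContDiffOn ℝ 1 Q (Ici 0)
  contDiff_two : ContDiffOn ℝ 2 Q (Ioi 0)
  nonneg : ∀ y, 0 ≤ y → 0 ≤ Q y
  growth : ∃ C₁ C₂ F₀ k₁ k₂ k₃ : ℝ, 0 < C₁ ∧ 0 < C₂ ∧ 0 < F₀ ∧
    (0 < k₁ ∧ k₁ < l + 3 / 2) ∧ (0 < k₂ ∧ k₂ < l + 3 / 2) ∧ (0 < k₃ ∧ k₃ < l + 3 / 2) ∧
    (∀ y, 0 ≤ y → (l = 0 → F₀ ≤ y) → C₁ * y ^ (1 + 1 / k₁) ≤ Q y) ∧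
    (∀ y, 0 ≤ y → y ≤ F₀ → Q y ≤ C₂ * y ^ (1 + 1 / k₂)) ∧
    (∀ y lam, 0 ≤ y → 0 ≤ lam → lam ≤ 1 → lam ^ (1 + 1 / k₃) * Q y ≤ Q (lam * y))
  deriv_two_pos : ∀ y, 0 < y → 0 < deriv (deriv Q) y
  deriv_zero : derivWithin Q (Ici 0) 0 = 0

/-- `f₀` is a minimizer of `D` over `F_M`. -/
def IsMinimizer (l : ℝ) (Q : ℝ → ℝ) (γ M : ℝ) (f₀ : Phase → ℝ) : Prop :=
  MemF l Q γ M f₀ ∧ ∀ g, MemF l Q γ M g → energyCasimir l Q γ f₀ ≤ energyCasimir l Q γ g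

/-- The particle energy `E = |v|²/2 + U_{f₀}(x)` in the potential of `f₀`. -/
def partE (f₀ : Phase → ℝ) (z : Phase) : ℝ := ‖z.2‖ ^ 2 / 2 + potOf f₀ z.1

/-- The cut-off energy `E₀ = (1/M) ∫∫ (Q'(L^{-l} f₀) + E + γ L) f₀` (a Lagrange multiplier). -/
def cutE (l : ℝ) (Q : ℝ → ℝ) (γ M : ℝ) (f₀ : Phase → ℝ) : ℝ :=
  (1 / M) * ∫ z, (derivWithin Q (Ici 0) (angL z ^ (-l) * f₀ z) + partE f₀ z + γ * angL z) * f₀ z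

/-- `d(f,f₀) = ∫∫ [Q(L^{-l} f) L^l - Q(L^{-l} f₀) L^l + (E + γ L - E₀)(f - f₀)]`. -/
def dFun (l : ℝ) (Q : ℝ → ℝ) (γ M : ℝ) (f f₀ : Phase → ℝ) : ℝ :=
  ∫ z, (casimirDensity l Q f z - casimirDensity l Q f₀ z +
    (partE f₀ z + γ * angL z - cutE l Q γ M f₀) * (f z - f₀ z))

/-- The deviation `d(f,f₀) + (1/8π) ‖∇U_f - ∇U_{f₀}‖₂²`. -/
def deviation (l : ℝ) (Q : ℝ → ℝ) (γ M : ℝ) (f f₀ : Phase → ℝ) : ℝ :=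
  dFun l Q γ M f f₀ + (1 / (8 * Real.pi)) * fieldDistSq f f₀

/-- Classical solutions `(f, U)` of the gravitational Vlasov-Poisson system on `[0,∞)`,
with the boundary condition `U → 0` at spatial infinity, and with a field which is bounded on
every compact time interval. No symmetry is imposed. -/
structure IsClassicalSolution (f : ℝ → Phase → ℝ) (U : ℝ → E3 → ℝ) : Prop where
  contDiff_f : ContDiffOn ℝ 1 (fun p : ℝ × Phase => f p.1 p.2) (Ici 0 ×ˢ univ)
  nonneg : ∀ t, 0 ≤ t → ∀ z, 0 ≤ f t z
  integrable_v : ∀ t, 0 ≤ t → ∀ x : E3, Integrable fun v : E3 => f t (x, v)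
  contDiff_U : ∀ t, 0 ≤ t → ContDiff ℝ 2 (U t)
  bounded_field : ∀ T : ℝ, ∃ K : ℝ, ∀ t, 0 ≤ t → t ≤ T → ∀ x, ‖gradient (U t) x‖ ≤ K
  vlasov : ∀ t, 0 ≤ t → ∀ x v : E3,
    derivWithin (fun s => f s (x, v)) (Ici 0) t
      + fderiv ℝ (fun y => f t (y, v)) x v
      - fderiv ℝ (fun w => f t (x, w)) v (gradient (U t) x) = 0
  poisson : ∀ t, 0 ≤ t → ∀ x, Laplacian.laplacian (U t) x = 4 * Real.pi * rho (f t) x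
  vanishing : ∀ t, 0 ≤ t → Tendsto (U t) (cocompact E3) (𝓝 0)

end CammStability

end

open CammStability

/-! The deviation is an excess energy in disguise. For states of equal mass the multiplier E₀ drops
out, and expanding the square of the field difference turns it into D(f) − D(f₀) + (1/4π)‖∇U_f −
∇U_{f₀}‖² (`MemF.deviation_eq`). Classical solutions stay in the constraint set and conserve D
(`IsClassicalSolution.memF`, `IsClassicalSolution.energyCasimir_eq`), so a small initial deviation
keeps D(f(t)) near its minimum. It remains to see that a state of almost minimal energy has a field
close to that of some minimizer (`exists_minimizer_near`).

This is a compactness statement. Splitting phase space by the size of v and of L^{-l} f bounds the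
mass in a ball of radius r by a power of r with exponent above 1/2 (`exists_massIn_le_rpow`). Hence
the field energy is O(P^θ) with θ < 1, so bounded D bounds P, and the functions m(s)²/s² have a
common integrable majorant. Along a minimizing sequence the mass functions converge on a
subsequence. A limit state is produced without weak topologies: minimizing ∫ e^{-f} over
midpoint-convex sets generated by the tails yields an almost everywhere convergent selection
(`exists_ae_tendsto_of_midpoint_convex`). Fatou and convexity of Q give lower semicontinuity of P,
the truncation estimate shows that no mass concentrates locally, and dominated convergence gives
convergence of the fields.

Only mass at infinity can be lost. The map (x, v) ↦ (x/μ, v_r + μ v_⊥) preserves L, and composing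
with it for μ ≥ 1 multiplies the mass by μ and D by at least as favourable a factor: D becomes at
most μ D (`MemF.comp_radialStretch`). If the minimum is negative, a limit of smaller mass could be
stretched to mass M with energy below the minimum. Small γ serves exactly to make the minimum
negative (`exists_gamma_bound`).

For the dynamics no characteristic flow is constructed. Supports, and the preservation of spherical
symmetry, are controlled by maximum principles for f and for the Poisson equation. The Casimir
integral is conserved because the joint law of (L, f) under f dx dv is conserved, which is checked
on its characteristic function. -/

namespace CammStability

/-! ### Mass functions, field energy and potential of radial states -/

section Mass

variable {f g : Phase → ℝ}

theorem measurableSet_norm_fst_le (r : ℝ) : MeasurableSet {z : Phase | ‖z.1‖ ≤ r} :=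
  measurableSet_le (by fun_prop) measurable_const

theorem massIn_eq_setIntegral (hf : Integrable f) (r : ℝ) :
    massIn f r = ∫ z in {z : Phase | ‖z.1‖ ≤ r}, f z := by
  have hs : {z : Phase | ‖z.1‖ ≤ r} = Metric.closedBall (0 : E3) r ×ˢ (univ : Set E3) := by
    ext z; simp
  rw [hs, massIn, Measure.volume_eq_prod, setIntegral_prod]
  · simp [rho]
  · exact hf.integrableOn

theorem massIn_nonneg (hf : Integrable f) (h0 : ∀ᵐ z, 0 ≤ f z) (r : ℝ) : 0 ≤ massIn f r := by
  rw [massIn_eq_setIntegral hf]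
  exact integral_nonneg_of_ae (ae_restrict_of_ae h0)

theorem massIn_mono (hf : Integrable f) (h0 : ∀ᵐ z, 0 ≤ f z) : Monotone (massIn f) := by
  intro r s hrs
  rw [massIn_eq_setIntegral hf, massIn_eq_setIntegral hf]
  refine setIntegral_mono_set hf.integrableOn (ae_restrict_of_ae h0) (ae_of_all _ ?_)
  intro z hz
  exact le_trans (show ‖z.1‖ ≤ r from hz) hrs

theorem massIn_le_integral (hf : Integrable f) (h0 : ∀ᵐ z, 0 ≤ f z) (r : ℝ) :
    massIn f r ≤ ∫ z, f z := by
  rw [massIn_eq_setIntegral hf]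
  exact setIntegral_le_integral hf h0

theorem massIn_congr (h : f =ᵐ[volume] g) : massIn f = massIn g := by
  ext r
  have h2 : ∀ᵐ x : E3, rho f x = rho g x := by
    have : ∀ᵐ x : E3, ∀ᵐ v : E3, f (x, v) = g (x, v) := by
      rw [Measure.volume_eq_prod] at h
      exact Measure.ae_ae_of_ae_prod h
    filter_upwards [this] with x hx
    exact integral_congr_ae hx
  exact integral_congr_ae (ae_restrict_of_ae h2)

theorem volume_norm_fst_eq (r : ℝ) : volume {z : Phase | ‖z.1‖ = r} = 0 := by
  have hs : {z : Phase | ‖z.1‖ = r} = Metric.sphere (0 : E3) r ×ˢ (univ : Set E3) := by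
    ext z; simp
  rw [hs, Measure.volume_eq_prod, Measure.prod_prod, Measure.addHaar_sphere, zero_mul]

/-- Spheres are null sets, so the indicators of the balls converge almost everywhere as the radius
varies, and f itself dominates. -/
theorem continuous_massIn (hf : Integrable f) : Continuous (massIn f) := by
  have h1 : massIn f = fun r => ∫ z, {z : Phase | ‖z.1‖ ≤ r}.indicator f z := by
    ext r
    rw [massIn_eq_setIntegral hf, integral_indicator (measurableSet_norm_fst_le r)]
  rw [h1, continuous_iff_continuousAt]
  intro r
  refine tendsto_integral_filter_of_dominated_convergence (fun z => ‖f z‖) ?_ ?_ hf.norm ?_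
  · exact Eventually.of_forall fun s =>
      hf.aestronglyMeasurable.indicator (measurableSet_norm_fst_le s)
  · refine Eventually.of_forall fun s => ae_of_all _ fun z => ?_
    exact norm_indicator_le_norm_self _ _
  · have : ∀ᵐ z : Phase, ‖z.1‖ ≠ r := by
      rw [ae_iff]; simpa using volume_norm_fst_eq r
    filter_upwards [this] with z hz
    refine tendsto_const_nhds.congr' ?_
    rcases lt_or_gt_of_ne hz with h | h
    · filter_upwards [lt_mem_nhds h] with s hs
      rw [indicator_of_mem (show z ∈ {z : Phase | ‖z.1‖ ≤ r} from h.le),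
        indicator_of_mem (show z ∈ {z : Phase | ‖z.1‖ ≤ s} from hs.le)]
    · filter_upwards [gt_mem_nhds h] with s hs
      rw [indicator_of_notMem (show z ∉ {z : Phase | ‖z.1‖ ≤ r} from not_le.2 h),
        indicator_of_notMem (show z ∉ {z : Phase | ‖z.1‖ ≤ s} from not_le.2 hs)]

/-- Integration of a radial function in space in polar coordinates. -/
theorem integral_radial (φ : ℝ → ℝ) :
    ∫ x : E3, φ ‖x‖ = 4 * Real.pi * ∫ s in Ioi (0 : ℝ), s ^ 2 * φ s := by
  rw [integral_fun_norm_addHaar volume φ]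
  have : (volume : Measure E3).real (Metric.ball 0 1) = Real.pi * 4 / 3 := by
    rw [Measure.real, EuclideanSpace.volume_ball_fin_three]
    simp
    positivity
  rw [this]
  simp only [finrank_euclideanSpace, Fintype.card_fin, nsmul_eq_mul, smul_eq_mul]
  norm_num
  ring

/-- The factor ‖x‖⁻¹ * ‖x‖ is kept because it equals 1 only away from the origin; with it the
identity needs no case distinction. -/
theorem norm_fieldOf_sub (x : E3) :
    ‖fieldOf f x - fieldOf g x‖ ^ 2
      = ((massIn f ‖x‖ - massIn g ‖x‖) / ‖x‖ ^ 2 * (‖x‖⁻¹ * ‖x‖)) ^ 2 := by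
  rw [fieldOf, fieldOf, ← sub_smul, ← sub_div, norm_smul, norm_smul, mul_pow, Real.norm_eq_abs,
    sq_abs]
  simp [mul_pow]

theorem fieldDistSq_eq (f g : Phase → ℝ) :
    fieldDistSq f g = 4 * Real.pi * ∫ s in Ioi (0 : ℝ), (massIn f s - massIn g s) ^ 2 / s ^ 2 := by
  unfold fieldDistSq
  simp_rw [norm_fieldOf_sub]
  rw [integral_radial (fun s => ((massIn f s - massIn g s) / s ^ 2 * (s⁻¹ * s)) ^ 2)]
  congr 1
  refine setIntegral_congr_fun measurableSet_Ioi fun s hs => ?_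
  have : s ≠ 0 := ne_of_gt hs
  field_simp

theorem Epot_eq (f : Phase → ℝ) :
    Epot f = -(1 / 2) * ∫ s in Ioi (0 : ℝ), massIn f s ^ 2 / s ^ 2 := by
  have h := fieldDistSq_eq f (fun _ => 0)
  have h0 : ∀ x, fieldOf (fun _ => 0) x = 0 := by intro x; simp [fieldOf, massIn, rho]
  have h1 : ∀ s, massIn (fun _ => 0) s = 0 := by intro s; simp [massIn, rho]
  simp only [fieldDistSq, h0, h1, sub_zero] at h
  rw [Epot, h]
  have := Real.pi_ne_zero
  field_simp
  ring

theorem fieldDistSq_congr {f g g' : Phase → ℝ} (h : g =ᵐ[volume] g') :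
    fieldDistSq f g = fieldDistSq f g' := by
  rw [fieldDistSq_eq, fieldDistSq_eq, massIn_congr h]

/-- Fubini for the interaction of a density `h` with the radial potential whose derivative is
`N`. -/
theorem integral_mul_radial_potential {h : Phase → ℝ} (hh : Integrable h) {N : ℝ → ℝ}
    (hN : Measurable N) (hN0 : ∀ s, 0 ≤ N s)
    (hi : IntegrableOn (fun s => N s * massIn (fun z => ‖h z‖) s) (Ioi 0)) :
    Integrable (fun z => h z * ∫ s in Ioi ‖z.1‖, N s) ∧
      ∫ z, h z * (∫ s in Ioi ‖z.1‖, N s) = ∫ s in Ioi (0 : ℝ), N s * massIn h s := by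
  -- The integrand is spread over the region ‖x‖ ≤ s: slices at fixed z give the potential, slices
  -- at fixed s give the mass function.
  set S : Set (Phase × ℝ) := {p | ‖p.1.1‖ ≤ p.2} with hS
  have hSm : MeasurableSet S := measurableSet_le (by fun_prop) (by fun_prop)
  set F : Phase × ℝ → ℝ := S.indicator (fun p => h p.1 * N p.2) with hF
  set ν : Measure ℝ := volume.restrict (Ioi 0) with hν
  have hsec : ∀ s, (fun z => F (z, s)) = {z : Phase | ‖z.1‖ ≤ s}.indicator (fun z => h z * N s) := by
    intro s; ext z
    simp [F, S, indicator]
  have hFm : AEStronglyMeasurable F ((volume : Measure Phase).prod ν) := by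
    refine AEStronglyMeasurable.indicator ?_ hSm
    exact (hh.aestronglyMeasurable.comp_fst).mul
      (hN.aestronglyMeasurable.comp_snd (μ := volume) (ν := ν))
  have hFi : Integrable F ((volume : Measure Phase).prod ν) := by
    rw [integrable_prod_iff' hFm]
    constructor
    · refine ae_of_all _ fun s => ?_
      rw [hsec]
      exact (hh.mul_const _).indicator (measurableSet_norm_fst_le s)
    · refine hi.congr (ae_of_all _ fun s => ?_)
      have : (fun z => ‖F (z, s)‖) = {z : Phase | ‖z.1‖ ≤ s}.indicator (fun z => ‖h z‖ * N s) := by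
        ext z
        rw [show F (z, s) = (fun z => F (z, s)) z from rfl, hsec]
        simp only [norm_indicator_eq_indicator_norm, norm_mul, Real.norm_of_nonneg (hN0 s)]
      simp only [this]
      rw [integral_indicator (measurableSet_norm_fst_le s), integral_mul_const,
        massIn_eq_setIntegral hh.norm, mul_comm]
  have hin : ∀ z : Phase, ∫ s, F (z, s) ∂ν = h z * ∫ s in Ioi ‖z.1‖, N s := by
    intro z
    have : (fun s => F (z, s)) = (Ici ‖z.1‖).indicator (fun s => h z * N s) := by
      ext s; simp [F, S, indicator]
    rw [this, integral_indicator measurableSet_Ici, hν, Measure.restrict_restrict measurableSet_Ici,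
      integral_const_mul]
    congr 1
    refine setIntegral_congr_set ?_
    have h1 : (Ici ‖z.1‖ ∩ Ioi 0 : Set ℝ) =ᵐ[volume] (Ici ‖z.1‖ ∩ Ici 0 : Set ℝ) :=
      (ae_eq_refl _).inter Ioi_ae_eq_Ici
    have h2 : (Ici ‖z.1‖ ∩ Ici 0 : Set ℝ) = Ici ‖z.1‖ := by
      apply inter_eq_left.2
      exact Ici_subset_Ici.2 (norm_nonneg _)
    exact (h1.trans (Eq.eventuallyEq h2)).trans Ioi_ae_eq_Ici.symm
  constructor
  · refine hFi.integral_prod_left.congr (ae_of_all _ fun z => ?_)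
    exact hin z
  · simp_rw [← hin]
    rw [integral_integral_swap (f := fun z s => F (z, s)) hFi]
    refine integral_congr_ae (ae_of_all _ fun s => ?_)
    simp only [hsec]
    rw [integral_indicator (measurableSet_norm_fst_le s), integral_mul_const,
      massIn_eq_setIntegral hh, mul_comm]

end Mass

/-! ### The angular momentum -/

section AngularMomentum

theorem angL_nonneg (z : Phase) : 0 ≤ angL z := by
  have h := abs_real_inner_le_norm z.1 z.2
  have h2 := pow_le_pow_left₀ (abs_nonneg _) h 2
  rw [sq_abs, mul_pow] at h2
  unfold angL
  linarith

theorem angL_le (z : Phase) : angL z ≤ (‖z.1‖ * ‖z.2‖) ^ 2 := by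
  unfold angL
  nlinarith [sq_nonneg (⟪z.1, z.2⟫)]

theorem continuous_angL : Continuous angL := by
  unfold angL
  fun_prop

@[fun_prop]
theorem measurable_angL : Measurable angL := continuous_angL.measurable

theorem angL_smul (a b : ℝ) (x v : E3) : angL (a • x, b • v) = (a * b) ^ 2 * angL (x, v) := by
  simp only [angL, norm_smul, real_inner_smul_left, real_inner_smul_right, mul_pow, Real.norm_eq_abs,
    sq_abs]
  ring

theorem angL_isometry (A : E3 ≃ₗᵢ[ℝ] E3) (x v : E3) : angL (A x, A v) = angL (x, v) := by
  simp [angL, LinearIsometryEquiv.inner_map_map]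

theorem ae_fst_ne_zero : ∀ᵐ z : Phase, z.1 ≠ 0 := by
  rw [ae_iff]
  simpa using volume_norm_fst_eq 0

theorem finrank_E3 : Module.finrank ℝ E3 = 3 := by simp

/-- By the equality case of Cauchy–Schwarz, L vanishes for x ≠ 0 only when v lies on the line
through x, a proper subspace and hence a null set. This makes the powers L^l and L^{-l} mutually
inverse almost everywhere. -/
theorem ae_angL_pos : ∀ᵐ z : Phase, 0 < angL z := by
  have hm : MeasurableSet {z : Phase | 0 < angL z} := measurableSet_lt measurable_const measurable_angL
  rw [Measure.volume_eq_prod]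
  refine (Measure.ae_prod_iff_ae_ae hm).2 ?_
  have h0 : ∀ᵐ x : E3, x ≠ 0 := by
    rw [ae_iff]; simp
  filter_upwards [h0] with x hx
  have hs : (Submodule.span ℝ {x} : Submodule ℝ E3) ≠ ⊤ := by
    intro h
    have h1 : Module.finrank ℝ (Submodule.span ℝ {x} : Submodule ℝ E3) = 3 := by
      rw [h, finrank_top, finrank_E3]
    rw [finrank_span_singleton hx] at h1
    omega
  have hv : ∀ᵐ v : E3, v ∉ (Submodule.span ℝ {x} : Submodule ℝ E3) := by
    rw [ae_iff]
    simpa using Measure.addHaar_submodule volume _ hs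
  filter_upwards [hv] with v hv
  refine lt_of_le_of_ne (angL_nonneg _) fun h => hv ?_
  have hv0 : v ≠ 0 := by
    rintro rfl; exact hv (zero_mem _)
  have h3 : ‖⟪x, v⟫‖ = ‖x‖ * ‖v‖ := by
    have h4 : ‖⟪x, v⟫‖ ^ 2 = (‖x‖ * ‖v‖) ^ 2 := by
      rw [Real.norm_eq_abs, sq_abs, mul_pow]
      simp only [angL] at h
      linarith
    exact (sq_eq_sq₀ (norm_nonneg _) (by positivity)).1 h4
  obtain ⟨r, -, hr⟩ := (norm_inner_eq_norm_iff hx hv0).1 h3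
  rw [hr]
  exact Submodule.smul_mem _ _ (Submodule.mem_span_singleton_self x)

end AngularMomentum

/-! ### Linear changes of variables in phase space -/

section ChangeOfVariables

/-- Fibrewise linear maps with constant Jacobian rescale the volume of phase space. -/
theorem map_fibered_volume {a d : ℝ} (ha : 0 < a) (hd : 0 < d) (B : E3 → E3 →ₗ[ℝ] E3)
    (hT : Measurable fun z : Phase => (a • z.1, B z.1 z.2))
    (hdet : ∀ x, x ≠ 0 → LinearMap.det (B x) = d) :
    Measure.map (fun z : Phase => (a • z.1, B z.1 z.2)) volume
      = ENNReal.ofReal (a ^ 3 * d)⁻¹ • (volume : Measure Phase) := by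
  refine Measure.ext_of_lintegral _ fun g hg => ?_
  rw [lintegral_map hg hT, lintegral_smul_measure, Measure.volume_eq_prod,
    lintegral_prod (fun z : Phase => g (a • z.1, B z.1 z.2)) (hg.comp hT).aemeasurable, lintegral_prod _ hg.aemeasurable]
  have h0 : ∀ᵐ x : E3, x ≠ 0 := by
    rw [ae_iff]; simp
  have h1 : ∀ x : E3, x ≠ 0 → ∫⁻ v, g (a • x, B x v)
      = ENNReal.ofReal d⁻¹ * ∫⁻ v, g (a • x, v) := by
    intro x hx
    have hne : LinearMap.det (B x) ≠ 0 := by rw [hdet x hx]; exact hd.ne'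
    have h2 := Measure.map_linearMap_addHaar_eq_smul_addHaar (volume : Measure E3) hne
    have hmeas : Measurable fun v : E3 => g (a • x, v) := hg.comp (by fun_prop)
    have hB : Measurable (B x) := (LinearMap.continuous_of_finiteDimensional (B x)).measurable
    rw [← lintegral_map hmeas hB, h2, lintegral_smul_measure, hdet x hx,
      abs_of_pos (inv_pos.2 hd), smul_eq_mul]
  have h3 : ∫⁻ x : E3, ∫⁻ v, g (a • x, B x v)
      = ∫⁻ x : E3, ENNReal.ofReal d⁻¹ * ∫⁻ v, g (a • x, v) :=
    lintegral_congr_ae (h0.mono fun x hx => h1 x hx)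
  have hG : Measurable fun x : E3 => ∫⁻ v, g (x, v) := hg.lintegral_prod_right'
  have hGa : Measurable fun x : E3 => ∫⁻ v, g (a • x, v) := hG.comp (measurable_const_smul a)
  rw [h3, lintegral_const_mul _ hGa,
    ← lintegral_map (f := fun x : E3 => ∫⁻ v, g (x, v)) hG (measurable_const_smul a)]
  have h4 := Measure.map_addHaar_smul (volume : Measure E3) ha.ne'
  rw [h4, lintegral_smul_measure, finrank_E3, abs_of_pos (by positivity), smul_eq_mul, smul_eq_mul,
    ← mul_assoc, ← ENNReal.ofReal_mul (by positivity)]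
  congr 2
  field_simp

theorem measurable_scaling (a b : ℝ) : Measurable fun z : Phase => (a • z.1, b • z.2) := by
  fun_prop

theorem map_scaling_volume {a b : ℝ} (ha : 0 < a) (hb : 0 < b) :
    Measure.map (fun z : Phase => (a • z.1, b • z.2)) volume
      = ENNReal.ofReal ((a * b) ^ 3)⁻¹ • (volume : Measure Phase) := by
  have h := map_fibered_volume ha (pow_pos hb 3) (fun _ => b • (LinearMap.id : E3 →ₗ[ℝ] E3))
    (by simpa using measurable_scaling a b) (fun x _ => by
      rw [LinearMap.det_smul, LinearMap.det_id, finrank_E3, mul_one])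
  simpa [mul_pow] using h

end ChangeOfVariables

/-! ### Local integrability of the weight L^l -/

section Weight

/-- The set of all `(x, v)` with `‖x‖ ≤ r` and `‖v‖ ≤ V`. -/
def phaseBox (r V : ℝ) : Set Phase := Metric.closedBall 0 r ×ˢ Metric.closedBall 0 V

theorem mem_phaseBox {r V : ℝ} {z : Phase} : z ∈ phaseBox r V ↔ ‖z.1‖ ≤ r ∧ ‖z.2‖ ≤ V := by
  simp [phaseBox]

theorem isCompact_phaseBox (r V : ℝ) : IsCompact (phaseBox r V) :=
  (isCompact_closedBall _ _).prod (isCompact_closedBall _ _)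

theorem measurableSet_phaseBox (r V : ℝ) : MeasurableSet (phaseBox r V) :=
  (isCompact_phaseBox r V).measurableSet

theorem volume_phaseBox_lt_top (r V : ℝ) : volume (phaseBox r V) < ⊤ :=
  (isCompact_phaseBox r V).measure_lt_top

theorem exists_isometry_map_eq {x y : E3} (h : ‖x‖ = ‖y‖) : ∃ R : E3 ≃ₗᵢ[ℝ] E3, R x = y :=
  ⟨(ℝ ∙ (x - y))ᗮ.reflection, Submodule.reflection_sub h⟩

theorem ae_coord_ne_zero (i : Fin 3) : ∀ᵐ v : E3, v i ≠ 0 := by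
  have hs : (LinearMap.ker (EuclideanSpace.proj i : E3 →L[ℝ] ℝ).toLinearMap) ≠ ⊤ := by
    intro h
    have : EuclideanSpace.single i (1 : ℝ) ∈
        LinearMap.ker (EuclideanSpace.proj i : E3 →L[ℝ] ℝ).toLinearMap := by rw [h]; trivial
    simp at this
  rw [ae_iff]
  have := Measure.addHaar_submodule (volume : Measure E3) _ hs
  convert this using 2
  ext v
  simp

theorem integrableOn_abs_rpow {l : ℝ} (hl : -1 < l) :
    IntegrableOn (fun s : ℝ => |s| ^ l) (Icc (-1) 1) := by
  have h := (integrableOn_fun_norm_addHaar (volume : Measure ℝ) (f := fun s : ℝ => s ^ l)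
    (r := 2)).2 (by
      simp only [Module.finrank_self, Nat.sub_self, pow_zero, one_smul]
      have := (intervalIntegral.intervalIntegrable_rpow' (a := 0) (b := 2) hl)
      rw [intervalIntegrable_iff_integrableOn_Ioo_of_le (by norm_num)] at this
      exact this)
  refine IntegrableOn.mono_set (t := Metric.ball (0 : ℝ) 2) ?_ ?_
  · simpa using h
  · intro s hs
    rw [mem_ball_zero_iff, Real.norm_eq_abs, abs_lt]
    constructor <;> linarith [hs.1, hs.2]

theorem integrableOn_norm_rpow {l : ℝ} (hl : -1 < l) :
    IntegrableOn (fun x : E3 => ‖x‖ ^ (2 * l)) (Metric.closedBall 0 1) := by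
  have h := (integrableOn_fun_norm_addHaar (volume : Measure E3) (f := fun s : ℝ => s ^ (2 * l))
    (r := 2)).2 (by
      rw [finrank_E3]
      have := (intervalIntegral.intervalIntegrable_rpow' (a := 0) (b := 2)
        (show -1 < 2 + 2 * l by linarith))
      rw [intervalIntegrable_iff_integrableOn_Ioo_of_le (by norm_num)] at this
      refine this.congr_fun (fun s hs => ?_) measurableSet_Ioo
      have hs0 : 0 < s := hs.1
      simp only [smul_eq_mul]
      rw [Real.rpow_add hs0]
      norm_num)
  exact h.mono_set (Metric.closedBall_subset_ball (by norm_num))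

/-- A unit vector of `E3`. -/
noncomputable def unitVec : E3 := EuclideanSpace.single 0 1

theorem norm_unitVec : ‖unitVec‖ = 1 := by simp [unitVec]

theorem angL_unitVec (v : E3) : angL (unitVec, v) = v 1 ^ 2 + v 2 ^ 2 := by
  have h1 : ‖v‖ ^ 2 = v 0 ^ 2 + v 1 ^ 2 + v 2 ^ 2 := by
    rw [EuclideanSpace.norm_sq_eq, Fin.sum_univ_three]
    simp [sq_abs]
  have h2 : ⟪unitVec, v⟫ = v 0 := by
    simp [unitVec, EuclideanSpace.inner_single_left]
  simp only [angL, norm_unitVec, h1, h2]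
  ring

/-- Here L = v₁² + v₂² ≥ 2|v₁||v₂|, so for negative l the weight is dominated by 2^l |v₁|^l |v₂|^l,
a product of one-dimensional integrable functions because l > −1. -/
theorem integrable_angL_unitVec {l : ℝ} (hl : -1 < l) (hl0 : l < 0) :
    Integrable ((Metric.closedBall (0 : E3) 1).indicator fun v => angL (unitVec, v) ^ l) := by
  set p : Fin 3 → ℝ → ℝ := fun i => if i = 0 then (Icc (-1) 1).indicator (fun _ => 1)
    else (Icc (-1) 1).indicator (fun s => |s| ^ l) with hp
  have hp1 : ∀ i, Integrable (p i) := by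
    intro i
    simp only [hp]
    split_ifs
    · exact (integrable_indicator_iff measurableSet_Icc).2 (integrableOn_const (by simp))
    · exact (integrable_indicator_iff measurableSet_Icc).2 (integrableOn_abs_rpow hl)
  have hpi : Integrable (fun v : Fin 3 → ℝ => ∏ i, p i (v i)) := Integrable.fintype_prod hp1
  have hpe : Integrable (fun v : E3 => 2 ^ l * ∏ i, p i (v i)) :=
    ((EuclideanSpace.volume_preserving_symm_measurableEquiv_toLp (Fin 3)).integrable_comp_emb
      (MeasurableEquiv.measurableEmbedding _)).2 hpi |>.const_mul _
  refine hpe.mono' ?_ ?_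
  · refine (Measurable.indicator ?_ measurableSet_closedBall).aestronglyMeasurable
    exact (measurable_angL.comp (by fun_prop)).pow_const l
  · filter_upwards [ae_coord_ne_zero 1, ae_coord_ne_zero 2] with v h1 h2
    by_cases hv : v ∈ Metric.closedBall (0 : E3) 1
    · rw [indicator_of_mem hv, Real.norm_of_nonneg (Real.rpow_nonneg (angL_nonneg _) _)]
      have hc : ∀ i, v i ∈ Icc (-1 : ℝ) 1 := by
        intro i
        have := (PiLp.norm_apply_le v i).trans (mem_closedBall_zero_iff.1 hv)
        exact abs_le.1 this
      have hprod : ∏ i, p i (v i) = |v 1| ^ l * |v 2| ^ l := by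
        rw [Fin.prod_univ_three]
        simp [hp, hc]
      rw [hprod, angL_unitVec, ← Real.mul_rpow (abs_nonneg _) (abs_nonneg _),
        ← Real.mul_rpow (by norm_num) (by positivity)]
      refine Real.rpow_le_rpow_of_nonpos (by positivity) ?_ hl0.le
      have := sq_nonneg (|v 1| - |v 2|)
      rw [sub_sq, sq_abs, sq_abs] at this
      linarith
    · rw [indicator_of_notMem hv, norm_zero]
      have : ∀ i, 0 ≤ p i (v i) := by
        intro i
        simp only [hp]
        split_ifs
        · exact indicator_nonneg (fun _ _ => zero_le_one) _
        · exact indicator_nonneg (fun _ _ => by positivity) _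
      exact mul_nonneg (by positivity) (Finset.prod_nonneg fun i _ => this i)

theorem integrableOn_angL_rpow_unit {l : ℝ} (hl : -1 < l) :
    IntegrableOn (fun z => angL z ^ l) (phaseBox 1 1) := by
  have hm : Measurable fun z => angL z ^ l := measurable_angL.pow_const l
  rcases le_or_gt 0 l with h0 | h0
  · refine Measure.integrableOn_of_bounded (M := 1) (volume_phaseBox_lt_top 1 1).ne
      hm.aestronglyMeasurable ?_
    filter_upwards [ae_restrict_mem (measurableSet_phaseBox 1 1)] with z hz
    rw [mem_phaseBox] at hz
    rw [Real.norm_of_nonneg (Real.rpow_nonneg (angL_nonneg _) _)]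
    refine Real.rpow_le_one (angL_nonneg _) ((angL_le z).trans ?_) h0
    have : ‖z.1‖ * ‖z.2‖ ≤ 1 := mul_le_one₀ hz.1 (norm_nonneg _) hz.2
    exact pow_le_one₀ (by positivity) this
  · rw [← integrable_indicator_iff (measurableSet_phaseBox 1 1), Measure.volume_eq_prod]
    set G : E3 → ℝ := (Metric.closedBall (0 : E3) 1).indicator fun v => angL (unitVec, v) ^ l with hG
    have hGi : Integrable G := integrable_angL_unitVec hl h0
    -- An isometry taking x to ‖x‖ times the unit vector separates the variables: L^l becomes
    -- ‖x‖^{2l} times the weight at the unit vector, and the velocity integral does not see the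
    -- isometry.
    have key : ∀ x : E3, x ≠ 0 → ∃ R : E3 ≃ₗᵢ[ℝ] E3, ∀ v,
        (phaseBox 1 1).indicator (fun z => angL z ^ l) (x, v)
          = (Metric.closedBall (0 : E3) 1).indicator (fun x => ‖x‖ ^ (2 * l)) x * G (R v) := by
      intro x hx
      obtain ⟨R, hR⟩ := exists_isometry_map_eq (x := x) (y := ‖x‖ • unitVec)
        (by simp [norm_smul, norm_unitVec])
      refine ⟨R, fun v => ?_⟩
      have h1 : angL (x, v) ^ l = ‖x‖ ^ (2 * l) * angL (unitVec, R v) ^ l := by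
        have h2 : angL (x, v) = ‖x‖ ^ 2 * angL (unitVec, R v) := by
          rw [← angL_isometry R, hR]
          have := angL_smul ‖x‖ 1 unitVec (R v)
          rw [one_smul, mul_one] at this
          exact this
        rw [h2, Real.mul_rpow (by positivity) (angL_nonneg _), Real.rpow_mul (norm_nonneg _)]
        norm_num
      by_cases h3 : ‖x‖ ≤ 1 <;> by_cases h4 : ‖v‖ ≤ 1 <;>
        simp [hG, indicator, mem_phaseBox, h3, h4, h1]
    have h0' : ∀ᵐ x : E3, x ≠ 0 := by
      rw [ae_iff]; simp
    rw [integrable_prod_iff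
      ((hm.indicator (measurableSet_phaseBox 1 1)).aestronglyMeasurable)]
    constructor
    · filter_upwards [h0'] with x hx
      obtain ⟨R, hR⟩ := key x hx
      simp_rw [hR]
      exact ((R.measurePreserving.integrable_comp_emb
        R.toHomeomorph.measurableEmbedding).2 hGi).const_mul _
    · have : Integrable ((Metric.closedBall (0 : E3) 1).indicator fun x => ‖x‖ ^ (2 * l)) :=
        (integrable_indicator_iff measurableSet_closedBall).2 (integrableOn_norm_rpow hl)
      refine (this.norm.mul_const (∫ v, ‖G v‖)).congr ?_
      filter_upwards [h0'] with x hx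
      obtain ⟨R, hR⟩ := key x hx
      simp_rw [hR, norm_mul]
      rw [integral_const_mul, R.measurePreserving.integral_comp
        R.toHomeomorph.measurableEmbedding (fun v => ‖G v‖)]

theorem preimage_scaling_phaseBox {r V : ℝ} (hr : 0 < r) (hV : 0 < V) :
    (fun z : Phase => (r⁻¹ • z.1, V⁻¹ • z.2)) ⁻¹' phaseBox 1 1 = phaseBox r V := by
  ext z
  simp only [mem_preimage, mem_phaseBox, norm_smul, norm_inv, Real.norm_of_nonneg hr.le,
    Real.norm_of_nonneg hV.le]
  rw [inv_mul_le_iff₀ hr, inv_mul_le_iff₀ hV, mul_one, mul_one]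

theorem angL_scaling {r V : ℝ} (hr : 0 < r) (hV : 0 < V) (z : Phase) :
    angL z = (r * V) ^ 2 * angL (r⁻¹ • z.1, V⁻¹ • z.2) := by
  rw [angL_smul]
  field_simp

/-- The exponent collects (rV)³ from the volume and (rV)^{2l} from the homogeneity of L. The set D
is arbitrary because both the box and the shell of the test functions are rescaled. -/
theorem integral_angL_rpow_scaling {l : ℝ} {D : Set Phase} (hD : MeasurableSet D)
    (hi : IntegrableOn (fun z => angL z ^ l) D) {r V : ℝ} (hr : 0 < r) (hV : 0 < V) :
    IntegrableOn (fun z => angL z ^ l) ((fun z : Phase => (r⁻¹ • z.1, V⁻¹ • z.2)) ⁻¹' D) ∧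
      ∫ z in (fun z : Phase => (r⁻¹ • z.1, V⁻¹ • z.2)) ⁻¹' D, angL z ^ l
        = (∫ z in D, angL z ^ l) * (r * V) ^ (3 + 2 * l) := by
  set T : Phase → Phase := fun z => (r⁻¹ • z.1, V⁻¹ • z.2) with hT
  have hTm : Measurable T := measurable_scaling _ _
  have hmap := map_scaling_volume (inv_pos.2 hr) (inv_pos.2 hV)
  set F : Phase → ℝ := D.indicator fun z => angL z ^ l with hF
  have hFm : Measurable F := (measurable_angL.pow_const l).indicator hD
  have hFi : Integrable F := (integrable_indicator_iff hD).2 hi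
  have hpt : (T ⁻¹' D).indicator (fun z => angL z ^ l)
      = fun z => (r * V) ^ (2 * l) * F (T z) := by
    ext z
    by_cases h3 : T z ∈ D
    · rw [indicator_of_mem (show z ∈ T ⁻¹' D from h3), hF, indicator_of_mem h3,
        angL_scaling hr hV z, Real.mul_rpow (by positivity) (angL_nonneg _),
        Real.rpow_mul (by positivity)]
      norm_num [hT]
    · rw [indicator_of_notMem (show z ∉ T ⁻¹' D from h3), hF, indicator_of_notMem h3, mul_zero]
  have hFTi : Integrable fun z => F (T z) := by
    refine (integrable_map_measure hFm.aestronglyMeasurable hTm.aemeasurable).1 ?_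
    rw [hmap]
    exact hFi.smul_measure ENNReal.ofReal_ne_top
  constructor
  · rw [← integrable_indicator_iff (hTm hD), hpt]
    exact hFTi.const_mul _
  · rw [← integral_indicator (hTm hD), hpt, integral_const_mul,
      ← integral_map hTm.aemeasurable hFm.aestronglyMeasurable, hmap, integral_smul_measure,
      ← integral_indicator hD, ENNReal.toReal_ofReal (by positivity),
      add_comm 3, Real.rpow_add (by positivity), smul_eq_mul]
    norm_num
    field_simp
    rfl

theorem exists_integral_angL_rpow_le {l : ℝ} (hl : -1 < l) :
    ∃ c : ℝ, 0 ≤ c ∧ ∀ r V : ℝ, 0 < r → 0 < V →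
      IntegrableOn (fun z => angL z ^ l) (phaseBox r V) ∧
      ∫ z in phaseBox r V, angL z ^ l = c * (r * V) ^ (3 + 2 * l) := by
  refine ⟨∫ z in phaseBox 1 1, angL z ^ l,
    integral_nonneg fun z => Real.rpow_nonneg (angL_nonneg _) _, fun r V hr hV => ?_⟩
  have h := integral_angL_rpow_scaling (measurableSet_phaseBox 1 1)
    (integrableOn_angL_rpow_unit hl) hr hV
  rwa [preimage_scaling_phaseBox hr hV] at h

end Weight

/-! ### Casimir functional and the mass in small balls -/

section Casimir

variable {l : ℝ} {Q : ℝ → ℝ} {γ M : ℝ} {f g : Phase → ℝ}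

theorem CasimirAssumptions.map_zero (hQ : CasimirAssumptions l Q) : Q 0 = 0 := by
  obtain ⟨C₁, C₂, F₀, k₁, k₂, k₃, hC₁, hC₂, hF₀, hk₁, hk₂, hk₃, h1, h2, h3⟩ := hQ.growth
  have h := h2 0 le_rfl hF₀.le
  have hk : 1 + 1 / k₂ ≠ 0 := by
    have := hk₂.1
    positivity
  rw [Real.zero_rpow hk, mul_zero] at h
  exact le_antisymm h (hQ.nonneg 0 le_rfl)

theorem CasimirAssumptions.continuousOn (hQ : CasimirAssumptions l Q) : ContinuousOn Q (Ici 0) :=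
  hQ.contDiff_one.continuousOn

theorem CasimirAssumptions.convexOn (hQ : CasimirAssumptions l Q) : ConvexOn ℝ (Ici 0) Q := by
  have hint : interior (Ici (0 : ℝ)) = Ioi 0 := interior_Ici
  have h1 : DifferentiableOn ℝ Q (Ioi 0) := hQ.contDiff_two.differentiableOn (by norm_num)
  have h2 : ContDiffOn ℝ 1 (deriv Q) (Ioi 0) :=
    ((contDiffOn_succ_iff_deriv_of_isOpen (n := 1) isOpen_Ioi).1
      (by simpa [one_add_one_eq_two] using hQ.contDiff_two)).2.2
  refine convexOn_of_deriv2_nonneg (convex_Ici 0) hQ.continuousOn ?_ ?_ ?_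
  · rwa [hint]
  · rw [hint]; exact h2.differentiableOn (by norm_num)
  · rw [hint]
    intro x hx
    exact (hQ.deriv_two_pos x hx).le

/-- Where y exceeds Y, the growth bound gives y Y^{1/k} ≤ y^{1+1/k} ≤ Q(y)/C₁, so the excess over
level Y is paid for by Q with a factor that is small for large Y. Requiring Y ≥ F covers the case l
= 0, in which growth is known only for large y. -/
theorem CasimirAssumptions.exists_truncation (hQ : CasimirAssumptions l Q) :
    ∃ C k F : ℝ, 0 < C ∧ 0 < k ∧ k < l + 3 / 2 ∧ 0 < F ∧
      ∀ Y y, F ≤ Y → 0 ≤ y → y ≤ min y Y + C * Y ^ (-(1 / k)) * Q y := by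
  obtain ⟨C₁, C₂, F₀, k₁, k₂, k₃, hC₁, hC₂, hF₀, hk₁, hk₂, hk₃, h1, h2, h3⟩ := hQ.growth
  refine ⟨1 / C₁, k₁, F₀, by positivity, hk₁.1, hk₁.2, hF₀, fun Y y hY hy => ?_⟩
  have hY0 : 0 < Y := hF₀.trans_le hY
  rcases le_or_gt y Y with h | h
  · rw [min_eq_left h]
    have := hQ.nonneg y hy
    have : 0 ≤ 1 / C₁ * Y ^ (-(1 / k₁)) * Q y := by positivity
    linarith
  · rw [min_eq_right h.le]
    have hy0 : 0 < y := hY0.trans h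
    have h4 := h1 y hy fun _ => hY.trans h.le
    rw [Real.rpow_add hy0, Real.rpow_one] at h4
    have hk : 0 ≤ 1 / k₁ := by have := hk₁.1; positivity
    have h5 : Y ^ (1 / k₁) ≤ y ^ (1 / k₁) := Real.rpow_le_rpow hY0.le h.le hk
    have h6 : y * Y ^ (1 / k₁) ≤ 1 / C₁ * Q y := by
      rw [one_div_mul_eq_div, le_div_iff₀ hC₁]
      calc y * Y ^ (1 / k₁) * C₁ ≤ y * y ^ (1 / k₁) * C₁ := by gcongr
        _ ≤ Q y := by linarith
    have h7 : y ≤ 1 / C₁ * Y ^ (-(1 / k₁)) * Q y := by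
      rw [Real.rpow_neg hY0.le]
      have : 0 < Y ^ (1 / k₁) := by positivity
      calc y = (y * Y ^ (1 / k₁)) * (Y ^ (1 / k₁))⁻¹ := by field_simp
        _ ≤ (1 / C₁ * Q y) * (Y ^ (1 / k₁))⁻¹ := by gcongr
        _ = _ := by ring
    linarith

theorem casimirDensity_nonneg (hQ : CasimirAssumptions l Q) {z : Phase} (h : 0 ≤ f z) :
    0 ≤ casimirDensity l Q f z :=
  mul_nonneg (hQ.nonneg _ (mul_nonneg (Real.rpow_nonneg (angL_nonneg _) _) h))
    (Real.rpow_nonneg (angL_nonneg _) _)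

/-- The integrand of the positive part of the energy-Casimir functional. -/
noncomputable def posDensity (l : ℝ) (Q : ℝ → ℝ) (γ : ℝ) (f : Phase → ℝ) (z : Phase) : ℝ :=
  γ * (angL z * f z) + casimirDensity l Q f z + 1 / 2 * (‖z.2‖ ^ 2 * f z)

theorem posDensity_nonneg (hQ : CasimirAssumptions l Q) (hγ : 0 ≤ γ) {z : Phase} (h : 0 ≤ f z) :
    0 ≤ posDensity l Q γ f z := by
  have h1 := casimirDensity_nonneg hQ h
  have h2 := angL_nonneg z
  unfold posDensity
  positivity

theorem MemF.integrable_posDensity (hf : MemF l Q γ M f) : Integrable (posDensity l Q γ f) :=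
  (hf.finite_angL.add hf.finite_casimir).add (hf.finite_kin.const_mul _)

theorem MemF.posPart_eq (hf : MemF l Q γ M f) : posPart l Q γ f = ∫ z, posDensity l Q γ f z := by
  unfold posPart posDensity casimir Ekin
  rw [integral_add (by exact hf.finite_angL.add hf.finite_casimir)
    (hf.finite_kin.const_mul _), integral_add hf.finite_angL hf.finite_casimir,
    integral_const_mul, integral_const_mul]

theorem MemF.casimir_nonneg (hQ : CasimirAssumptions l Q) (hf : MemF l Q γ M f) :
    0 ≤ casimir l Q f :=
  integral_nonneg_of_ae (hf.nonneg.mono fun _ h => casimirDensity_nonneg hQ h)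

theorem MemF.kin_nonneg (hf : MemF l Q γ M f) : 0 ≤ ∫ z, ‖z.2‖ ^ 2 * f z :=
  integral_nonneg_of_ae (hf.nonneg.mono fun _ h => by positivity)

theorem MemF.casimir_add_Ekin_le (hγ : 0 ≤ γ) (hf : MemF l Q γ M f) :
    casimir l Q f + Ekin f ≤ posPart l Q γ f := by
  have : 0 ≤ ∫ z, angL z * f z :=
    integral_nonneg_of_ae (hf.nonneg.mono fun z h => mul_nonneg (angL_nonneg z) h)
  unfold posPart
  nlinarith [mul_nonneg hγ this]

theorem MemF.mass_nonneg (hf : MemF l Q γ M f) : 0 ≤ M :=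
  hf.mass ▸ integral_nonneg_of_ae hf.nonneg

/-- The part of `f` below the level `Y L^l`. -/
noncomputable def truncDensity (l Y : ℝ) (f : Phase → ℝ) (z : Phase) : ℝ :=
  angL z ^ l * min (angL z ^ (-l) * f z) Y

theorem truncDensity_nonneg {Y : ℝ} (hY : 0 ≤ Y) {z : Phase} (h : 0 ≤ f z) :
    0 ≤ truncDensity l Y f z :=
  mul_nonneg (Real.rpow_nonneg (angL_nonneg _) _)
    (le_min (mul_nonneg (Real.rpow_nonneg (angL_nonneg _) _) h) hY)

theorem truncDensity_le (Y : ℝ) (z : Phase) : truncDensity l Y f z ≤ angL z ^ l * Y :=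
  mul_le_mul_of_nonneg_left (min_le_right _ _) (Real.rpow_nonneg (angL_nonneg _) _)

theorem angL_rpow_mul_neg {z : Phase} (hz : 0 < angL z) (y : ℝ) :
    angL z ^ l * (angL z ^ (-l) * y) = y := by
  rw [← mul_assoc, ← Real.rpow_add hz, add_neg_cancel, Real.rpow_zero, one_mul]

theorem truncDensity_le_self {Y : ℝ} {z : Phase} (hz : 0 < angL z) :
    truncDensity l Y f z ≤ f z := by
  calc truncDensity l Y f z ≤ angL z ^ l * (angL z ^ (-l) * f z) :=
        mul_le_mul_of_nonneg_left (min_le_left _ _) (Real.rpow_nonneg (angL_nonneg _) _)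
    _ = f z := angL_rpow_mul_neg hz _

theorem aestronglyMeasurable_truncDensity {Y : ℝ} (hf : AEStronglyMeasurable f volume) :
    AEStronglyMeasurable (truncDensity l Y f) volume := by
  refine AEMeasurable.aestronglyMeasurable ?_
  have := hf.aemeasurable
  have h1 : Measurable fun z => angL z ^ l := measurable_angL.pow_const l
  have h2 : Measurable fun z => angL z ^ (-l) := measurable_angL.pow_const _
  exact h1.aemeasurable.mul ((h2.aemeasurable.mul this).min aemeasurable_const)

theorem integrableOn_truncDensity (hl : -1 < l) {Y : ℝ} (hY : 0 ≤ Y)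
    (hf : AEStronglyMeasurable f volume)
    (h0 : ∀ᵐ z, 0 ≤ f z) {r V : ℝ} (hr : 0 < r) (hV : 0 < V) :
    IntegrableOn (truncDensity l Y f) (phaseBox r V) := by
  obtain ⟨c, -, hc⟩ := exists_integral_angL_rpow_le hl
  refine Integrable.mono' ((hc r V hr hV).1.mul_const Y)
    (aestronglyMeasurable_truncDensity hf).restrict (ae_restrict_of_ae ?_)
  filter_upwards [h0] with z hz
  rw [Real.norm_of_nonneg (truncDensity_nonneg hY hz)]
  exact truncDensity_le Y z

/-- The mass in a ball is carried, up to errors controlled by the Casimir functional and the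
kinetic energy, by a bounded part of `f`. -/
theorem MemF.massIn_le_truncation (hl : -1 < l) (hQ : CasimirAssumptions l Q)
    (hf : MemF l Q γ M f) {C k F : ℝ} (hC : 0 < C) (hF : 0 < F)
    (htr : ∀ Y y, F ≤ Y → 0 ≤ y → y ≤ min y Y + C * Y ^ (-(1 / k)) * Q y)
    {r V Y : ℝ} (hr : 0 < r) (hV : 0 < V) (hY : F ≤ Y) :
    massIn f r ≤ (∫ z in phaseBox r V, truncDensity l Y f z)
      + C * Y ^ (-(1 / k)) * casimir l Q f + (V ^ 2)⁻¹ * ∫ z, ‖z.2‖ ^ 2 * f z := by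
  have hY0 : 0 < Y := hF.trans_le hY
  have hti := integrableOn_truncDensity hl hY0.le hf.integrable.aestronglyMeasurable
    hf.nonneg hr hV (f := f)
  rw [← integrable_indicator_iff (measurableSet_phaseBox r V)] at hti
  rw [massIn_eq_setIntegral hf.integrable, ← integral_indicator (measurableSet_norm_fst_le r),
    ← integral_indicator (measurableSet_phaseBox r V), casimir, ← integral_const_mul,
    ← integral_const_mul, ← integral_add hti (hf.finite_casimir.const_mul _),
    ← integral_add (by exact hti.add (hf.finite_casimir.const_mul _)) (hf.finite_kin.const_mul _)]
  refine integral_mono_ae (hf.integrable.indicator (measurableSet_norm_fst_le r))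
    ((hti.add (hf.finite_casimir.const_mul _)).add (hf.finite_kin.const_mul _)) ?_
  filter_upwards [hf.nonneg, ae_angL_pos] with z h0 hz
  have h1 : 0 ≤ (phaseBox r V).indicator (truncDensity l Y f) z :=
    indicator_apply_nonneg fun _ => truncDensity_nonneg hY0.le h0
  have hcas := casimirDensity_nonneg hQ h0
  have h2 : 0 ≤ C * Y ^ (-(1 / k)) * casimirDensity l Q f z := by positivity
  have h3 : 0 ≤ (V ^ 2)⁻¹ * (‖z.2‖ ^ 2 * f z) := by positivity
  by_cases hx : ‖z.1‖ ≤ r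
  · rw [indicator_of_mem (show z ∈ {z : Phase | ‖z.1‖ ≤ r} from hx)]
    -- Slow particles are estimated by truncation, fast ones by the kinetic energy through V² ≤
    -- ‖v‖².
    by_cases hv : ‖z.2‖ ≤ V
    · rw [indicator_of_mem (mem_phaseBox.2 ⟨hx, hv⟩)] at h1 ⊢
      have h4 := htr Y _ hY (mul_nonneg (Real.rpow_nonneg (angL_nonneg z) (-l)) h0)
      have h5 := mul_le_mul_of_nonneg_left h4 (Real.rpow_nonneg (angL_nonneg z) l)
      rw [angL_rpow_mul_neg hz] at h5
      have h6 : angL z ^ l * (min (angL z ^ (-l) * f z) Y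
          + C * Y ^ (-(1 / k)) * Q (angL z ^ (-l) * f z))
          = truncDensity l Y f z + C * Y ^ (-(1 / k)) * casimirDensity l Q f z := by
        unfold truncDensity casimirDensity
        ring
      rw [h6] at h5
      linarith
    · have h7 : f z ≤ (V ^ 2)⁻¹ * (‖z.2‖ ^ 2 * f z) := by
        rw [← div_eq_inv_mul, le_div_iff₀ (by positivity), mul_comm]
        have : V ^ 2 ≤ ‖z.2‖ ^ 2 := pow_le_pow_left₀ hV.le (not_le.1 hv).le 2
        exact mul_le_mul_of_nonneg_right this h0
      linarith
  · rw [indicator_of_notMem (show z ∉ {z : Phase | ‖z.1‖ ≤ r} from hx)]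
    linarith

/-- Power-law control of the mass in small balls by the Casimir functional and the kinetic
energy. -/
theorem exists_massIn_le_rpow (hl : -1 < l) (hQ : CasimirAssumptions l Q) :
    ∃ a θ C P₀ : ℝ, 1 / 2 < a ∧ 0 < θ ∧ θ < 1 ∧ 0 < C ∧ 1 ≤ P₀ ∧
      ∀ γ M f, MemF l Q γ M f → ∀ P, P₀ ≤ P → casimir l Q f + Ekin f ≤ P →
        ∀ r, 0 < r → r * P ^ θ ≤ 1 → massIn f r ≤ C * (r * P ^ θ) ^ a := by
  obtain ⟨C, k, F, hC, hk, hkl, hF, htr⟩ := hQ.exists_truncation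
  obtain ⟨c, hc0, hc⟩ := exists_integral_angL_rpow_le hl
  set n : ℝ := 3 + 2 * l with hn
  have hn1 : 1 < n := by rw [hn]; linarith
  -- This a solves n − na = a, which makes the box term at least as small as the other two; a > 1/2
  -- is equivalent to n > 1, that is, to l > −1.
  set a : ℝ := n / (n + 1) with ha
  -- This θ cancels the power of P in (rV)^n Y, and θ < 1 is exactly k < l + 3/2.
  set θ : ℝ := (k + n / 2) / n with hθ
  have ha0 : 0 < a := by positivity
  refine ⟨a, θ, c + C + 2, max 1 (F ^ (1 / k)), ?_, by positivity, ?_, by positivity,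
    le_max_left _ _, ?_⟩
  · rw [ha, div_lt_div_iff₀ (by norm_num) (by linarith)]; linarith
  · rw [hθ, div_lt_one (by linarith)]; linarith
  intro γ M f hf P hP hfP r hr hrP
  have hP1 : 1 ≤ P := (le_max_left _ _).trans hP
  have hP0 : 0 < P := by linarith
  have hPF : F ≤ P ^ k := by
    have h := Real.rpow_le_rpow (by positivity) ((le_max_right _ _).trans hP) hk.le
    rwa [← Real.rpow_mul hF.le, one_div_mul_cancel hk.ne', Real.rpow_one] at h
  set u : ℝ := r * P ^ θ with hu
  have hu0 : 0 < u := by positivity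
  -- V and Y are chosen so that 1/V² and Y^{-1/k} both equal u^a / P, whence the kinetic and Casimir
  -- errors are multiples of u^a.
  set V : ℝ := P ^ (1 / 2 : ℝ) * u ^ (-(a / 2)) with hV
  set Y : ℝ := P ^ k * u ^ (-(k * a)) with hY
  have hV0 : 0 < V := by positivity
  have hY0 : 0 < Y := by positivity
  have hFY : F ≤ Y := by
    have h1 : 1 ≤ u ^ (-(k * a)) :=
      Real.one_le_rpow_of_pos_of_le_one_of_nonpos hu0 hrP (by have := mul_pos hk ha0; linarith)
    calc F ≤ P ^ k * 1 := by rwa [mul_one]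
      _ ≤ Y := by rw [hY]; gcongr
  have main := hf.massIn_le_truncation hl hQ hC hF htr hr hV0 hFY
  have hua : 0 < u ^ a := by positivity
  have t1 : ∫ z in phaseBox r V, truncDensity l Y f z ≤ c * u ^ a := by
    have h1 : ∫ z in phaseBox r V, truncDensity l Y f z ≤ ∫ z in phaseBox r V, angL z ^ l * Y :=
      setIntegral_mono_on (integrableOn_truncDensity hl hY0.le
        hf.integrable.aestronglyMeasurable hf.nonneg hr hV0)
        ((hc r V hr hV0).1.mul_const Y) (measurableSet_phaseBox r V)
        fun z _ => truncDensity_le Y z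
    rw [integral_mul_const, (hc r V hr hV0).2] at h1
    refine h1.trans ?_
    rw [mul_assoc]
    refine mul_le_mul_of_nonneg_left ?_ hc0
    have h2 : r = u * P ^ (-θ) := by
      rw [hu, mul_assoc, ← Real.rpow_add hP0, add_neg_cancel, Real.rpow_zero, mul_one]
    have h3 : r * V = u ^ (1 - a / 2) * P ^ (1 / 2 - θ) := by
      rw [hV, h2, sub_eq_add_neg, sub_eq_neg_add, Real.rpow_add hu0, Real.rpow_add hP0,
        Real.rpow_one]
      ring
    have h4 : (r * V) ^ n * Y = u ^ ((1 - a / 2) * n + -(k * a)) := by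
      rw [h3, Real.mul_rpow (by positivity) (by positivity), ← Real.rpow_mul hu0.le,
        ← Real.rpow_mul hP0.le, hY]
      calc u ^ ((1 - a / 2) * n) * P ^ ((1 / 2 - θ) * n) * (P ^ k * u ^ (-(k * a)))
          = (u ^ ((1 - a / 2) * n) * u ^ (-(k * a))) * (P ^ ((1 / 2 - θ) * n) * P ^ k) := by ring
        _ = u ^ ((1 - a / 2) * n + -(k * a)) := by
            rw [← Real.rpow_add hu0, ← Real.rpow_add hP0]
            have : (1 / 2 - θ) * n + k = 0 := by rw [hθ]; field_simp; ring
            rw [this, Real.rpow_zero, mul_one]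
    rw [h4]
    -- Since u ≤ 1 it suffices that the exponent is at least a, which follows from k < n/2 and n −
    -- na = a.
    refine Real.rpow_le_rpow_of_exponent_ge hu0 hrP ?_
    have h5 : n - n * a = a := by rw [ha]; field_simp; ring
    have h6 : k * a ≤ n / 2 * a := by gcongr; linarith
    nlinarith
  have t2 : C * Y ^ (-(1 / k)) * casimir l Q f ≤ C * u ^ a := by
    have h1 : Y ^ (-(1 / k)) = P⁻¹ * u ^ a := by
      rw [hY, Real.mul_rpow (by positivity) (by positivity), ← Real.rpow_mul hP0.le,
        ← Real.rpow_mul hu0.le, ← Real.rpow_neg_one]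
      congr 2 <;> field_simp
    have h2 : casimir l Q f ≤ P := by
      have : 0 ≤ Ekin f := mul_nonneg (by norm_num) hf.kin_nonneg
      linarith
    rw [h1]
    calc C * (P⁻¹ * u ^ a) * casimir l Q f ≤ C * (P⁻¹ * u ^ a) * P := by gcongr
      _ = C * u ^ a := by field_simp
  have t3 : (V ^ 2)⁻¹ * ∫ z, ‖z.2‖ ^ 2 * f z ≤ 2 * u ^ a := by
    have h1 : (V ^ 2)⁻¹ = P⁻¹ * u ^ a := by
      rw [hV, mul_pow, ← Real.rpow_natCast (P ^ _), ← Real.rpow_natCast (u ^ _),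
        ← Real.rpow_mul hP0.le, ← Real.rpow_mul hu0.le, mul_inv, ← Real.rpow_neg hu0.le]
      norm_num
    have h2 : ∫ z, ‖z.2‖ ^ 2 * f z ≤ 2 * P := by
      have := hf.casimir_nonneg hQ
      unfold Ekin at hfP
      linarith
    rw [h1]
    calc P⁻¹ * u ^ a * ∫ z, ‖z.2‖ ^ 2 * f z ≤ P⁻¹ * u ^ a * (2 * P) := by gcongr
      _ = 2 * u ^ a := by field_simp
  linarith

end Casimir

/-! ### An integrable majorant for the field energy density -/

section FieldEnergy

/-- Majorant of `m(s)² / s²` for a mass function with `m(s) ≤ C (s/ρ)^a` near the origin. -/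
noncomputable def fieldMajorant (C a ρ M s : ℝ) : ℝ :=
  if s ≤ ρ then C ^ 2 * (s / ρ) ^ (2 * a) / s ^ 2 else M ^ 2 / s ^ 2

/-- The condition a > 1/2 is what makes s^{2a−2} integrable at the origin. The value scales like
1/ρ, so ρ = P^{-θ} will produce a bound of order P^θ. -/
theorem integrableOn_fieldMajorant {C a ρ M : ℝ} (ha : 1 / 2 < a) (hρ : 0 < ρ) :
    IntegrableOn (fieldMajorant C a ρ M) (Ioi 0) ∧
      ∫ s in Ioi 0, fieldMajorant C a ρ M s = (C ^ 2 / (2 * a - 1) + M ^ 2) / ρ := by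
  have hsplit : Ioi (0 : ℝ) = Ioc 0 ρ ∪ Ioi ρ := (Ioc_union_Ioi_eq_Ioi hρ.le).symm
  have hdisj : Disjoint (Ioc 0 ρ) (Ioi ρ) := by
    rw [Set.disjoint_left]; intro x hx hx'; exact not_lt.2 hx.2 hx'
  have h1 : EqOn (fieldMajorant C a ρ M) (fun s => C ^ 2 * ρ ^ (-(2 * a)) * s ^ (2 * a - 2))
      (Ioc 0 ρ) := by
    intro s hs
    have hs0 : 0 < s := hs.1
    simp only [fieldMajorant, if_pos hs.2]
    rw [Real.div_rpow hs0.le hρ.le, Real.rpow_sub hs0, Real.rpow_neg hρ.le]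
    norm_num
    ring
  have h2 : EqOn (fieldMajorant C a ρ M) (fun s => M ^ 2 * s ^ (-2 : ℝ)) (Ioi ρ) := by
    intro s hs
    have hs0 : 0 < s := hρ.trans hs
    simp only [fieldMajorant, if_neg (not_le.2 (mem_Ioi.1 hs))]
    rw [Real.rpow_neg hs0.le]
    norm_num
    ring
  have i1 : IntegrableOn (fun s : ℝ => C ^ 2 * ρ ^ (-(2 * a)) * s ^ (2 * a - 2)) (Ioc 0 ρ) := by
    have := (intervalIntegral.intervalIntegrable_rpow' (a := 0) (b := ρ)
      (show -1 < 2 * a - 2 by linarith)).const_mul (C ^ 2 * ρ ^ (-(2 * a)))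
    rwa [intervalIntegrable_iff_integrableOn_Ioc_of_le hρ.le] at this
  have i2 : IntegrableOn (fun s : ℝ => M ^ 2 * s ^ (-2 : ℝ)) (Ioi ρ) :=
    (integrableOn_Ioi_rpow_of_lt (by norm_num) hρ).const_mul _
  have j1 := i1.congr_fun h1.symm measurableSet_Ioc
  have j2 := i2.congr_fun h2.symm measurableSet_Ioi
  refine ⟨hsplit ▸ j1.union j2, ?_⟩
  rw [hsplit, setIntegral_union hdisj measurableSet_Ioi j1 j2,
    setIntegral_congr_fun measurableSet_Ioc h1, setIntegral_congr_fun measurableSet_Ioi h2,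
    integral_const_mul, integral_const_mul, ← intervalIntegral.integral_of_le hρ.le,
    integral_rpow (Or.inl (by linarith)), integral_Ioi_rpow_of_lt (by norm_num) hρ]
  have h3 : (0 : ℝ) ^ (2 * a - 2 + 1) = 0 := Real.zero_rpow (by linarith)
  have h4 : ρ ^ (2 * a - 2 + 1) = ρ ^ (2 * a) / ρ := by
    rw [show 2 * a - 2 + 1 = 2 * a - 1 by ring, Real.rpow_sub_one hρ.ne']
  have h5 : ρ ^ (-2 + 1 : ℝ) = ρ⁻¹ := by norm_num [Real.rpow_neg_one]
  rw [h3, h4, h5, Real.rpow_neg hρ.le]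
  have h6 : 2 * a - 1 ≠ 0 := by linarith
  have h7 : 2 * a - 2 + 1 = 2 * a - 1 := by ring
  have h8 : (0 : ℝ) < ρ ^ (2 * a) := by positivity
  rw [h7, add_div]
  norm_num
  field_simp

theorem sq_div_sq_le_fieldMajorant {C a ρ M m s : ℝ} (hρ : 0 < ρ) (hs : 0 < s)
    (hM : m ^ 2 ≤ M ^ 2) (hm : s * ρ⁻¹ ≤ 1 → m ^ 2 ≤ (C * (s * ρ⁻¹) ^ a) ^ 2) :
    m ^ 2 / s ^ 2 ≤ fieldMajorant C a ρ M s := by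
  unfold fieldMajorant
  split_ifs with h
  · have h1 := hm (by rw [← div_eq_mul_inv]; exact div_le_one_of_le₀ h hρ.le)
    rw [mul_pow, ← Real.rpow_natCast ((s * ρ⁻¹) ^ a), ← Real.rpow_mul (by positivity)] at h1
    rw [div_eq_mul_inv s ρ]
    gcongr
    rwa [show 2 * a = a * ((2 : ℕ) : ℝ) by push_cast; ring]
  · gcongr

end FieldEnergy

/-! ### Deviation formula and coercivity of the energy -/

section Deviation

variable {l : ℝ} {Q : ℝ → ℝ} {γ M : ℝ} {f g : Phase → ℝ}

theorem MemF.massIn_nonneg (hf : MemF l Q γ M f) (s : ℝ) : 0 ≤ massIn f s :=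
  CammStability.massIn_nonneg hf.integrable hf.nonneg s

theorem MemF.massIn_le (hf : MemF l Q γ M f) (s : ℝ) : massIn f s ≤ M :=
  (massIn_le_integral hf.integrable hf.nonneg s).trans hf.mass.le

/-- A common integrable majorant for the field energy densities of all `f` with
controlled Casimir functional and kinetic energy. -/
theorem exists_uniform_majorant (hl : -1 < l) (hQ : CasimirAssumptions l Q) :
    ∃ a θ C P₀ : ℝ, 1 / 2 < a ∧ 0 < θ ∧ θ < 1 ∧ 1 ≤ P₀ ∧
      ∀ γ M f, MemF l Q γ M f → ∀ P, P₀ ≤ P → casimir l Q f + Ekin f ≤ P →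
        ∀ s, 0 < s → massIn f s ^ 2 / s ^ 2 ≤ fieldMajorant C a (P ^ (-θ)) M s := by
  obtain ⟨a, θ, C, P₀, ha, hθ, hθ1, hC, hP₀, h⟩ := exists_massIn_le_rpow hl hQ
  refine ⟨a, θ, C, P₀, ha, hθ, hθ1, hP₀, fun γ M f hf P hP hfP s hs => ?_⟩
  have hP0 : 0 < P := by linarith
  refine sq_div_sq_le_fieldMajorant (by positivity) hs ?_ ?_
  · exact pow_le_pow_left₀ (hf.massIn_nonneg s) (hf.massIn_le s) 2
  · intro h1
    rw [Real.rpow_neg hP0.le, inv_inv] at h1 ⊢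
    exact pow_le_pow_left₀ (hf.massIn_nonneg s) (h γ M f hf P hP hfP s hs h1) 2

theorem aestronglyMeasurable_massIn_mul (hf : Integrable f) (hg : Integrable g) (μ : Measure ℝ) :
    AEStronglyMeasurable (fun s => massIn f s * massIn g s / s ^ 2) μ := by
  have h1 := (continuous_massIn hf).measurable
  have h2 := (continuous_massIn hg).measurable
  exact ((h1.mul h2).div (by fun_prop)).aestronglyMeasurable

theorem MemF.integrableOn_massIn_sq (hl : -1 < l) (hQ : CasimirAssumptions l Q)
    (hf : MemF l Q γ M f) : IntegrableOn (fun s => massIn f s ^ 2 / s ^ 2) (Ioi 0) := by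
  obtain ⟨a, θ, C, P₀, ha, hθ, hθ1, hP₀, h⟩ := exists_uniform_majorant hl hQ
  have h1 := h γ M f hf _ (le_max_left P₀ (casimir l Q f + Ekin f)) (le_max_right _ _)
  have hP : 0 < max P₀ (casimir l Q f + Ekin f) := by
    have := le_max_left P₀ (casimir l Q f + Ekin f)
    linarith
  refine Integrable.mono' (integrableOn_fieldMajorant (C := C) (M := M) ha
    (Real.rpow_pos_of_pos hP (-θ))).1 ?_ ?_
  · simpa only [sq] using aestronglyMeasurable_massIn_mul hf.integrable hf.integrable _
  · filter_upwards [ae_restrict_mem measurableSet_Ioi] with s hs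
    rw [Real.norm_of_nonneg (by positivity)]
    exact h1 s hs

theorem MemF.integrableOn_massIn_mul {M' : ℝ} (hl : -1 < l) (hQ : CasimirAssumptions l Q)
    (hf : MemF l Q γ M f) (hg : MemF l Q γ M' g) :
    IntegrableOn (fun s => massIn f s * massIn g s / s ^ 2) (Ioi 0) := by
  refine Integrable.mono' ((hf.integrableOn_massIn_sq hl hQ).add (hg.integrableOn_massIn_sq hl hQ))
    (aestronglyMeasurable_massIn_mul hf.integrable hg.integrable _) (ae_of_all _ fun s => ?_)
  have h1 := hf.massIn_nonneg s
  have h2 := hg.massIn_nonneg s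
  rw [Real.norm_of_nonneg (by positivity)]
  simp only [Pi.add_apply]
  rw [← add_div]
  gcongr
  nlinarith [sq_nonneg (massIn f s - massIn g s)]

/-- Fubini puts the interaction energy into a form symmetric in the two mass functions, so that it
becomes the cross term of the squared field difference. -/
theorem MemF.integral_mul_potOf {M' : ℝ} (hl : -1 < l) (hQ : CasimirAssumptions l Q)
    (hf : MemF l Q γ M f) (hg : MemF l Q γ M' g) :
    Integrable (fun z => f z * potOf g z.1) ∧
      ∫ z, f z * potOf g z.1 = -∫ s in Ioi (0 : ℝ), massIn g s * massIn f s / s ^ 2 := by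
  have hN : Measurable fun s => massIn g s / s ^ 2 :=
    (continuous_massIn hg.integrable).measurable.div (by fun_prop)
  have hN0 : ∀ s, 0 ≤ massIn g s / s ^ 2 := fun s => by
    have := hg.massIn_nonneg s
    positivity
  have habs : massIn (fun z => ‖f z‖) = massIn f :=
    massIn_congr (hf.nonneg.mono fun z hz => Real.norm_of_nonneg hz)
  have h := integral_mul_radial_potential hf.integrable hN hN0 (by
    rw [habs]
    refine (hg.integrableOn_massIn_mul hl hQ hf).congr (ae_of_all _ fun s => ?_)
    simp only
    ring)
  constructor
  · simpa [potOf] using h.1.neg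
  · simp only [potOf, mul_neg, integral_neg]
    rw [h.2]
    congr 1
    refine integral_congr_ae (ae_of_all _ fun s => ?_)
    simp only
    ring

/-- The deviation of `f` from `f₀` is the excess energy plus the squared field distance. -/
theorem MemF.deviation_eq {f₀ : Phase → ℝ} (hl : -1 < l) (hQ : CasimirAssumptions l Q)
    (hf : MemF l Q γ M f) (h₀ : MemF l Q γ M f₀) :
    deviation l Q γ M f f₀ = energyCasimir l Q γ f - energyCasimir l Q γ f₀
      + 1 / (4 * Real.pi) * fieldDistSq f f₀ := by
  obtain ⟨i1, e1⟩ := hf.integral_mul_potOf hl hQ h₀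
  obtain ⟨i2, e2⟩ := h₀.integral_mul_potOf hl hQ h₀
  have hd : dFun l Q γ M f f₀ = posPart l Q γ f - posPart l Q γ f₀
      + ((∫ z, f z * potOf f₀ z.1) - ∫ z, f₀ z * potOf f₀ z.1) := by
    -- The integrand splits into the positive part, the interaction with the potential, and a
    -- multiple of f − f₀ whose integral vanishes because the masses agree.
    have e3 : ∀ z, casimirDensity l Q f z - casimirDensity l Q f₀ z +
        (partE f₀ z + γ * angL z - cutE l Q γ M f₀) * (f z - f₀ z)
        = ((posDensity l Q γ f z - posDensity l Q γ f₀ z)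
          + (f z * potOf f₀ z.1 - f₀ z * potOf f₀ z.1))
          - cutE l Q γ M f₀ * (f z - f₀ z) := by
      intro z
      unfold posDensity partE
      ring
    have ip := hf.integrable_posDensity.sub h₀.integrable_posDensity
    have iq := i1.sub i2
    unfold dFun
    simp_rw [e3]
    rw [integral_sub (by exact ip.add iq) (by exact (hf.integrable.sub h₀.integrable).const_mul _),
      integral_add (by exact ip) (by exact iq),
      integral_sub hf.integrable_posDensity h₀.integrable_posDensity,
      integral_sub i1 i2, integral_const_mul, integral_sub hf.integrable h₀.integrable,
      hf.mass, h₀.mass, hf.posPart_eq, h₀.posPart_eq]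
    ring
  have j1 := hf.integrableOn_massIn_sq hl hQ
  have j2 := hf.integrableOn_massIn_mul hl hQ h₀
  have j3 := h₀.integrableOn_massIn_sq hl hQ
  have hfd : fieldDistSq f f₀ = 4 * Real.pi * ((∫ s in Ioi (0 : ℝ), massIn f s ^ 2 / s ^ 2)
      - 2 * (∫ s in Ioi (0 : ℝ), massIn f s * massIn f₀ s / s ^ 2)
      + ∫ s in Ioi (0 : ℝ), massIn f₀ s ^ 2 / s ^ 2) := by
    rw [fieldDistSq_eq, ← integral_const_mul 2, ← integral_sub j1 (j2.const_mul 2),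
      ← integral_add (by exact j1.sub (j2.const_mul 2)) j3]
    congr 1
    refine integral_congr_ae (ae_of_all _ fun s => ?_)
    simp only
    ring
  have e4 : ∫ s in Ioi (0 : ℝ), massIn f₀ s * massIn f s / s ^ 2
      = ∫ s in Ioi (0 : ℝ), massIn f s * massIn f₀ s / s ^ 2 := by
    simp_rw [mul_comm (massIn f₀ _)]
  have e5 : ∫ s in Ioi (0 : ℝ), massIn f₀ s * massIn f₀ s / s ^ 2
      = ∫ s in Ioi (0 : ℝ), massIn f₀ s ^ 2 / s ^ 2 := by
    simp_rw [sq (massIn f₀ _)]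
  unfold deviation energyCasimir
  rw [hd, e1, e2, e4, e5, hfd, Epot_eq, Epot_eq]
  have := Real.pi_ne_zero
  field_simp
  ring

/-- The field energy grows at most like the power θ < 1 of the positive part, so it cannot
compensate a large positive part. The bound is uniform in γ. -/
theorem exists_posPart_le (hl : -1 < l) (hQ : CasimirAssumptions l Q) (M B : ℝ) :
    ∃ P, ∀ γ f, 0 ≤ γ → MemF l Q γ M f → energyCasimir l Q γ f ≤ B → posPart l Q γ f ≤ P := by
  obtain ⟨a, θ, C, P₀, ha, hθ, hθ1, hP₀, h⟩ := exists_uniform_majorant hl hQ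
  set c : ℝ := C ^ 2 / (2 * a - 1) + M ^ 2 with hc
  have hc0 : 0 ≤ c := by
    have : 0 < 2 * a - 1 := by linarith
    positivity
  refine ⟨max (c ^ (1 / (1 - θ))) (2 * B + P₀), fun γ f hγ hf hB => ?_⟩
  have hp := hf.casimir_add_Ekin_le hγ
  have hp0 : 0 ≤ posPart l Q γ f := by
    have h1 := hf.casimir_nonneg hQ
    have h2 : 0 ≤ Ekin f := mul_nonneg (by norm_num) hf.kin_nonneg
    linarith
  -- Adding P₀ puts X into the range where the majorant is available. Above the threshold
  -- c^{1/(1−θ)} one has c X^θ ≤ X, so half of the positive part survives in D.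
  set X : ℝ := posPart l Q γ f + P₀ with hX
  have hX0 : 0 < X := by linarith
  rcases le_or_gt X (c ^ (1 / (1 - θ))) with hcase | hcase
  · exact le_max_of_le_left (by linarith)
  · refine le_max_of_le_right ?_
    have hmaj := h γ M f hf X (by linarith) (by linarith)
    obtain ⟨i1, e1⟩ := integrableOn_fieldMajorant (C := C) (M := M) ha
      (Real.rpow_pos_of_pos hX0 (-θ))
    have hW : ∫ s in Ioi (0 : ℝ), massIn f s ^ 2 / s ^ 2 ≤ c * X ^ θ := by
      calc ∫ s in Ioi (0 : ℝ), massIn f s ^ 2 / s ^ 2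
          ≤ ∫ s in Ioi 0, fieldMajorant C a (X ^ (-θ)) M s :=
            setIntegral_mono_on (hf.integrableOn_massIn_sq hl hQ) i1 measurableSet_Ioi hmaj
        _ = c * X ^ θ := by
            rw [e1, Real.rpow_neg hX0.le, div_inv_eq_mul]
    have hcX : c * X ^ θ ≤ X := by
      have h1 : c ≤ X ^ (1 - θ) := by
        have := Real.rpow_le_rpow (by positivity) hcase.le (show 0 ≤ 1 - θ by linarith)
        rwa [← Real.rpow_mul hc0, one_div_mul_cancel (by linarith), Real.rpow_one] at this
      calc c * X ^ θ ≤ X ^ (1 - θ) * X ^ θ := by gcongr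
        _ = X := by rw [← Real.rpow_add hX0, sub_add_cancel, Real.rpow_one]
    unfold energyCasimir at hB
    rw [Epot_eq] at hB
    linarith

end Deviation

/-! ### Stretching in the radial direction at fixed angular momentum -/

section Stretching

variable {l : ℝ} {Q : ℝ → ℝ} {γ M μ : ℝ} {f g : Phase → ℝ}

/-- The velocity map `v ↦ v_r + μ v_⊥`, in terms of the radial and tangential parts with respect
to `x`. -/
noncomputable def tangentialStretch (μ : ℝ) (x : E3) : E3 →ₗ[ℝ] E3 :=
  μ • LinearMap.transvection (((1 - μ) / (μ * ‖x‖ ^ 2)) • (innerₗ E3 x)) x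

theorem tangentialStretch_apply (hμ : μ ≠ 0) (x v : E3) :
    tangentialStretch μ x v = μ • v + ((1 - μ) * (⟪x, v⟫ / ‖x‖ ^ 2)) • x := by
  simp only [tangentialStretch, LinearMap.smul_apply, LinearMap.transvection.apply, smul_add,
    innerₗ_apply_apply, smul_smul, smul_eq_mul]
  congr 2
  field_simp

/-- The radial direction is fixed and the two tangential ones are scaled by μ. Written as μ times a
rank-one perturbation of the identity, the determinant is μ³ · μ⁻¹. -/
theorem det_tangentialStretch (hμ : 0 < μ) {x : E3} (hx : x ≠ 0) :
    LinearMap.det (tangentialStretch μ x) = μ ^ 2 := by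
  have : ‖x‖ ≠ 0 := norm_ne_zero_iff.2 hx
  rw [tangentialStretch, LinearMap.det_smul, LinearMap.transvection.det, finrank_E3]
  simp only [LinearMap.smul_apply, innerₗ_apply_apply, real_inner_self_eq_norm_sq, smul_eq_mul]
  field_simp
  ring

/-- The map `(r, v_r, L) ↦ (r / μ, v_r, L)` of phase space. -/
noncomputable def radialStretch (μ : ℝ) (z : Phase) : Phase :=
  (μ⁻¹ • z.1, tangentialStretch μ z.1 z.2)

theorem measurable_radialStretch (hμ : μ ≠ 0) : Measurable (radialStretch μ) := by
  have : radialStretch μ = fun z : Phase =>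
      (μ⁻¹ • z.1, μ • z.2 + ((1 - μ) * (⟪z.1, z.2⟫ / ‖z.1‖ ^ 2)) • z.1) := by
    ext1 z
    rw [radialStretch, tangentialStretch_apply hμ]
  rw [this]
  fun_prop

/-- The Jacobian is μ⁻³ from positions times μ² from velocities, so pulling back a density
multiplies its integral by μ. -/
theorem map_radialStretch_volume (hμ : 0 < μ) :
    Measure.map (radialStretch μ) volume = ENNReal.ofReal μ • (volume : Measure Phase) := by
  have h := map_fibered_volume (inv_pos.2 hμ) (pow_pos hμ 2) (tangentialStretch μ)
    (measurable_radialStretch hμ.ne') fun x hx => det_tangentialStretch hμ hx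
  rw [show ((μ⁻¹) ^ 3 * μ ^ 2)⁻¹ = μ by field_simp] at h
  exact h

theorem quasiMeasurePreserving_radialStretch (hμ : 0 < μ) :
    Measure.QuasiMeasurePreserving (radialStretch μ) volume volume :=
  ⟨measurable_radialStretch hμ.ne', by
    rw [map_radialStretch_volume hμ]; exact Measure.smul_absolutelyContinuous⟩

theorem integrable_comp_radialStretch (hμ : 0 < μ) (hg : Integrable g) :
    Integrable fun z => g (radialStretch μ z) := by
  have hm := measurable_radialStretch hμ.ne'
  have h : Integrable g (Measure.map (radialStretch μ) volume) := by
    rw [map_radialStretch_volume hμ]; exact hg.smul_measure ENNReal.ofReal_ne_top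
  exact (integrable_map_measure h.aestronglyMeasurable hm.aemeasurable).1 h

theorem integral_comp_radialStretch (hμ : 0 < μ) (hg : Integrable g) :
    ∫ z, g (radialStretch μ z) = μ * ∫ z, g z := by
  have hm := measurable_radialStretch hμ.ne'
  have h : Integrable g (Measure.map (radialStretch μ) volume) := by
    rw [map_radialStretch_volume hμ]; exact hg.smul_measure ENNReal.ofReal_ne_top
  rw [← integral_map hm.aemeasurable h.aestronglyMeasurable, map_radialStretch_volume hμ,
    integral_smul_measure, ENNReal.toReal_ofReal hμ.le, smul_eq_mul]

theorem norm_sq_tangentialStretch (hμ : 0 < μ) {x : E3} (hx : x ≠ 0) (v : E3) :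
    ‖tangentialStretch μ x v‖ ^ 2
      = μ ^ 2 * ‖v‖ ^ 2 + (1 - μ ^ 2) * (⟪x, v⟫ ^ 2 / ‖x‖ ^ 2) := by
  have : ‖x‖ ≠ 0 := norm_ne_zero_iff.2 hx
  rw [tangentialStretch_apply hμ.ne', norm_add_sq_real, norm_smul, norm_smul,
    real_inner_smul_left, real_inner_smul_right, mul_pow, mul_pow, Real.norm_eq_abs,
    Real.norm_eq_abs, sq_abs, sq_abs, real_inner_comm]
  field_simp
  ring

/-- L is ‖x‖² times the squared tangential speed, and the two factors μ⁻² and μ² cancel. -/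
theorem angL_radialStretch (hμ : 0 < μ) {z : Phase} (hz : z.1 ≠ 0) :
    angL (radialStretch μ z) = angL z := by
  have hx : ‖z.1‖ ≠ 0 := norm_ne_zero_iff.2 hz
  have h1 : ⟪z.1, tangentialStretch μ z.1 z.2⟫ = ⟪z.1, z.2⟫ := by
    rw [tangentialStretch_apply hμ.ne', inner_add_right, real_inner_smul_right,
      real_inner_smul_right, real_inner_self_eq_norm_sq]
    field_simp
    ring
  simp only [angL, radialStretch, norm_sq_tangentialStretch hμ hz, real_inner_smul_left, h1,
    norm_smul, norm_inv, Real.norm_of_nonneg hμ.le]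
  field_simp
  ring

theorem norm_sq_le_radialStretch (hμ : 1 ≤ μ) {z : Phase} (hz : z.1 ≠ 0) :
    ‖z.2‖ ^ 2 ≤ ‖(radialStretch μ z).2‖ ^ 2 := by
  have hx : 0 < ‖z.1‖ ^ 2 := by have := norm_pos_iff.2 hz; positivity
  have hL := angL_nonneg z
  simp only [radialStretch]
  rw [norm_sq_tangentialStretch (by linarith) hz]
  have h1 : ⟪z.1, z.2⟫ ^ 2 / ‖z.1‖ ^ 2 ≤ ‖z.2‖ ^ 2 := by
    rw [div_le_iff₀ hx]
    unfold angL at hL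
    linarith
  nlinarith [mul_nonneg (show 0 ≤ μ ^ 2 - 1 by nlinarith) (sub_nonneg.2 h1)]

theorem radialStretch_isometry (hμ : μ ≠ 0) (A : E3 ≃ₗᵢ[ℝ] E3) (z : Phase) :
    radialStretch μ (A z.1, A z.2) = (A (radialStretch μ z).1, A (radialStretch μ z).2) := by
  simp [radialStretch, tangentialStretch_apply hμ, LinearIsometryEquiv.inner_map_map]

theorem casimirDensity_comp_radialStretch (hμ : 0 < μ) {z : Phase} (hz : z.1 ≠ 0) :
    casimirDensity l Q (fun z => f (radialStretch μ z)) z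
      = casimirDensity l Q f (radialStretch μ z) := by
  simp only [casimirDensity, angL_radialStretch hμ hz]

theorem massIn_comp_radialStretch (hμ : 0 < μ) (hf : Integrable f) (r : ℝ) :
    massIn (fun z => f (radialStretch μ z)) r = μ * massIn f (μ⁻¹ * r) := by
  rw [massIn_eq_setIntegral (integrable_comp_radialStretch hμ hf), massIn_eq_setIntegral hf,
    ← integral_indicator (measurableSet_norm_fst_le _),
    ← integral_indicator (measurableSet_norm_fst_le _),
    ← integral_comp_radialStretch hμ (hf.indicator (measurableSet_norm_fst_le _))]
  congr 1
  ext z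
  have : ‖(radialStretch μ z).1‖ ≤ μ⁻¹ * r ↔ ‖z.1‖ ≤ r := by
    simp only [radialStretch, norm_smul, norm_inv, Real.norm_of_nonneg hμ.le]
    exact mul_le_mul_iff_right₀ (inv_pos.2 hμ)
  simp only [indicator, mem_ofPred_eq, this]

/-- The mass function becomes μ m(r/μ), and substituting s = μ s' in ∫ μ² m(s/μ)²/s² ds leaves one
factor μ. -/
theorem Epot_comp_radialStretch (hμ : 0 < μ) (hf : Integrable f) :
    Epot (fun z => f (radialStretch μ z)) = μ * Epot f := by
  have h := integral_comp_mul_left_Ioi (fun s => massIn f s ^ 2 / s ^ 2) 0 (inv_pos.2 hμ)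
  rw [mul_zero, inv_inv, smul_eq_mul] at h
  rw [Epot_eq, Epot_eq, mul_left_comm, ← h]
  congr 1
  refine setIntegral_congr_fun measurableSet_Ioi fun s hs => ?_
  simp only [massIn_comp_radialStretch hμ hf]
  have : s ≠ 0 := ne_of_gt hs
  field_simp

/-- Every term of D scales exactly by μ except the kinetic energy, which scales by at most μ because
the stretch does not decrease speeds. This replaces a scaling argument in which L would change. -/
theorem MemF.comp_radialStretch (hμ : 1 ≤ μ) (hf : MemF l Q γ M f) :
    MemF l Q γ (μ * M) (fun z => f (radialStretch μ z)) ∧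
      energyCasimir l Q γ (fun z => f (radialStretch μ z)) ≤ μ * energyCasimir l Q γ f := by
  have hμ0 : 0 < μ := by linarith
  have hqm := quasiMeasurePreserving_radialStretch hμ0
  have hL : (fun z => γ * (angL (radialStretch μ z) * f (radialStretch μ z)))
      =ᵐ[volume] fun z => γ * (angL z * f (radialStretch μ z)) :=
    ae_fst_ne_zero.mono fun z hz => by simp only [angL_radialStretch hμ0 hz]
  have hC : (fun z => casimirDensity l Q f (radialStretch μ z))
      =ᵐ[volume] casimirDensity l Q (fun z => f (radialStretch μ z)) :=
    ae_fst_ne_zero.mono fun z hz => (casimirDensity_comp_radialStretch hμ0 hz).symm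
  have h0 : ∀ᵐ z : Phase, 0 ≤ f (radialStretch μ z) := hqm.ae hf.nonneg
  have hK : ∀ᵐ z : Phase, ‖z.2‖ ^ 2 * f (radialStretch μ z)
      ≤ ‖(radialStretch μ z).2‖ ^ 2 * f (radialStretch μ z) := by
    filter_upwards [ae_fst_ne_zero, h0] with z hz hz0
    exact mul_le_mul_of_nonneg_right (norm_sq_le_radialStretch hμ hz) hz0
  have hfi := integrable_comp_radialStretch hμ0 hf.integrable
  have hki := integrable_comp_radialStretch hμ0 hf.finite_kin
  have hmem : MemF l Q γ (μ * M) (fun z => f (radialStretch μ z)) :=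
    { integrable := hfi
      nonneg := h0
      mass := by rw [integral_comp_radialStretch hμ0 hf.integrable, hf.mass]
      finite_angL := (integrable_comp_radialStretch hμ0 hf.finite_angL).congr hL
      finite_casimir := (integrable_comp_radialStretch hμ0 hf.finite_casimir).congr hC
      finite_kin := by
        refine hki.mono' ?_ ?_
        · exact AEStronglyMeasurable.mul (by fun_prop) hfi.aestronglyMeasurable
        · filter_upwards [hK, h0] with z h1 h2
          rw [Real.norm_of_nonneg (by positivity)]
          exact h1
      symm := fun A hA => by
        filter_upwards [hqm.ae (hf.symm A hA)] with z hz
        rw [radialStretch_isometry hμ0.ne', hz] }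
  refine ⟨hmem, ?_⟩
  have hp : posPart l Q γ (fun z => f (radialStretch μ z)) ≤ μ * posPart l Q γ f := by
    rw [hmem.posPart_eq, hf.posPart_eq, ← integral_comp_radialStretch hμ0 hf.integrable_posDensity]
    refine integral_mono_ae hmem.integrable_posDensity
      (integrable_comp_radialStretch hμ0 hf.integrable_posDensity) ?_
    filter_upwards [hL, hC, hK] with z h1 h2 h3
    simp only [posDensity]
    rw [h1, h2]
    linarith
  have := Epot_comp_radialStretch hμ0 hf.integrable
  unfold energyCasimir
  rw [this]
  linarith

end Stretching

/-! ### States of negative energy -/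

section TestFunction

variable {l : ℝ} {Q : ℝ → ℝ} {γ M : ℝ}

/-- Points of the unit box with angular momentum bounded away from zero. -/
def unitShell : Set Phase := {z | z ∈ phaseBox 1 1 ∧ 1 / 4 ≤ angL z}

theorem measurableSet_unitShell : MeasurableSet unitShell :=
  (measurableSet_phaseBox 1 1).inter (measurableSet_le measurable_const measurable_angL)

theorem integral_unitShell_pos (hl : -1 < l) : 0 < ∫ z in unitShell, angL z ^ l := by
  have hi : IntegrableOn (fun z => angL z ^ l) unitShell :=
    (integrableOn_angL_rpow_unit hl).mono_set fun z hz => hz.1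
  rw [setIntegral_pos_iff_support_of_nonneg_ae
    (ae_of_all _ fun z => Real.rpow_nonneg (angL_nonneg _) _) hi]
  set O : Set Phase := {z | ‖z.1‖ < 1 ∧ ‖z.2‖ < 1 ∧ 1 / 4 < angL z} with hO
  have hOo : IsOpen O := by
    refine (isOpen_lt (f := fun z : Phase => ‖z.1‖) (by fun_prop) continuous_const).inter
      ((isOpen_lt (f := fun z : Phase => ‖z.2‖) (by fun_prop) continuous_const).inter
        (isOpen_lt continuous_const continuous_angL))
  have hOn : O.Nonempty := by
    refine ⟨((9 / 10 : ℝ) • unitVec, (9 / 10 : ℝ) • EuclideanSpace.single 1 1), ?_, ?_, ?_⟩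
    · rw [norm_smul, norm_unitVec]; norm_num
    · simp only [norm_smul, PiLp.norm_single]; norm_num
    · rw [angL_smul, angL_unitVec]
      simp
      norm_num
  refine (hOo.measure_pos volume hOn).trans_le (measure_mono fun z hz => ⟨?_, ?_⟩)
  · have : 0 < angL z := by have := hz.2.2; linarith
    exact (Real.rpow_pos_of_pos this _).ne'
  · exact ⟨mem_phaseBox.2 ⟨hz.1.le, hz.2.1.le⟩, hz.2.2.le⟩

/-- Isotropic-type states with constant `L^{-l} f` and arbitrarily chosen extent. -/
theorem exists_polytrope (hl : -1 < l) (hQ : CasimirAssumptions l Q) (hM : 0 < M) :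
    ∃ w : ℝ, 0 < w ∧ ∀ R V : ℝ, 0 < R → 0 < V → ∃ g : Phase → ℝ, (∀ γ, MemF l Q γ M g) ∧
      energyCasimir l Q 0 g ≤ Q (M / w * (R * V) ^ (-(3 + 2 * l)))
        / (M / w * (R * V) ^ (-(3 + 2 * l))) * M + V ^ 2 * M / 2 - M ^ 2 / (2 * R) := by
  refine ⟨∫ z in unitShell, angL z ^ l, integral_unitShell_pos hl, fun R V hR hV => ?_⟩
  set w : ℝ := ∫ z in unitShell, angL z ^ l with hw
  have hw0 : 0 < w := integral_unitShell_pos hl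
  set T : Phase → Phase := fun z => (R⁻¹ • z.1, V⁻¹ • z.2) with hT
  have hTm : Measurable T := measurable_scaling _ _
  set S : Set Phase := T ⁻¹' unitShell with hS
  have hSm : MeasurableSet S := hTm measurableSet_unitShell
  obtain ⟨hSi, hSe⟩ := integral_angL_rpow_scaling measurableSet_unitShell
    ((integrableOn_angL_rpow_unit hl).mono_set fun z hz => hz.1) hR hV
  change IntegrableOn _ S at hSi
  change ∫ z in S, angL z ^ l = w * _ at hSe
  have hRV : 0 < R * V := by positivity
  -- The level y normalizes the total mass to M.
  set y : ℝ := M / w * (R * V) ^ (-(3 + 2 * l)) with hy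
  have hy0 : 0 < y := by positivity
  have hSbox : ∀ z ∈ S, ‖z.1‖ ≤ R ∧ ‖z.2‖ ≤ V := by
    intro z hz
    have h1 : z ∈ T ⁻¹' phaseBox 1 1 := hz.1
    rw [hT, preimage_scaling_phaseBox hR hV] at h1
    exact mem_phaseBox.1 h1
  have hSL : ∀ z ∈ S, 0 < angL z := by
    intro z hz
    have h2 : 1 / 4 ≤ angL (T z) := hz.2
    rw [angL_scaling hR hV z]
    have : 0 < angL (T z) := by linarith
    positivity
  set g : Phase → ℝ := fun z => y * S.indicator (fun z => angL z ^ l) z with hg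
  have hgi : Integrable g := ((integrable_indicator_iff hSm).2 hSi).const_mul y
  have hg0 : ∀ z, 0 ≤ g z := fun z =>
    mul_nonneg hy0.le (indicator_nonneg (fun z _ => Real.rpow_nonneg (angL_nonneg _) _) _)
  have hgS : ∀ z, z ∉ S → g z = 0 := fun z hz => by simp [hg, hz]
  have hgM : ∫ z, g z = M := by
    simp only [hg]
    rw [integral_const_mul, integral_indicator hSm, hSe, hy, Real.rpow_neg hRV.le]
    field_simp
  have hcas : ∀ z, casimirDensity l Q g z = Q y / y * g z := by
    intro z
    by_cases hz : z ∈ S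
    · have h1 : angL z ^ (-l) * g z = y := by
        simp only [hg, indicator_of_mem hz]
        rw [mul_left_comm, ← Real.rpow_add (hSL z hz), neg_add_cancel, Real.rpow_zero, mul_one]
      rw [casimirDensity, h1]
      simp only [hg, indicator_of_mem hz]
      field_simp
    · rw [casimirDensity, hgS z hz, mul_zero, mul_zero, hQ.map_zero, zero_mul]
  have hbound : ∀ {φ : Phase → ℝ} {c : ℝ}, Continuous φ → 0 ≤ c → (∀ z ∈ S, |φ z| ≤ c) →
      Integrable fun z => φ z * g z := by
    intro φ c hφ hc h
    refine (hgi.const_mul c).mono' (hφ.aestronglyMeasurable.mul hgi.aestronglyMeasurable)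
      (ae_of_all _ fun z => ?_)
    rw [norm_mul, Real.norm_of_nonneg (hg0 z), Real.norm_eq_abs]
    by_cases hz : z ∈ S
    · exact mul_le_mul_of_nonneg_right (h z hz) (hg0 z)
    · simp [hgS z hz]
  have hLi : Integrable fun z => angL z * g z := by
    refine hbound continuous_angL (c := (R * V) ^ 2) (by positivity) fun z hz => ?_
    obtain ⟨h1, h2⟩ := hSbox z hz
    rw [abs_of_nonneg (angL_nonneg z)]
    exact (angL_le z).trans (by gcongr)
  have hKi : Integrable fun z => ‖z.2‖ ^ 2 * g z := by
    refine hbound (φ := fun z => ‖z.2‖ ^ 2) (by fun_prop) (c := V ^ 2) (by positivity)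
      fun z hz => ?_
    rw [abs_of_nonneg (by positivity)]
    have := (hSbox z hz).2
    gcongr
  have hmem : ∀ γ, MemF l Q γ M g := fun γ =>
    { integrable := hgi
      nonneg := ae_of_all _ hg0
      mass := hgM
      finite_angL := hLi.const_mul γ
      finite_casimir := (hgi.const_mul (Q y / y)).congr (ae_of_all _ fun z => (hcas z).symm)
      finite_kin := hKi
      symm := fun A _ => ae_of_all _ fun z => by
        have h1 : ((A z.1, A z.2) : Phase) ∈ S ↔ z ∈ S := by
          simp only [hS, hT, mem_preimage, unitShell, mem_ofPred_eq, mem_phaseBox,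
            ← A.map_smul, A.norm_map, angL_isometry]
        by_cases hz : z ∈ S
        · simp only [hg, indicator_of_mem hz, indicator_of_mem (h1.2 hz), angL_isometry]
        · rw [hgS z hz, hgS _ fun h => hz (h1.1 h)] }
  refine ⟨g, hmem, ?_⟩
  have e1 : casimir l Q g = Q y / y * M := by
    unfold casimir
    simp_rw [hcas]
    rw [integral_const_mul, hgM]
  have e2 : Ekin g ≤ V ^ 2 * M / 2 := by
    have : ∫ z, ‖z.2‖ ^ 2 * g z ≤ ∫ z, V ^ 2 * g z := by
      refine integral_mono hKi (hgi.const_mul _) fun z => ?_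
      by_cases hz : z ∈ S
      · have := (hSbox z hz).2
        have := hg0 z
        simp only
        gcongr
      · simp [hgS z hz]
    rw [integral_const_mul, hgM] at this
    unfold Ekin
    linarith
  -- Only radii beyond R are kept; there the enclosed mass is all of M and the integral is explicit.
  have e3 : Epot g ≤ -(M ^ 2 / (2 * R)) := by
    have hm : ∀ s, R ≤ s → massIn g s = M := by
      intro s hs
      rw [massIn_eq_setIntegral hgi, ← hgM]
      refine setIntegral_eq_integral_of_forall_compl_eq_zero fun z hz => hgS z fun hzS => hz ?_
      exact (hSbox z hzS).1.trans hs
    have h1 : ∫ s in Ioi R, massIn g s ^ 2 / s ^ 2 = M ^ 2 / R := by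
      have : EqOn (fun s => massIn g s ^ 2 / s ^ 2) (fun s => M ^ 2 * s ^ (-2 : ℝ)) (Ioi R) := by
        intro s hs
        have hs' : R < s := hs
        have hs0 : 0 < s := hR.trans hs'
        simp only [hm s hs'.le]
        rw [Real.rpow_neg hs0.le]
        norm_num
        ring
      rw [setIntegral_congr_fun measurableSet_Ioi this, integral_const_mul,
        integral_Ioi_rpow_of_lt (by norm_num) hR]
      norm_num [Real.rpow_neg_one]
      ring
    have h2 : ∫ s in Ioi R, massIn g s ^ 2 / s ^ 2 ≤ ∫ s in Ioi (0 : ℝ), massIn g s ^ 2 / s ^ 2 :=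
      setIntegral_mono_set ((hmem 0).integrableOn_massIn_sq hl hQ)
        (ae_of_all _ fun s => by positivity) (ae_of_all _ (Ioi_subset_Ioi hR.le))
    rw [Epot_eq]
    have : M ^ 2 / (2 * R) = 1 / 2 * (M ^ 2 / R) := by field_simp
    linarith
  unfold energyCasimir posPart
  rw [e1, zero_mul, zero_add]
  linarith

/-- For very extended states near virial balance, kinetic and potential energy are of order 1/R,
whereas the Casimir term decays faster, like R^{-n/(2k₂)} with n/2 = l + 3/2 > k₂. The potential
energy therefore wins. -/
theorem exists_energyCasimir_neg (hl : -1 < l) (hQ : CasimirAssumptions l Q) (hM : 0 < M) :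
    ∃ g : Phase → ℝ, (∀ γ, MemF l Q γ M g) ∧ energyCasimir l Q 0 g < 0 := by
  obtain ⟨C₁, C₂, F₀, k₁, k₂, k₃, hC₁, hC₂, hF₀, hk₁, hk₂, hk₃, h1, h2, h3⟩ := hQ.growth
  obtain ⟨w, hw, hg⟩ := exists_polytrope hl hQ hM
  set n : ℝ := 3 + 2 * l with hn
  have hn0 : 0 < n := by linarith
  set A : ℝ := M / w * (M / 4) ^ (-(n / 2)) with hA
  have hA0 : 0 < A := by positivity
  have hk : 0 < k₂ := hk₂.1
  have t1 : Tendsto (fun R : ℝ => A * R ^ (-(n / 2))) atTop (𝓝 0) := by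
    simpa using (tendsto_rpow_neg_atTop (by positivity : 0 < n / 2)).const_mul A
  have hexp : 0 < n / (2 * k₂) - 1 := by
    rw [sub_pos, one_lt_div (by positivity)]
    linarith [hk₂.2]
  have t2 : Tendsto (fun R : ℝ => C₂ * M * A ^ (1 / k₂) * R ^ (-(n / (2 * k₂) - 1))) atTop
      (𝓝 0) := by
    simpa using (tendsto_rpow_neg_atTop hexp).const_mul (C₂ * M * A ^ (1 / k₂))
  have hM2 : (0 : ℝ) < 3 * M ^ 2 / 8 := by positivity
  obtain ⟨R, hR1, hR2, hR0⟩ := ((t1.eventually (gt_mem_nhds hF₀)).and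
    ((t2.eventually (gt_mem_nhds hM2)).and (eventually_gt_atTop 0))).exists
  -- With V² = M/(4R) the kinetic bound is M²/(8R), a quarter of the potential gain M²/(2R), leaving
  -- −3M²/(8R) to absorb the Casimir term.
  set V : ℝ := √(M / (4 * R)) with hV
  have hV0 : 0 < V := by positivity
  have hV2 : V ^ 2 = M / (4 * R) := Real.sq_sqrt (by positivity)
  obtain ⟨g, hgm, hgE⟩ := hg R V hR0 hV0
  refine ⟨g, hgm, hgE.trans_lt ?_⟩
  have hRV : R * V = (M / 4 * R) ^ (1 / 2 : ℝ) := by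
    rw [← Real.sqrt_eq_rpow, hV, eq_comm, Real.sqrt_eq_iff_mul_self_eq (by positivity)
      (by positivity)]
    rw [mul_mul_mul_comm, Real.mul_self_sqrt (by positivity)]
    field_simp
  have hy : M / w * (R * V) ^ (-n) = A * R ^ (-(n / 2)) := by
    rw [hRV, ← Real.rpow_mul (by positivity), Real.mul_rpow (by positivity) hR0.le, hA,
      show 1 / 2 * -n = -(n / 2) by ring]
    ring
  rw [hy]
  set y : ℝ := A * R ^ (-(n / 2)) with hyd
  have hy0 : 0 < y := by positivity
  have hQy := h2 y hy0.le hR1.le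
  rw [Real.rpow_add hy0, Real.rpow_one] at hQy
  have hQ2 : Q y / y * M ≤ C₂ * y ^ (1 / k₂) * M := by
    gcongr
    rw [div_le_iff₀ hy0]
    linarith
  have hyk : y ^ (1 / k₂) = A ^ (1 / k₂) * R ^ (-(n / (2 * k₂) - 1)) / R := by
    rw [hyd, Real.mul_rpow hA0.le (by positivity), ← Real.rpow_mul hR0.le,
      mul_div_assoc, ← Real.rpow_sub_one hR0.ne']
    congr 2
    field_simp
    ring
  have h5 : C₂ * y ^ (1 / k₂) * M < 3 * M ^ 2 / 8 / R := by
    rw [hyk, lt_div_iff₀ hR0]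
    calc C₂ * (A ^ (1 / k₂) * R ^ (-(n / (2 * k₂) - 1)) / R) * M * R
        = C₂ * M * A ^ (1 / k₂) * R ^ (-(n / (2 * k₂) - 1)) := by field_simp
      _ < _ := hR2
  have h6 : V ^ 2 * M / 2 - M ^ 2 / (2 * R) = -(3 * M ^ 2 / 8 / R) := by
    rw [hV2]; field_simp; ring
  linarith

/-- For small `γ` the minimal energy is negative. -/
theorem exists_gamma_bound (hl : -1 < l) (hQ : CasimirAssumptions l Q) (hM : 0 < M) :
    ∃ γ₀ : ℝ, 0 < γ₀ ∧ ∀ γ, 0 ≤ γ → γ < γ₀ →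
      ∃ g : Phase → ℝ, MemF l Q γ M g ∧ energyCasimir l Q γ g < 0 := by
  obtain ⟨g, hg, hE⟩ := exists_energyCasimir_neg hl hQ hM
  set K : ℝ := ∫ z, angL z * g z with hK
  have hK0 : 0 ≤ K :=
    integral_nonneg_of_ae ((hg 0).nonneg.mono fun z h => mul_nonneg (angL_nonneg z) h)
  -- D depends affinely on γ with slope K, so γ K stays below the negative energy at γ = 0; the 1
  -- guards against K = 0.
  refine ⟨-energyCasimir l Q 0 g / (K + 1), div_pos (by linarith) (by linarith),
    fun γ h0 h1 => ⟨g, hg γ, ?_⟩⟩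
  rw [lt_div_iff₀ (by linarith)] at h1
  have h2 : energyCasimir l Q γ g = energyCasimir l Q 0 g + γ * K := by
    unfold energyCasimir posPart
    ring
  nlinarith

end TestFunction

/-! ### Almost everywhere convergent selections from convex sets -/

section ConvexCombinations

open scoped ENNReal

theorem integrable_exp_neg {α : Type*} [MeasurableSpace α] {ν : Measure α} [IsFiniteMeasure ν]
    {f : α → ℝ} (hf : AEStronglyMeasurable f ν) (h0 : ∀ᵐ z ∂ν, 0 ≤ f z) :
    Integrable (fun z => Real.exp (-f z)) ν := by
  refine Integrable.mono' (integrable_const 1)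
    (Real.continuous_exp.comp_aestronglyMeasurable hf.neg) ?_
  filter_upwards [h0] with z hz
  rw [Real.norm_of_nonneg (Real.exp_nonneg _)]
  exact Real.exp_le_one_iff.2 (by linarith)

theorem memLp_exp_neg_half {α : Type*} [MeasurableSpace α] {ν : Measure α} [IsFiniteMeasure ν]
    {f : α → ℝ} (hf : AEStronglyMeasurable f ν) (h0 : ∀ᵐ z ∂ν, 0 ≤ f z) :
    MemLp (fun z => Real.exp (-(f z / 2))) 2 ν := by
  have hm : AEStronglyMeasurable (fun z => -(f z / 2)) ν :=
    (hf.aemeasurable.div_const 2).neg.aestronglyMeasurable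
  refine MemLp.of_bound (Real.continuous_exp.comp_aestronglyMeasurable hm) 1 ?_
  filter_upwards [h0] with z hz
  rw [Real.norm_of_nonneg (Real.exp_nonneg _)]
  exact Real.exp_le_one_iff.2 (by linarith)

theorem sq_norm_toLp_sub {α : Type*} [MeasurableSpace α] {ν : Measure α} {u v : α → ℝ}
    (hu : MemLp u 2 ν) (hv : MemLp v 2 ν) :
    dist (hu.toLp u) (hv.toLp v) ^ 2 = ∫ z, (u z - v z) ^ 2 ∂ν := by
  rw [dist_eq_norm, ← MemLp.toLp_sub hu hv, ← real_inner_self_eq_norm_sq, L2.inner_def]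
  refine integral_congr_ae ?_
  filter_upwards [(hu.sub hv).coeFn_toLp] with z hz
  rw [hz]
  simp [sq]

/-- A decreasing sequence of nonempty midpoint-convex sets of nonnegative functions, bounded in
`L¹`, contains an almost everywhere convergent selection. -/
theorem exists_ae_tendsto_of_midpoint_convex {α : Type*} [MeasurableSpace α] {μ : Measure α}
    [SigmaFinite μ] (C : ℕ → Set (α → ℝ)) (hne : ∀ j, (C j).Nonempty) (hanti : Antitone C)
    (hconv : ∀ j, ∀ f ∈ C j, ∀ g ∈ C j, (fun z => (f z + g z) / 2) ∈ C j)
    (hint : ∀ f ∈ C 0, Integrable f μ) (hpos : ∀ f ∈ C 0, ∀ᵐ z ∂μ, 0 ≤ f z)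
    (M : ℝ) (hM : ∀ f ∈ C 0, ∫ z, f z ∂μ ≤ M) :
    ∃ (h : ℕ → α → ℝ) (h₀ : α → ℝ), (∀ j, h j ∈ C j) ∧ AEStronglyMeasurable h₀ μ ∧
      ∀ᵐ z ∂μ, Tendsto (fun j => h j z) atTop (𝓝 (h₀ z)) := by
  -- An equivalent finite measure makes e^{-f} integrable without changing null sets.
  set ν := μ.toFinite with hν
  have hae : ae ν = ae μ := ae_toFinite
  have hac : ν ≪ μ := Measure.ae_le_iff_absolutelyContinuous.1 hae.le
  have h0 : ∀ j, C j ⊆ C 0 := fun j => hanti (Nat.zero_le j)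
  have hm : ∀ f ∈ C 0, AEStronglyMeasurable f ν := fun f hf =>
    (hint f hf).aestronglyMeasurable.mono_ac hac
  have hp : ∀ f ∈ C 0, ∀ᵐ z ∂ν, 0 ≤ f z := fun f hf => hac.ae_le (hpos f hf)
  set J : (α → ℝ) → ℝ := fun f => ∫ z, Real.exp (-f z) ∂ν with hJ
  have hJ0 : ∀ f, 0 ≤ J f := fun f => integral_nonneg fun z => (Real.exp_pos _).le
  have hJ1 : ∀ f ∈ C 0, J f ≤ ν.real univ := by
    intro f hf
    calc J f ≤ ∫ _, (1 : ℝ) ∂ν := by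
          refine integral_mono_ae (integrable_exp_neg (hm f hf) (hp f hf)) (integrable_const 1) ?_
          filter_upwards [hp f hf] with z hz
          exact Real.exp_le_one_iff.2 (by linarith)
      _ = _ := by simp
  have hbdd : ∀ j, BddBelow (J '' C j) := fun j => ⟨0, by rintro _ ⟨f, -, rfl⟩; exact hJ0 f⟩
  set I : ℕ → ℝ := fun j => sInf (J '' C j) with hI
  have hImono : Monotone I := fun i j hij =>
    csInf_le_csInf (hbdd i) ((hne j).image J) (image_mono (hanti hij))
  have hIle : ∀ j, ∀ f ∈ C j, I j ≤ J f := fun j f hf => csInf_le (hbdd j) ⟨f, hf, rfl⟩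
  have hIbdd : BddAbove (range I) := by
    refine ⟨ν.real univ, ?_⟩
    rintro _ ⟨j, rfl⟩
    obtain ⟨f, hf⟩ := hne j
    exact (hIle j f hf).trans (hJ1 f (h0 j hf))
  have hIlim := tendsto_atTop_ciSup hImono hIbdd
  set Isup : ℝ := ⨆ j, I j
  have hex : ∀ j : ℕ, ∃ f ∈ C j, J f < I j + 1 / ((j : ℝ) + 1) := by
    intro j
    obtain ⟨_, ⟨f, hf, rfl⟩, hlt⟩ := exists_lt_of_csInf_lt ((hne j).image J)
      (show sInf (J '' C j) < I j + 1 / ((j : ℝ) + 1) from lt_add_of_pos_right _ (by positivity))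
    exact ⟨f, hf, hlt⟩
  choose h hC hlt using hex
  have hmem : ∀ j, MemLp (fun z => Real.exp (-(h j z / 2))) 2 ν := fun j =>
    memLp_exp_neg_half (hm _ (h0 j (hC j))) (hp _ (h0 j (hC j)))
  set u : ℕ → Lp ℝ 2 ν := fun j => (hmem j).toLp _ with hu
  -- From (e^{-a/2} − e^{-b/2})² = e^{-a} + e^{-b} − 2e^{-(a+b)/2}: the midpoint lies in the larger
  -- set C i, so its value of J is at least I i, and near-minimality of both functions bounds their
  -- distance.
  have hdist : ∀ i j, i ≤ j → dist (u i) (u j) ^ 2 ≤ Isup - I i + 2 / ((i : ℝ) + 1) := by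
    intro i j hij
    have hj : h j ∈ C i := hanti hij (hC j)
    have hmid := hconv i _ (hC i) _ hj
    have e1 := integrable_exp_neg (hm _ (h0 i (hC i))) (hp _ (h0 i (hC i)))
    have e2 := integrable_exp_neg (hm _ (h0 i hj)) (hp _ (h0 i hj))
    have e3 := integrable_exp_neg (hm _ (h0 i hmid)) (hp _ (h0 i hmid))
    have key : ∫ z, (Real.exp (-(h i z / 2)) - Real.exp (-(h j z / 2))) ^ 2 ∂ν
        = J (h i) + J (h j) - 2 * J (fun z => (h i z + h j z) / 2) := by
      simp only [hJ]
      rw [← integral_const_mul, ← integral_add e1 e2,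
        ← integral_sub (by exact e1.add e2) (e3.const_mul 2)]
      congr 1
      ext z
      have a1 : Real.exp (-h i z) = Real.exp (-(h i z / 2)) ^ 2 := by
        rw [← Real.exp_nat_mul]; congr 1; push_cast; ring
      have a2 : Real.exp (-h j z) = Real.exp (-(h j z / 2)) ^ 2 := by
        rw [← Real.exp_nat_mul]; congr 1; push_cast; ring
      have a3 : Real.exp (-((h i z + h j z) / 2))
          = Real.exp (-(h i z / 2)) * Real.exp (-(h j z / 2)) := by
        rw [← Real.exp_add]; congr 1; ring
      rw [a1, a2, a3]
      ring
    rw [hu, sq_norm_toLp_sub, key]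
    have b1 := hlt i
    have b2 := hlt j
    have b3 := hIle i _ hmid
    have b4 : I j ≤ Isup := le_ciSup hIbdd j
    have b5 : 1 / ((j : ℝ) + 1) ≤ 1 / ((i : ℝ) + 1) := by
      have : (i : ℝ) ≤ j := by exact_mod_cast hij
      gcongr
    have b6 : 2 / ((i : ℝ) + 1) = 1 / ((i : ℝ) + 1) + 1 / ((i : ℝ) + 1) := by ring
    linarith
  have hcauchy : CauchySeq u := by
    refine cauchySeq_of_le_tendsto_0 (fun i => √(Isup - I i + 2 / ((i : ℝ) + 1))) ?_ ?_
    · have aux : ∀ n m N, N ≤ n → n ≤ m → dist (u n) (u m) ≤ √(Isup - I N + 2 / ((N : ℝ) + 1)) := by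
        intro n m N hN hnm
        refine Real.le_sqrt_of_sq_le ((hdist n m hnm).trans ?_)
        have b1 := hImono hN
        have b2 : 2 / ((n : ℝ) + 1) ≤ 2 / ((N : ℝ) + 1) := by
          have : (N : ℝ) ≤ n := by exact_mod_cast hN
          gcongr
        linarith
      intro n m N hn hm
      rcases le_total n m with h1 | h1
      · exact aux n m N hn h1
      · rw [dist_comm]; exact aux m n N hm h1
    · have t1 : Tendsto (fun i : ℕ => 2 / ((i : ℝ) + 1)) atTop (𝓝 0) := by
        simpa [div_eq_mul_inv] using (tendsto_one_div_add_atTop_nhds_zero_nat (𝕜 := ℝ)).const_mul 2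
      have t2 := ((tendsto_const_nhds (x := Isup)).sub hIlim).add t1
      rw [sub_self, zero_add] at t2
      simpa using t2.sqrt
  obtain ⟨U, hU⟩ := cauchySeq_tendsto_of_complete hcauchy
  obtain ⟨φ, hφ, hlim⟩ := (tendstoInMeasure_of_tendsto_Lp hU).exists_seq_tendsto_ae
  have hlim' : ∀ᵐ z ∂μ, Tendsto (fun j => Real.exp (-(h (φ j) z / 2))) atTop (𝓝 (U z)) := by
    rw [← hae]
    have hco : ∀ᵐ z ∂ν, ∀ j, u j z = Real.exp (-(h j z / 2)) :=
      ae_all_iff.2 fun j => (hmem j).coeFn_toLp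
    filter_upwards [hlim, hco] with z h1 h2
    simpa only [h2] using h1
  have hφC : ∀ j, h (φ j) ∈ C 0 := fun j => h0 _ (hC _)
  -- The L¹ bound and Fatou exclude escape of the values to infinity, that is, a zero of the limit
  -- U, so that taking logarithms is legitimate.
  have hfat : ∀ᵐ z ∂μ, liminf (fun j => ENNReal.ofReal (h (φ j) z)) atTop < ⊤ := by
    have hmeas : ∀ j, AEMeasurable (fun z => ENNReal.ofReal (h (φ j) z)) μ := fun j =>
      (hint _ (hφC j)).aemeasurable.ennreal_ofReal
    have hlm : AEMeasurable (fun z => liminf (fun j => ENNReal.ofReal (h (φ j) z)) atTop) μ := by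
      refine ⟨fun z => liminf (fun j => (hmeas j).mk _ z) atTop,
        Measurable.liminf fun j => (hmeas j).measurable_mk, ?_⟩
      filter_upwards [ae_all_iff.2 fun j => (hmeas j).ae_eq_mk] with z hz
      simp only [← hz]
    refine ae_lt_top' hlm (ne_top_of_le_ne_top ENNReal.ofReal_ne_top
      ((lintegral_liminf_le' hmeas).trans (b := liminf _ _) (c := ENNReal.ofReal M) ?_))
    refine (liminf_le_liminf (Eventually.of_forall fun j => ?_)).trans
      (liminf_const (f := atTop (α := ℕ)) (ENNReal.ofReal M)).le
    rw [← ofReal_integral_eq_lintegral_ofReal (hint _ (hφC j)) (hpos _ (hφC j))]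
    exact ENNReal.ofReal_le_ofReal (hM _ (hφC j))
  have hfin : ∀ᵐ z ∂μ, Tendsto (fun j => h (φ j) z) atTop (𝓝 (-2 * Real.log (U z))) := by
    filter_upwards [hlim', hfat] with z h1 h2
    have hU0 : U z ≠ 0 := by
      intro hz
      rw [hz, Real.tendsto_exp_comp_nhds_zero] at h1
      have h3 : Tendsto (fun j => h (φ j) z) atTop atTop := by
        have := tendsto_neg_atBot_atTop.comp h1
        refine (this.const_mul_atTop (show (0 : ℝ) < 2 by norm_num)).congr fun j => ?_
        simp only [Function.comp]
        ring
      have h4 := (ENNReal.tendsto_ofReal_atTop.comp h3).liminf_eq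
      simp only [Function.comp_def] at h4
      exact h2.ne h4
    have h5 := (((Real.continuousAt_log hU0).tendsto.comp h1).const_mul (-2))
    refine h5.congr fun j => ?_
    simp only [Function.comp, Real.log_exp]
    ring
  refine ⟨fun j => h (φ j), fun z => -2 * Real.log (U z), fun j => hanti (hφ.id_le j) (hC _), ?_,
    hfin⟩
  exact aestronglyMeasurable_of_tendsto_ae atTop (fun j => (hint _ (hφC j)).aestronglyMeasurable)
    hfin

end ConvexCombinations

/-! ### Compactness of minimizing sequences -/

section Compactness

variable {l : ℝ} {Q : ℝ → ℝ} {γ M : ℝ} {f g : Phase → ℝ}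

theorem CasimirAssumptions.continuous_max (hQ : CasimirAssumptions l Q) :
    Continuous fun y => Q (max y 0) :=
  hQ.continuousOn.comp_continuous (by fun_prop) fun y => le_max_right y 0

theorem aestronglyMeasurable_casimirDensity (hQ : CasimirAssumptions l Q)
    (hf : AEStronglyMeasurable f volume) (h0 : ∀ᵐ z, 0 ≤ f z) :
    AEStronglyMeasurable (casimirDensity l Q f) volume := by
  have h1 : Measurable fun z => angL z ^ l := measurable_angL.pow_const l
  have h2 : Measurable fun z => angL z ^ (-l) := measurable_angL.pow_const _
  have h3 : AEStronglyMeasurable (fun z => Q (max (angL z ^ (-l) * f z) 0)) volume :=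
    hQ.continuous_max.comp_aestronglyMeasurable (h2.aestronglyMeasurable.mul hf)
  refine (h3.mul h1.aestronglyMeasurable).congr ?_
  filter_upwards [h0] with z hz
  simp only [casimirDensity, Pi.mul_apply,
    max_eq_left (mul_nonneg (Real.rpow_nonneg (angL_nonneg z) (-l)) hz)]

theorem measurePreserving_isometry (A : E3 ≃ₗᵢ[ℝ] E3) :
    MeasurePreserving (fun z : Phase => (A z.1, A z.2)) volume volume :=
  A.measurePreserving.prod A.measurePreserving

/-- Componentwise integrability from integrability of the total density. -/
theorem MemF.of_posDensity (hQ : CasimirAssumptions l Q) (hγ : 0 ≤ γ) (hf : Integrable f)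
    (h0 : ∀ᵐ z, 0 ≤ f z) (hp : Integrable (posDensity l Q γ f)) (hs : SphericallySymmetric f) :
    MemF l Q γ (∫ z, f z) f := by
  have hfm := hf.aestronglyMeasurable
  have hcm := aestronglyMeasurable_casimirDensity hQ hfm h0
  refine ⟨hf, h0, rfl, hp.mono' ?_ ?_, hp.mono' hcm ?_, (hp.const_mul 2).mono' ?_ ?_, hs⟩
  · exact (continuous_angL.aestronglyMeasurable.mul hfm).const_mul γ
  · filter_upwards [h0] with z hz
    have h1 := casimirDensity_nonneg hQ hz
    have h2 := angL_nonneg z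
    have h3 : 0 ≤ 1 / 2 * (‖z.2‖ ^ 2 * f z) := by positivity
    rw [Real.norm_of_nonneg (by positivity)]
    unfold posDensity
    linarith
  · filter_upwards [h0] with z hz
    have h1 := casimirDensity_nonneg hQ hz
    have h2 := angL_nonneg z
    have h3 : 0 ≤ 1 / 2 * (‖z.2‖ ^ 2 * f z) := by positivity
    have h4 : 0 ≤ γ * (angL z * f z) := by positivity
    rw [Real.norm_of_nonneg h1]
    unfold posDensity
    linarith
  · exact AEStronglyMeasurable.mul (by fun_prop) hfm
  · filter_upwards [h0] with z hz
    have h1 := casimirDensity_nonneg hQ hz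
    have h2 := angL_nonneg z
    have h4 : 0 ≤ γ * (angL z * f z) := by positivity
    rw [Real.norm_of_nonneg (by positivity)]
    unfold posDensity
    linarith

theorem posDensity_midpoint_le (hQ : CasimirAssumptions l Q) {z : Phase} (hf : 0 ≤ f z)
    (hg : 0 ≤ g z) : posDensity l Q γ (fun z => (f z + g z) / 2) z
      ≤ (posDensity l Q γ f z + posDensity l Q γ g z) / 2 := by
  have hL := Real.rpow_nonneg (angL_nonneg z) (-l)
  have hL' := Real.rpow_nonneg (angL_nonneg z) l
  have h := hQ.convexOn.2 (mem_Ici.2 (mul_nonneg hL hf)) (mem_Ici.2 (mul_nonneg hL hg))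
    (show (0 : ℝ) ≤ 1 / 2 by norm_num) (show (0 : ℝ) ≤ 1 / 2 by norm_num) (by norm_num)
  simp only [smul_eq_mul] at h
  have h1 : casimirDensity l Q (fun z => (f z + g z) / 2) z
      ≤ (casimirDensity l Q f z + casimirDensity l Q g z) / 2 := by
    unfold casimirDensity
    rw [show angL z ^ (-l) * ((f z + g z) / 2)
      = 1 / 2 * (angL z ^ (-l) * f z) + 1 / 2 * (angL z ^ (-l) * g z) by ring]
    nlinarith [mul_le_mul_of_nonneg_right h hL']
  unfold posDensity
  nlinarith

/-- Convexity of Q, the other terms being linear; this is what makes the tail sets of the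
compactness argument midpoint-convex. -/
theorem MemF.midpoint (hQ : CasimirAssumptions l Q) (hγ : 0 ≤ γ) (hf : MemF l Q γ M f)
    (hg : MemF l Q γ M g) :
    MemF l Q γ M (fun z => (f z + g z) / 2) ∧
      posPart l Q γ (fun z => (f z + g z) / 2) ≤ (posPart l Q γ f + posPart l Q γ g) / 2 := by
  have hi : Integrable fun z => (f z + g z) / 2 := (hf.integrable.add hg.integrable).div_const 2
  have h0 : ∀ᵐ z, 0 ≤ (f z + g z) / 2 := by
    filter_upwards [hf.nonneg, hg.nonneg] with z h1 h2
    positivity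
  have hle : ∀ᵐ z, posDensity l Q γ (fun z => (f z + g z) / 2) z
      ≤ (posDensity l Q γ f z + posDensity l Q γ g z) / 2 := by
    filter_upwards [hf.nonneg, hg.nonneg] with z h1 h2
    exact posDensity_midpoint_le hQ h1 h2
  have hpi : Integrable fun z => (posDensity l Q γ f z + posDensity l Q γ g z) / 2 :=
    (hf.integrable_posDensity.add hg.integrable_posDensity).div_const 2
  have hpm : Integrable (posDensity l Q γ fun z => (f z + g z) / 2) := by
    refine hpi.mono' ?_ ?_
    · have hcm := aestronglyMeasurable_casimirDensity hQ hi.aestronglyMeasurable h0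
      exact (((continuous_angL.aestronglyMeasurable.mul hi.aestronglyMeasurable).const_mul γ).add
        hcm).add ((AEStronglyMeasurable.mul (by fun_prop) hi.aestronglyMeasurable).const_mul _)
    · filter_upwards [h0, hle] with z h1 h2
      rw [Real.norm_of_nonneg (posDensity_nonneg hQ hγ h1)]
      exact h2
  have hs : SphericallySymmetric fun z => (f z + g z) / 2 := fun A hA => by
    filter_upwards [hf.symm A hA, hg.symm A hA] with z h1 h2
    rw [h1, h2]
  have hmass : ∫ z, (f z + g z) / 2 = M := by
    rw [integral_div, integral_add hf.integrable hg.integrable, hf.mass, hg.mass]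
    ring
  have hmem := MemF.of_posDensity hQ hγ hi h0 hpm hs
  rw [hmass] at hmem
  refine ⟨hmem, ?_⟩
  rw [hmem.posPart_eq, hf.posPart_eq, hg.posPart_eq,
    ← integral_add hf.integrable_posDensity hg.integrable_posDensity, ← integral_div]
  exact integral_mono_ae hpm hpi hle

theorem massIn_midpoint (hf : Integrable f) (hg : Integrable g) (r : ℝ) :
    massIn (fun z => (f z + g z) / 2) r = (massIn f r + massIn g r) / 2 := by
  rw [massIn_eq_setIntegral hf, massIn_eq_setIntegral hg,
    massIn_eq_setIntegral (f := fun z => (f z + g z) / 2) ((hf.add hg).div_const 2),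
    integral_div, integral_add hf.integrableOn hg.integrableOn]

/-- Fatou's lemma for nonnegative integrable functions with eventually bounded integrals. -/
theorem integrable_and_integral_le_of_tendsto {α : Type*} [MeasurableSpace α] {μ : Measure α}
    {u : ℕ → α → ℝ} {v : α → ℝ} {c : ℝ} (hi : ∀ j, Integrable (u j) μ)
    (h0 : ∀ j, ∀ᵐ z ∂μ, 0 ≤ u j z)
    (hlim : ∀ᵐ z ∂μ, Tendsto (fun j => u j z) atTop (𝓝 (v z)))
    (hc : ∀ᶠ j in atTop, ∫ z, u j z ∂μ ≤ c) :
    Integrable v μ ∧ ∫ z, v z ∂μ ≤ c := by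
  have hv0 : ∀ᵐ z ∂μ, 0 ≤ v z := by
    filter_upwards [ae_all_iff.2 h0, hlim] with z h1 h2
    exact ge_of_tendsto' h2 h1
  have hvm := aestronglyMeasurable_of_tendsto_ae atTop (fun j => (hi j).aestronglyMeasurable) hlim
  have hc0 : 0 ≤ c := by
    obtain ⟨j, hj⟩ := hc.exists
    exact (integral_nonneg_of_ae (h0 j)).trans hj
  have hfat : ∫⁻ z, ENNReal.ofReal (v z) ∂μ ≤ ENNReal.ofReal c := by
    calc ∫⁻ z, ENNReal.ofReal (v z) ∂μ
        = ∫⁻ z, liminf (fun j => ENNReal.ofReal (u j z)) atTop ∂μ := by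
          refine lintegral_congr_ae (hlim.mono fun z hz => ?_)
          exact ((ENNReal.continuous_ofReal.tendsto _).comp hz).liminf_eq.symm
      _ ≤ liminf (fun j => ∫⁻ z, ENNReal.ofReal (u j z) ∂μ) atTop :=
          lintegral_liminf_le' fun j => (hi j).aemeasurable.ennreal_ofReal
      _ ≤ liminf (fun _ : ℕ => ENNReal.ofReal c) atTop := by
          refine liminf_le_liminf (hc.mono fun j hj => ?_)
          rw [← ofReal_integral_eq_lintegral_ofReal (hi j) (h0 j)]
          exact ENNReal.ofReal_le_ofReal hj
      _ = ENNReal.ofReal c := liminf_const _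
  have hvi : Integrable v μ := by
    refine ⟨hvm, ?_⟩
    rw [hasFiniteIntegral_iff_ofReal hv0]
    exact hfat.trans_lt ENNReal.ofReal_lt_top
  refine ⟨hvi, ?_⟩
  rw [← ofReal_integral_eq_lintegral_ofReal hvi hv0] at hfat
  exact (ENNReal.ofReal_le_ofReal_iff hc0).1 hfat

theorem tendsto_posDensity (hQ : CasimirAssumptions l Q) {h : ℕ → Phase → ℝ}
    {z : Phase} (h0 : ∀ j, 0 ≤ h j z) (hlim : Tendsto (fun j => h j z) atTop (𝓝 (f z))) :
    Tendsto (fun j => posDensity l Q γ (h j) z) atTop (𝓝 (posDensity l Q γ f z)) := by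
  have hf0 : 0 ≤ f z := ge_of_tendsto' hlim h0
  have hL := Real.rpow_nonneg (angL_nonneg z) (-l)
  have h1 : Tendsto (fun j => Q (angL z ^ (-l) * h j z)) atTop (𝓝 (Q (angL z ^ (-l) * f z))) := by
    have := (hQ.continuous_max.tendsto (angL z ^ (-l) * f z)).comp (hlim.const_mul (angL z ^ (-l)))
    simp only [Function.comp_def, max_eq_left (mul_nonneg hL hf0)] at this
    refine this.congr fun j => ?_
    rw [max_eq_left (mul_nonneg hL (h0 j))]
  exact (((hlim.const_mul _).const_mul γ).add (h1.mul_const _)).add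
    ((hlim.const_mul _).const_mul _)

/-- Almost everywhere limits of sequences in the constraint set with converging local masses. -/
theorem memF_of_ae_tendsto (hl : -1 < l) (hQ : CasimirAssumptions l Q) (hγ : 0 ≤ γ)
    {h : ℕ → Phase → ℝ} (hh : ∀ j, MemF l Q γ M (h j))
    (hlim : ∀ᵐ z, Tendsto (fun j => h j z) atTop (𝓝 (f z))) {p : ℝ}
    (hp : ∀ t, p < t → ∀ᶠ j in atTop, posPart l Q γ (h j) ≤ t) :
    MemF l Q γ (∫ z, f z) f ∧ ∫ z, f z ≤ M ∧ posPart l Q γ f ≤ p ∧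
      ∀ r m, 0 < r → Tendsto (fun j => massIn (h j) r) atTop (𝓝 m) → massIn f r = m := by
  have hall : ∀ᵐ z, ∀ j, 0 ≤ h j z := ae_all_iff.2 fun j => (hh j).nonneg
  obtain ⟨hfi, hfM⟩ := integrable_and_integral_le_of_tendsto (c := M) (fun j => (hh j).integrable)
    (fun j => (hh j).nonneg) hlim (Eventually.of_forall fun j => (hh j).mass.le)
  have hf0 : ∀ᵐ z, 0 ≤ f z := by
    filter_upwards [hall, hlim] with z h1 h2
    exact ge_of_tendsto' h2 h1
  have hpl : ∀ᵐ z, Tendsto (fun j => posDensity l Q γ (h j) z) atTop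
      (𝓝 (posDensity l Q γ f z)) := by
    filter_upwards [hall, hlim] with z h1 h2
    exact tendsto_posDensity hQ h1 h2
  have hpt : ∀ t, p < t → Integrable (posDensity l Q γ f) ∧ ∫ z, posDensity l Q γ f z ≤ t := by
    intro t ht
    refine integrable_and_integral_le_of_tendsto (fun j => (hh j).integrable_posDensity)
      (fun j => (hh j).nonneg.mono fun z hz => posDensity_nonneg hQ hγ hz) hpl ?_
    filter_upwards [hp t ht] with j hj
    rwa [← (hh j).posPart_eq]
  have hs : SphericallySymmetric f := by
    intro A hA
    have h1 := (measurePreserving_isometry A).quasiMeasurePreserving.ae hlim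
    have h2 : ∀ᵐ z : Phase, ∀ j, h j (A z.1, A z.2) = h j z :=
      ae_all_iff.2 fun j => (hh j).symm A hA
    filter_upwards [h1, h2, hlim] with z h3 h4 h5
    simp only [h4] at h3
    exact tendsto_nhds_unique h3 h5
  have hmem := MemF.of_posDensity hQ hγ hfi hf0 (hpt (p + 1) (by linarith)).1 hs
  refine ⟨hmem, hfM, le_of_forall_gt_imp_ge_of_dense fun t ht => ?_, fun r m hr hm => ?_⟩
  · rw [hmem.posPart_eq]
    exact (hpt t ht).2
  refine le_antisymm ?_ ?_
  · refine le_of_forall_gt_imp_ge_of_dense fun t ht => ?_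
    rw [massIn_eq_setIntegral hfi]
    refine (integrable_and_integral_le_of_tendsto (fun j => (hh j).integrable.integrableOn)
      (fun j => ae_restrict_of_ae (hh j).nonneg) (ae_restrict_of_ae hlim) ?_).2
    filter_upwards [hm.eventually (gt_mem_nhds ht)] with j hj
    rw [← massIn_eq_setIntegral (hh j).integrable]
    exact hj.le
  · obtain ⟨C, k, F, hC, hk, hkl, hF, htr⟩ := hQ.exists_truncation
    obtain ⟨c, -, hc⟩ := exists_integral_angL_rpow_le hl
    set P : ℝ := p + 1 with hP
    have hPj : ∀ᶠ j in atTop, posPart l Q γ (h j) ≤ P := hp P (by linarith)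
    -- No local mass is lost to concentration or to high speeds. The truncated part converges by
    -- domination with Y L^l on a box, and the remainder is uniformly small for large Y and V.
    have key : ∀ Y V : ℝ, F ≤ Y → 0 < V →
        m ≤ massIn f r + C * Y ^ (-(1 / k)) * P + (V ^ 2)⁻¹ * (2 * P) := by
      intro Y V hY hV
      have hY0 : 0 < Y := hF.trans_le hY
      have t1 : Tendsto (fun j => ∫ z in phaseBox r V, truncDensity l Y (h j) z) atTop
          (𝓝 (∫ z in phaseBox r V, truncDensity l Y f z)) := by
        refine tendsto_integral_of_dominated_convergence (fun z => angL z ^ l * Y)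
          (fun j => (aestronglyMeasurable_truncDensity
            (hh j).integrable.aestronglyMeasurable).restrict)
          ((hc r V hr hV).1.mul_const Y) (fun j => ae_restrict_of_ae ?_) (ae_restrict_of_ae ?_)
        · filter_upwards [(hh j).nonneg] with z hz
          rw [Real.norm_of_nonneg (truncDensity_nonneg hY0.le hz)]
          exact truncDensity_le Y z
        · filter_upwards [hlim] with z hz
          exact ((hz.const_mul _).min tendsto_const_nhds).const_mul _
      have t2 : ∫ z in phaseBox r V, truncDensity l Y f z ≤ massIn f r := by
        rw [massIn_eq_setIntegral hfi]
        calc ∫ z in phaseBox r V, truncDensity l Y f z ≤ ∫ z in phaseBox r V, f z := by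
              refine setIntegral_mono_ae (integrableOn_truncDensity hl hY0.le
                hfi.aestronglyMeasurable hf0 hr hV) hfi.integrableOn ?_
              exact ae_angL_pos.mono fun z hz => truncDensity_le_self hz
          _ ≤ _ := setIntegral_mono_set hfi.integrableOn (ae_restrict_of_ae hf0)
              (ae_of_all _ fun z hz => (mem_phaseBox.1 hz).1)
      have t3 : m ≤ (∫ z in phaseBox r V, truncDensity l Y f z)
          + (C * Y ^ (-(1 / k)) * P + (V ^ 2)⁻¹ * (2 * P)) := by
        refine le_of_tendsto_of_tendsto hm (t1.add_const _) ?_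
        filter_upwards [hPj] with j hj
        have h1 := (hh j).massIn_le_truncation hl hQ hC hF htr hr hV hY
        have h2 := (hh j).casimir_add_Ekin_le hγ
        have h3 := (hh j).casimir_nonneg hQ
        have h4 := (hh j).kin_nonneg
        have h5 : Ekin (h j) = 1 / 2 * ∫ z, ‖z.2‖ ^ 2 * h j z := rfl
        have h6 : C * Y ^ (-(1 / k)) * casimir l Q (h j) ≤ C * Y ^ (-(1 / k)) * P := by
          gcongr; linarith
        have h7 : (V ^ 2)⁻¹ * ∫ z, ‖z.2‖ ^ 2 * h j z ≤ (V ^ 2)⁻¹ * (2 * P) := by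
          gcongr; linarith
        linarith
      linarith
    have t4 : Tendsto (fun Y : ℝ => massIn f r + C * Y ^ (-(1 / k)) * P + (Y ^ 2)⁻¹ * (2 * P))
        atTop (𝓝 (massIn f r + C * 0 * P + 0 * (2 * P))) := by
      refine (tendsto_const_nhds.add (((tendsto_rpow_neg_atTop (by positivity)).const_mul
        C).mul_const P)).add (Tendsto.mul_const _ ?_)
      exact (tendsto_pow_atTop two_ne_zero).inv_tendsto_atTop
    have t5 := ge_of_tendsto t4 ((eventually_ge_atTop F).mono fun Y hY =>
      key Y Y hY (hF.trans_le hY))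
    simpa using t5

/-- Squeeze between nearby rational radii, using monotonicity of the approximants and continuity of
the limit. Countably many radii thus suffice in the subsequence selection. -/
theorem tendsto_of_monotone_of_rat {u : ℕ → ℝ → ℝ} {v : ℝ → ℝ} (hu : ∀ n, Monotone (u n))
    (hv : Continuous v)
    (hq : ∀ q : ℚ, (0 : ℝ) < q → Tendsto (fun n => u n q) atTop (𝓝 (v q))) {r : ℝ} (hr : 0 < r) :
    Tendsto (fun n => u n r) atTop (𝓝 (v r)) := by
  refine tendsto_order.2 ⟨fun a ha => ?_, fun a ha => ?_⟩
  · obtain ⟨s, hs, hs'⟩ := exists_Ioc_subset_of_mem_nhds (hv.continuousAt.eventually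
      (lt_mem_nhds ha)) ⟨0, hr⟩
    obtain ⟨q, hq1, hq2⟩ := exists_rat_btwn (max_lt hs hr)
    have h1 : a < v q := hs' ⟨(le_max_left _ _).trans_lt hq1, hq2.le⟩
    filter_upwards [(hq q ((le_max_right _ _).trans_lt hq1)).eventually (lt_mem_nhds h1)] with n hn
    exact hn.trans_le (hu n hq2.le)
  · obtain ⟨s, hs, hs'⟩ := exists_Ico_subset_of_mem_nhds (hv.continuousAt.eventually
      (gt_mem_nhds ha)) ⟨r + 1, by linarith⟩
    obtain ⟨q, hq1, hq2⟩ := exists_rat_btwn hs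
    have h1 : v q < a := hs' ⟨hq1.le, hq2⟩
    filter_upwards [(hq q (hr.trans hq1)).eventually (gt_mem_nhds h1)] with n hn
    exact (hu n hq1.le).trans_lt hn

/-- Along energy-bounded sequences with pointwise converging mass functions the field energies
and the fields converge. -/
theorem tendsto_field_of_tendsto_massIn (hl : -1 < l) (hQ : CasimirAssumptions l Q)
    {h : ℕ → Phase → ℝ} {M' P : ℝ} (hh : ∀ j, MemF l Q γ M (h j)) (hf : MemF l Q γ M' f)
    (hP : ∀ j, casimir l Q (h j) + Ekin (h j) ≤ P)
    (hm : ∀ r, 0 < r → Tendsto (fun j => massIn (h j) r) atTop (𝓝 (massIn f r))) :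
    Tendsto (fun j => fieldDistSq (h j) f) atTop (𝓝 0) ∧
      Tendsto (fun j => Epot (h j)) atTop (𝓝 (Epot f)) := by
  obtain ⟨a, θ, C, P₀, ha, hθ, hθ1, hP₀, hmaj⟩ := exists_uniform_majorant hl hQ
  set X : ℝ := max P₀ P with hX
  have hX0 : 0 < X := by have := le_max_left P₀ P; linarith
  have b1 : ∀ j, ∀ s, 0 < s → massIn (h j) s ^ 2 / s ^ 2 ≤ fieldMajorant C a (X ^ (-θ)) M s :=
    fun j => hmaj γ M (h j) (hh j) X (le_max_left _ _) ((hP j).trans (le_max_right _ _))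
  have i1 := (integrableOn_fieldMajorant (C := C) (M := M) ha (Real.rpow_pos_of_pos hX0 (-θ))).1
  have i2 := hf.integrableOn_massIn_sq hl hQ
  constructor
  · have t : Tendsto (fun j => ∫ s in Ioi (0 : ℝ), (massIn (h j) s - massIn f s) ^ 2 / s ^ 2) atTop
        (𝓝 (∫ _ in Ioi (0 : ℝ), 0)) := by
      refine tendsto_integral_of_dominated_convergence _ (fun j => ?_) (i1.add i2)
        (fun j => ?_) ?_
      · have h1 := (continuous_massIn (hh j).integrable).measurable
        have h2 := (continuous_massIn hf.integrable).measurable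
        exact (((h1.sub h2).pow_const 2).div (by fun_prop)).aestronglyMeasurable
      · filter_upwards [ae_restrict_mem measurableSet_Ioi] with s hs
        have h1 := (hh j).massIn_nonneg s
        have h2 := hf.massIn_nonneg s
        rw [Real.norm_of_nonneg (by positivity)]
        refine le_trans ?_ (add_le_add_left (b1 j s hs) _)
        rw [← add_div]
        gcongr
        nlinarith [mul_nonneg h1 h2]
      · filter_upwards [ae_restrict_mem measurableSet_Ioi] with s hs
        have h1 := (((hm s hs).sub_const (massIn f s)).pow 2).div_const (s ^ 2)
        simpa using h1
    simp only [fieldDistSq_eq]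
    simpa using t.const_mul (4 * Real.pi)
  · have t : Tendsto (fun j => ∫ s in Ioi (0 : ℝ), massIn (h j) s ^ 2 / s ^ 2) atTop
        (𝓝 (∫ s in Ioi (0 : ℝ), massIn f s ^ 2 / s ^ 2)) := by
      refine tendsto_integral_of_dominated_convergence _ (fun j => ?_) i1 (fun j => ?_) ?_
      · have h1 := (continuous_massIn (hh j).integrable).measurable
        exact ((h1.pow_const 2).div (by fun_prop)).aestronglyMeasurable
      · filter_upwards [ae_restrict_mem measurableSet_Ioi] with s hs
        rw [Real.norm_of_nonneg (by positivity)]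
        exact b1 j s hs
      · filter_upwards [ae_restrict_mem measurableSet_Ioi] with s hs
        exact ((hm s hs).pow 2).div_const (s ^ 2)
    simp only [Epot_eq]
    exact t.const_mul _

/-- Sequences in the constraint set with bounded positive part have, along a subsequence, a limit
for which the positive part is lower semicontinuous and the fields converge. -/
theorem exists_subseq_limit (hl : -1 < l) (hQ : CasimirAssumptions l Q) (hγ : 0 ≤ γ)
    {F : ℕ → Phase → ℝ} (hF : ∀ n, MemF l Q γ M (F n)) {P : ℝ}
    (hP : ∀ n, posPart l Q γ (F n) ≤ P) :
    ∃ (ψ : ℕ → ℕ) (p : ℝ) (f : Phase → ℝ), StrictMono ψ ∧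
      Tendsto (fun n => posPart l Q γ (F (ψ n))) atTop (𝓝 p) ∧
      MemF l Q γ (∫ z, f z) f ∧ ∫ z, f z ≤ M ∧ posPart l Q γ f ≤ p ∧
      Tendsto (fun n => fieldDistSq (F (ψ n)) f) atTop (𝓝 0) ∧
      Tendsto (fun n => Epot (F (ψ n))) atTop (𝓝 (Epot f)) := by
  have hposnn : ∀ n, 0 ≤ posPart l Q γ (F n) := fun n => by
    rw [(hF n).posPart_eq]
    exact integral_nonneg_of_ae ((hF n).nonneg.mono fun z hz => posDensity_nonneg hQ hγ hz)
  -- One compact product records the positive part (at `none`) and all masses at rational radii, so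
  -- a single extraction replaces a diagonal argument.
  set X : ℕ → Option ℚ → ℝ := fun n o => o.elim (posPart l Q γ (F n)) fun q => massIn (F n) q
    with hX
  have hK : IsCompact (Set.pi univ fun o : Option ℚ => Icc (0 : ℝ) (o.elim P fun _ => M)) :=
    isCompact_univ_pi fun o => isCompact_Icc
  obtain ⟨Y, -, ψ, hψ, hY⟩ := hK.tendsto_subseq (x := X) (fun n => by
    rintro (_ | q) -
    · exact ⟨hposnn n, hP n⟩
    · exact ⟨(hF n).massIn_nonneg _, (hF n).massIn_le _⟩)
  have hY' := tendsto_pi_nhds.1 hY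
  set p : ℝ := Y none with hp
  have hYp : Tendsto (fun n => posPart l Q γ (F (ψ n))) atTop (𝓝 p) := hY' none
  have hYq : ∀ q : ℚ, Tendsto (fun n => massIn (F (ψ n)) q) atTop (𝓝 (Y (some q))) :=
    fun q => hY' (some q)
  -- States obeying every upper bound on the positive part, and every error bound on the rational
  -- masses, valid along the tail from j. The conditions are stable under midpoints and force any
  -- selection to have the limiting mass function.
  set C : ℕ → Set (Phase → ℝ) := fun j => {h | MemF l Q γ M h ∧
    (∀ t, (∀ n, j ≤ n → posPart l Q γ (F (ψ n)) ≤ t) → posPart l Q γ h ≤ t) ∧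
    ∀ (q : ℚ) (t : ℝ), (∀ n, j ≤ n → |massIn (F (ψ n)) q - Y (some q)| ≤ t) →
      |massIn h q - Y (some q)| ≤ t} with hC
  obtain ⟨h, f, hhC, -, hlim⟩ := exists_ae_tendsto_of_midpoint_convex (μ := (volume : Measure Phase))
    C (fun j => ⟨F (ψ j), hF _, fun t ht => ht j le_rfl, fun q t ht => ht j le_rfl⟩)
    (fun i j hij h hh => ⟨hh.1, fun t ht => hh.2.1 t fun n hn => ht n (hij.trans hn),
      fun q t ht => hh.2.2 q t fun n hn => ht n (hij.trans hn)⟩)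
    (fun j u hu v hv => by
      obtain ⟨h1, h2⟩ := hu.1.midpoint hQ hγ hv.1
      refine ⟨h1, fun t ht => ?_, fun q t ht => ?_⟩
      · have a1 := hu.2.1 t ht
        have a2 := hv.2.1 t ht
        linarith
      · have a1 := abs_le.1 (hu.2.2 q t ht)
        have a2 := abs_le.1 (hv.2.2 q t ht)
        rw [massIn_midpoint hu.1.integrable hv.1.integrable, abs_le]
        constructor <;> linarith [a1.1, a1.2, a2.1, a2.2])
    (fun u hu => hu.1.integrable) (fun u hu => hu.1.nonneg) M (fun u hu => hu.1.mass.le)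
  obtain ⟨hmem, hmass, hpos, hloc⟩ := memF_of_ae_tendsto hl hQ hγ (fun j => (hhC j).1) hlim (p := p)
    (fun t ht => by
      obtain ⟨N, hN⟩ := eventually_atTop.1 (hYp.eventually (gt_mem_nhds ht))
      filter_upwards [eventually_ge_atTop N] with j hj
      exact (hhC j).2.1 t fun n hn => (hN n (hj.trans hn)).le)
  have hq : ∀ q : ℚ, (0 : ℝ) < q → massIn f q = Y (some q) := by
    intro q hq0
    refine hloc q _ hq0 (Metric.tendsto_atTop.2 fun ε hε => ?_)
    obtain ⟨N, hN⟩ := Metric.tendsto_atTop.1 (hYq q) (ε / 2) (by positivity)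
    refine ⟨N, fun j hj => ?_⟩
    have := (hhC j).2.2 q (ε / 2) fun n hn => (hN n (hj.trans hn)).le
    rw [Real.dist_eq]
    linarith
  -- The selection was needed only to build f; from here on the original subsequence converges to it
  -- in terms of mass functions.
  have hconv : ∀ r, 0 < r → Tendsto (fun n => massIn (F (ψ n)) r) atTop (𝓝 (massIn f r)) :=
    fun r hr => tendsto_of_monotone_of_rat
      (fun n => massIn_mono (hF (ψ n)).integrable (hF (ψ n)).nonneg)
      (continuous_massIn hmem.integrable) (fun q hq0 => by rw [hq q hq0]; exact hYq q) hr
  obtain ⟨c1, c2⟩ := tendsto_field_of_tendsto_massIn hl hQ (fun n => hF (ψ n)) hmem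
    (fun n => ((hF (ψ n)).casimir_add_Ekin_le hγ).trans (hP _)) hconv
  exact ⟨ψ, p, f, hψ, hYp, hmem, hmass, hpos, c1, c2⟩

/-- States of almost minimal energy are close to the set of minimizers. -/
theorem exists_minimizer_near (hl : -1 < l) (hQ : CasimirAssumptions l Q) (hγ : 0 ≤ γ)
    {f₀ : Phase → ℝ} (h₀ : IsMinimizer l Q γ M f₀) (hneg : energyCasimir l Q γ f₀ < 0)
    {ε : ℝ} (hε : 0 < ε) :
    ∃ δ : ℝ, 0 < δ ∧ ∀ f, MemF l Q γ M f → energyCasimir l Q γ f < energyCasimir l Q γ f₀ + δ →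
      ∃ g, IsMinimizer l Q γ M g ∧ energyCasimir l Q γ f - energyCasimir l Q γ f₀
        + 1 / (4 * Real.pi) * fieldDistSq f g < ε := by
  by_contra hcon
  push Not at hcon
  choose F hF hFE hFfar using fun n : ℕ => hcon (1 / ((n : ℝ) + 1)) (by positivity)
  obtain ⟨P, hP⟩ := exists_posPart_le hl hQ M (energyCasimir l Q γ f₀ + 1)
  obtain ⟨ψ, p, f, hψ, hp, hf, hfM, hfp, hd, hE⟩ := exists_subseq_limit hl hQ hγ hF (P := P)
    (fun n => hP γ _ hγ (hF n) ((hFE n).le.trans (by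
      have : 1 / ((n : ℝ) + 1) ≤ 1 := by
        rw [div_le_one (by positivity)]
        have : (0 : ℝ) ≤ n := n.cast_nonneg
        linarith
      linarith)))
  have hsmall : Tendsto (fun n => 1 / ((ψ n : ℝ) + 1)) atTop (𝓝 0) :=
    tendsto_one_div_add_atTop_nhds_zero_nat.comp hψ.tendsto_atTop
  have hDle : energyCasimir l Q γ f ≤ energyCasimir l Q γ f₀ := by
    have h1 : p + Epot f ≤ energyCasimir l Q γ f₀ + 0 :=
      le_of_tendsto_of_tendsto' (hp.add hE) (hsmall.const_add _) fun n => (hFE (ψ n)).le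
    unfold energyCasimir at h1 ⊢
    linarith
  -- A limit of zero mass has D ≥ 0, contradicting negativity. A limit of positive mass m < M,
  -- stretched by M/m > 1, would have energy at most (M/m) D(f) < D(f) ≤ D(f₀), contradicting
  -- minimality of f₀.
  have hmass : ∫ z, f z = M := by
    refine le_antisymm hfM (not_lt.1 fun hlt => ?_)
    rcases hf.mass_nonneg.eq_or_lt with h0 | h0
    · have hm : ∀ s, massIn f s = 0 := fun s =>
        le_antisymm ((hf.massIn_le s).trans h0.symm.le) (hf.massIn_nonneg s)
      have h1 : Epot f = 0 := by rw [Epot_eq]; simp [hm]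
      have h2 : 0 ≤ posPart l Q γ f := by
        rw [hf.posPart_eq]
        exact integral_nonneg_of_ae (hf.nonneg.mono fun z hz => posDensity_nonneg hQ hγ hz)
      unfold energyCasimir at hDle hneg
      linarith
    · have hμ : 1 < M / ∫ z, f z := (one_lt_div h0).2 hlt
      obtain ⟨h1, h2⟩ := hf.comp_radialStretch hμ.le
      rw [div_mul_cancel₀ _ h0.ne'] at h1
      have h3 := h₀.2 _ h1
      nlinarith
  rw [hmass] at hf
  have hmin : IsMinimizer l Q γ M f := ⟨hf, fun g hg => hDle.trans (h₀.2 g hg)⟩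
  -- Along the subsequence the excess energy tends to zero and the fields converge to that of the
  -- minimizer just found, so the assumed distance ε cannot persist.
  have h1 : ε ≤ 0 + 1 / (4 * Real.pi) * 0 := by
    refine ge_of_tendsto (hsmall.add (hd.const_mul (1 / (4 * Real.pi))))
      (Eventually.of_forall fun n => ?_)
    have h2 := hFfar (ψ n) f hmin
    have h3 := hFE (ψ n)
    linarith
  linarith

end Compactness

/-! ### Sup and gradient bounds for the Poisson equation by barriers -/

section MaximumPrinciple

open InnerProductSpace

variable {w : E3 → ℝ}

theorem hasDerivAt_line (hw : Differentiable ℝ w) (x e : E3) (s : ℝ) :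
    HasDerivAt (fun s : ℝ => w (x + s • e)) (fderiv ℝ w (x + s • e) e) s := by
  have h1 : HasDerivAt (fun s : ℝ => x + s • e) e s := by
    simpa using ((hasDerivAt_id s).smul_const e).const_add x
  exact (hw _).hasFDerivAt.comp_hasDerivAt s h1

theorem hasDerivAt_deriv_line (hw : ContDiff ℝ 2 w) (x e : E3) (s : ℝ) :
    HasDerivAt (deriv fun s : ℝ => w (x + s • e)) (fderiv ℝ (fderiv ℝ w) (x + s • e) e e) s := by
  have hd : Differentiable ℝ w := hw.differentiable (by norm_num)
  have h0 : (deriv fun s : ℝ => w (x + s • e)) = fun s => fderiv ℝ w (x + s • e) e := by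
    ext s
    exact (hasDerivAt_line hd x e s).deriv
  have hd2 : Differentiable ℝ (fderiv ℝ w) :=
    (hw.fderiv_right (m := 1) (by norm_num)).differentiable (by norm_num)
  have h1 : HasDerivAt (fun s : ℝ => x + s • e) e s := by
    simpa using ((hasDerivAt_id s).smul_const e).const_add x
  rw [h0]
  have h2 := (hd2 (x + s • e)).hasFDerivAt.comp_hasDerivAt s h1
  exact h2.clm_apply (hasDerivAt_const s e) |>.congr_deriv (by simp)

/-- The Laplacian as a sum of second derivatives along the lines of an orthonormal basis. -/
theorem laplacian_eq_sum_deriv (hw : ContDiff ℝ 2 w) (b : OrthonormalBasis (Fin 3) ℝ E3) (x : E3) :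
    Laplacian.laplacian w x = ∑ i, deriv (deriv fun s : ℝ => w (x + s • b i)) 0 := by
  rw [laplacian_eq_iteratedFDeriv_orthonormalBasis w b]
  refine Finset.sum_congr rfl fun i _ => ?_
  rw [(hasDerivAt_deriv_line hw x (b i) 0).deriv, iteratedFDeriv_two_apply]
  simp

theorem laplacian_comp_isometry (hw : ContDiff ℝ 2 w) (A : E3 ≃ₗᵢ[ℝ] E3) (x : E3) :
    Laplacian.laplacian (fun x => w (A x)) x = Laplacian.laplacian w (A x) := by
  have hwA : ContDiff ℝ 2 fun x => w (A x) := hw.comp A.contDiff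
  rw [laplacian_eq_sum_deriv hwA (EuclideanSpace.basisFun (Fin 3) ℝ),
    laplacian_eq_sum_deriv hw ((EuclideanSpace.basisFun (Fin 3) ℝ).map A)]
  simp

theorem laplacian_comp_add_left (hw : ContDiff ℝ 2 w) (x₀ x : E3) :
    Laplacian.laplacian (fun x => w (x₀ + x)) x = Laplacian.laplacian w (x₀ + x) := by
  have hwA : ContDiff ℝ 2 fun x => w (x₀ + x) := hw.comp (by fun_prop)
  rw [laplacian_eq_sum_deriv hwA (EuclideanSpace.basisFun (Fin 3) ℝ),
    laplacian_eq_sum_deriv hw (EuclideanSpace.basisFun (Fin 3) ℝ)]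
  simp only [add_assoc]

/-- A positive second derivative would make s also a local minimum, hence φ locally constant, with
second derivative zero. -/
theorem deriv_deriv_nonpos_of_isLocalMax {φ : ℝ → ℝ} {s : ℝ} (hφ : ContinuousAt φ s)
    (h : IsLocalMax φ s) : deriv (deriv φ) s ≤ 0 := by
  by_contra hc
  have h1 : IsLocalMin φ s := isLocalMin_of_deriv_deriv_pos (not_le.1 hc) h.deriv_eq_zero hφ
  have h2 : φ =ᶠ[𝓝 s] fun _ => φ s := by
    filter_upwards [h, h1] with y hy hy'
    exact le_antisymm hy hy'
  have h3 : deriv φ =ᶠ[𝓝 s] fun _ => 0 := by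
    have := h2.deriv
    simpa using this
  have h4 := h3.deriv_eq
  simp at h4
  linarith

theorem laplacian_nonpos_of_isLocalMax (hw : ContDiff ℝ 2 w) {x : E3} (h : IsLocalMax w x) :
    Laplacian.laplacian w x ≤ 0 := by
  rw [laplacian_eq_sum_deriv hw (EuclideanSpace.basisFun (Fin 3) ℝ)]
  refine Finset.sum_nonpos fun i _ => deriv_deriv_nonpos_of_isLocalMax ?_ ?_
  · exact (hw.continuous.comp (by fun_prop)).continuousAt
  · have hc : ContinuousAt (fun s : ℝ => x + s • (EuclideanSpace.basisFun (Fin 3) ℝ) i) 0 := by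
      fun_prop
    have h' : IsLocalMax w (x + (0 : ℝ) • (EuclideanSpace.basisFun (Fin 3) ℝ) i) := by simpa using h
    exact IsLocalMax.comp_continuous (g := fun s : ℝ =>
      x + s • (EuclideanSpace.basisFun (Fin 3) ℝ) i) h' hc

/-- A strictly subharmonic function vanishing at infinity is nonpositive. -/
theorem nonpos_of_laplacian_pos (hw : ContDiff ℝ 2 w) (hpos : ∀ x, 0 < Laplacian.laplacian w x)
    (h0 : Tendsto w (cocompact E3) (𝓝 0)) (x : E3) : w x ≤ 0 := by
  by_contra hx
  obtain ⟨y, hy⟩ := hw.continuous.exists_forall_ge' x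
    ((h0.eventually (gt_mem_nhds (not_le.1 hx))).mono fun z hz => hz.le)
  exact not_lt.2 (laplacian_nonpos_of_isLocalMax hw (Eventually.of_forall hy)) (hpos y)

/-- The Plummer potential (up to sign). -/
noncomputable def plummer (x : E3) : ℝ := (√(1 + ‖x‖ ^ 2))⁻¹

theorem contDiff_plummer : ContDiff ℝ 2 plummer := by
  unfold plummer
  refine ContDiff.inv (ContDiff.sqrt (contDiff_const.add (contDiff_norm_sq ℝ)) fun x => ?_) fun x => ?_
  · positivity
  · positivity

theorem laplacian_plummer (x : E3) :
    Laplacian.laplacian plummer x = -(3 * (√(1 + ‖x‖ ^ 2))⁻¹ ^ 5) := by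
  rw [laplacian_eq_sum_deriv contDiff_plummer (EuclideanSpace.basisFun (Fin 3) ℝ)]
  set q : ℝ := √(1 + ‖x‖ ^ 2) with hq
  have hq0 : 0 < q := by positivity
  have hq2 : q ^ 2 = 1 + ‖x‖ ^ 2 := Real.sq_sqrt (by positivity)
  have hline : ∀ i (s : ℝ), plummer (x + s • (EuclideanSpace.basisFun (Fin 3) ℝ) i)
      = (√(1 + ‖x‖ ^ 2 + 2 * s * x i + s ^ 2))⁻¹ := by
    intro i s
    unfold plummer
    congr 2
    rw [norm_add_sq_real, real_inner_smul_right, norm_smul, mul_pow]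
    simp [EuclideanSpace.inner_single_right]
    ring
  have hpos : ∀ i (s : ℝ), 0 < 1 + ‖x‖ ^ 2 + 2 * s * x i + s ^ 2 := by
    intro i s
    have h1 : |x i| ≤ ‖x‖ := PiLp.norm_apply_le x i
    have h2 : x i ^ 2 ≤ ‖x‖ ^ 2 := by
      rw [← sq_abs]; exact pow_le_pow_left₀ (abs_nonneg _) h1 2
    nlinarith [sq_nonneg (s + x i)]
  have hd1 : ∀ i (s : ℝ), HasDerivAt (fun s : ℝ => (√(1 + ‖x‖ ^ 2 + 2 * s * x i + s ^ 2))⁻¹)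
      (-((x i + s) * (√(1 + ‖x‖ ^ 2 + 2 * s * x i + s ^ 2))⁻¹ ^ 3)) s := by
    intro i s
    have h1 : HasDerivAt (fun s : ℝ => 1 + ‖x‖ ^ 2 + 2 * s * x i + s ^ 2)
        (2 * x i + 2 * s) s := by
      have a1 := (((((hasDerivAt_id' s).const_mul 2).mul_const (x i)).const_add
        (1 + ‖x‖ ^ 2)).fun_add (hasDerivAt_pow 2 s))
      exact a1.congr_deriv (by simp)
    have h2 := (h1.sqrt (hpos i s).ne').inv (Real.sqrt_pos.2 (hpos i s)).ne'
    refine h2.congr_deriv ?_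
    have := Real.sqrt_pos.2 (hpos i s)
    field_simp
  have hd2 : ∀ i, deriv (deriv fun s : ℝ => plummer (x + s • (EuclideanSpace.basisFun (Fin 3) ℝ) i))
      0 = -q⁻¹ ^ 3 + 3 * x i ^ 2 * q⁻¹ ^ 5 := by
    intro i
    have e1 : (deriv fun s : ℝ => plummer (x + s • (EuclideanSpace.basisFun (Fin 3) ℝ) i))
        = fun s => -((x i + s) * (√(1 + ‖x‖ ^ 2 + 2 * s * x i + s ^ 2))⁻¹ ^ 3) := by
      ext s
      simp only [hline]
      exact (hd1 i s).deriv
    rw [e1]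
    have h1 := (((hasDerivAt_id (0 : ℝ)).const_add (x i)).mul ((hd1 i 0).pow 3)).neg
    refine (h1.congr_deriv ?_).deriv
    simp [← hq]
    ring
  simp only [hd2]
  rw [Finset.sum_add_distrib, ← Finset.sum_mul, ← Finset.mul_sum]
  have h3 : ∑ i, x i ^ 2 = ‖x‖ ^ 2 := by
    rw [EuclideanSpace.norm_sq_eq]
    simp [sq_abs]
  rw [h3, show ‖x‖ ^ 2 = q ^ 2 - 1 by rw [hq2]; ring]
  simp
  field_simp
  ring

theorem tendsto_plummer : Tendsto plummer (cocompact E3) (𝓝 0) := by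
  have h1 : Tendsto (fun x : E3 => ‖x‖) (cocompact E3) atTop := tendsto_norm_cocompact_atTop
  have h2 : Tendsto (fun x : E3 => √(1 + ‖x‖ ^ 2)) (cocompact E3) atTop := by
    refine tendsto_atTop_mono (fun x => ?_) h1
    exact Real.le_sqrt_of_sq_le (by linarith)
  exact h2.inv_tendsto_atTop

/-- Supremum bound for solutions of the Poisson equation vanishing at infinity. -/
theorem le_of_laplacian_bound (hw : ContDiff ℝ 2 w) (h0 : Tendsto w (cocompact E3) (𝓝 0))
    {N R : ℝ} (hN : 0 < N) (hb : ∀ x, |Laplacian.laplacian w x| ≤ N)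
    (hz : ∀ x, R < ‖x‖ → Laplacian.laplacian w x = 0) (x : E3) :
    w x ≤ N * (√(1 + R ^ 2)) ^ 5 := by
  -- With this constant c times the Plummer potential has Laplacian at most −3N on the ball of
  -- radius R and negative outside, so subtracting it makes w strictly subharmonic.
  set c : ℝ := N * (√(1 + R ^ 2)) ^ 5 with hc
  have hc0 : 0 < c := by positivity
  have hcp : ContDiff ℝ 2 (c • plummer) := contDiff_plummer.const_smul c
  have h1 : w x - (c • plummer) x ≤ 0 := by
    refine nonpos_of_laplacian_pos (w := w - c • plummer) (hw.sub hcp) (fun y => ?_) ?_ x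
    · rw [ContDiffAt.laplacian_sub hw.contDiffAt hcp.contDiffAt,
        laplacian_smul c contDiff_plummer.contDiffAt, laplacian_plummer, smul_eq_mul]
      have hq : 0 < √(1 + ‖y‖ ^ 2) := by positivity
      have h2 : 0 < c * (3 * (√(1 + ‖y‖ ^ 2))⁻¹ ^ 5) := by positivity
      rcases le_or_gt ‖y‖ R with h | h
      · have h3 : N ≤ c * (√(1 + ‖y‖ ^ 2))⁻¹ ^ 5 := by
          rw [inv_pow, ← div_eq_mul_inv, le_div_iff₀ (by positivity), hc]
          gcongr
        have h4 := neg_abs_le (Laplacian.laplacian w y)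
        have h5 := hb y
        linarith
      · rw [hz y h]
        linarith
    · have := h0.sub (tendsto_plummer.const_mul c)
      rw [mul_zero, sub_zero] at this
      exact this
  have h2 : plummer x ≤ 1 := by
    unfold plummer
    refine inv_le_one_of_one_le₀ (Real.one_le_sqrt.2 ?_)
    have := sq_nonneg ‖x‖
    linarith
  have h3 : c * plummer x ≤ c * 1 := by gcongr
  simp only [Pi.smul_apply, smul_eq_mul] at h1
  linarith

theorem abs_le_of_laplacian_bound (hw : ContDiff ℝ 2 w) (h0 : Tendsto w (cocompact E3) (𝓝 0))
    {N R : ℝ} (hN : 0 < N) (hb : ∀ x, |Laplacian.laplacian w x| ≤ N)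
    (hz : ∀ x, R < ‖x‖ → Laplacian.laplacian w x = 0) (x : E3) :
    |w x| ≤ N * (√(1 + R ^ 2)) ^ 5 := by
  have hneg : ∀ y, Laplacian.laplacian (-w) y = -Laplacian.laplacian w y := fun y => by
    rw [laplacian_neg]; rfl
  refine abs_le'.2 ⟨le_of_laplacian_bound hw h0 hN hb hz x, ?_⟩
  exact le_of_laplacian_bound (w := -w) hw.neg (by have := h0.neg; rwa [neg_zero] at this) hN
    (fun y => by rw [hneg, abs_neg]; exact hb y) (fun y hy => by rw [hneg, hz y hy, neg_zero]) x

theorem eq_zero_of_laplacian_eq_zero (hw : ContDiff ℝ 2 w) (h0 : Tendsto w (cocompact E3) (𝓝 0))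
    (hz : ∀ x, Laplacian.laplacian w x = 0) (x : E3) : w x = 0 := by
  have h1 : ∀ N : ℝ, 0 < N → |w x| ≤ N := by
    intro N hN
    have := abs_le_of_laplacian_bound (R := 0) hw h0 hN (fun y => by rw [hz y, abs_zero]; exact hN.le)
      (fun y _ => hz y) x
    simpa using this
  exact abs_eq_zero.1 (le_antisymm (le_of_forall_gt_imp_ge_of_dense h1) (abs_nonneg _))

/-- The barrier in a slab orthogonal to `e`. -/
theorem laplacian_slab_barrier (a b : ℝ) {e : E3} (he : ‖e‖ = 1) (x : E3) :
    Laplacian.laplacian (fun x : E3 => a * ⟪x, e⟫ + b * (⟪x, e⟫ * (1 - ⟪x, e⟫))) x = -(2 * b) := by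
  have hcd : ContDiff ℝ 2 fun x : E3 => a * ⟪x, e⟫ + b * (⟪x, e⟫ * (1 - ⟪x, e⟫)) := by
    have h : ContDiff ℝ 2 fun x : E3 => ⟪x, e⟫ := contDiff_id.inner ℝ contDiff_const
    exact (contDiff_const.mul h).add (contDiff_const.mul (h.mul (contDiff_const.sub h)))
  set B := EuclideanSpace.basisFun (Fin 3) ℝ
  rw [laplacian_eq_sum_deriv hcd B]
  have h1 : ∀ i, deriv (deriv fun s : ℝ => a * ⟪x + s • B i, e⟫
      + b * (⟪x + s • B i, e⟫ * (1 - ⟪x + s • B i, e⟫))) 0 = -(2 * b) * ⟪B i, e⟫ ^ 2 := by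
    intro i
    set p : ℝ := ⟪x, e⟫
    set m : ℝ := ⟪B i, e⟫
    have e0 : ∀ s : ℝ, ⟪x + s • B i, e⟫ = p + s * m := fun s => by
      rw [inner_add_left, real_inner_smul_left]
    simp only [e0]
    have d0 : ∀ s : ℝ, HasDerivAt (fun s : ℝ => p + s * m) m s := fun s => by
      simpa using ((hasDerivAt_id s).mul_const m).const_add p
    have d1 : ∀ s : ℝ, HasDerivAt (fun s : ℝ => a * (p + s * m)
        + b * ((p + s * m) * (1 - (p + s * m)))) (a * m + b * (m * (1 - 2 * (p + s * m)))) s := by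
      intro s
      refine (((d0 s).const_mul a).add (((d0 s).mul ((d0 s).const_sub 1)).const_mul b)).congr_deriv ?_
      ring
    have e1 : (deriv fun s : ℝ => a * (p + s * m) + b * ((p + s * m) * (1 - (p + s * m))))
        = fun s => a * m + b * (m * (1 - 2 * (p + s * m))) := by
      ext s; exact (d1 s).deriv
    rw [e1]
    refine HasDerivAt.deriv ?_
    refine ((((((d0 0).const_mul 2).const_sub 1).const_mul m).const_mul b).const_add
      (a * m)).congr_deriv ?_
    ring
  simp only [h1]
  rw [← Finset.mul_sum, OrthonormalBasis.sum_sq_inner_right, he]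
  ring

/-- The odd part of w under reflection in the plane orthogonal to e vanishes on that plane and is at
most 2S on the opposite face of the unit slab. The barrier dominates it on both faces and has
Laplacian −4N, while that of the odd part is at least −2N, so the difference has no positive maximum
inside. -/
theorem odd_part_le_barrier (hw : ContDiff ℝ 2 w) (h0 : Tendsto w (cocompact E3) (𝓝 0))
    {N S : ℝ} (hN : 0 < N) (hb : ∀ x, |Laplacian.laplacian w x| ≤ N) (hS : ∀ x, |w x| ≤ S)
    {e : E3} (he : ‖e‖ = 1) {x : E3} (hx0 : 0 ≤ ⟪x, e⟫) (hx1 : ⟪x, e⟫ ≤ 1) :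
    w x - w ((ℝ ∙ e)ᗮ.reflection x)
      ≤ 2 * S * ⟪x, e⟫ + 2 * N * (⟪x, e⟫ * (1 - ⟪x, e⟫)) := by
  set σ := (ℝ ∙ e)ᗮ.reflection with hσ
  have hσe : σ e = -e := Submodule.reflection_orthogonalComplement_singleton_eq_neg e
  have hσi : ∀ y, ⟪σ y, e⟫ = -⟪y, e⟫ := by
    intro y
    have h1 : ⟪σ y, σ e⟫ = ⟪y, e⟫ := σ.inner_map_map y e
    rw [hσe, inner_neg_right] at h1
    linarith
  have hσfix : ∀ y, ⟪y, e⟫ = 0 → σ y = y := by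
    intro y hy
    refine Submodule.reflection_mem_subspace_eq_self ?_
    rw [Submodule.mem_orthogonal_singleton_iff_inner_left]
    exact hy
  have hS0 : 0 ≤ S := (abs_nonneg _).trans (hS 0)
  set φ : E3 → ℝ := w - fun y => w (σ y) with hφ
  set β : E3 → ℝ := fun x : E3 => 2 * S * ⟪x, e⟫ + 2 * N * (⟪x, e⟫ * (1 - ⟪x, e⟫)) with hβ
  have hwσ : ContDiff ℝ 2 fun y => w (σ y) := hw.comp σ.contDiff
  have hφc : ContDiff ℝ 2 φ := hw.sub hwσ
  have hin : ContDiff ℝ 2 fun x : E3 => ⟪x, e⟫ := contDiff_id.inner ℝ contDiff_const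
  have hβc : ContDiff ℝ 2 β :=
    (contDiff_const.mul hin).add (contDiff_const.mul (hin.mul (contDiff_const.sub hin)))
  have hφ2 : ∀ y, φ y ≤ 2 * S := by
    intro y
    have a1 := le_abs_self (w y)
    have a2 := neg_abs_le (w (σ y))
    have a3 := hS y
    have a4 := hS (σ y)
    simp only [hφ, Pi.sub_apply]
    linarith
  by_contra hcon
  set g : E3 → ℝ := φ - β with hg
  have hgc : ContDiff ℝ 2 g := hφc.sub hβc
  have hgx : 0 < g x := by
    simp only [hg, hφ, hβ, Pi.sub_apply]
    linarith
  have hφ0 : Tendsto φ (cocompact E3) (𝓝 0) := by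
    have := h0.sub (h0.comp σ.toHomeomorph.isClosedEmbedding.tendsto_cocompact)
    rw [sub_zero] at this
    exact this
  set D : Set E3 := {y | 0 ≤ ⟪y, e⟫ ∧ ⟪y, e⟫ ≤ 1} with hD
  have hDc : IsClosed D := (isClosed_le continuous_const hin.continuous).inter
    (isClosed_le hin.continuous continuous_const)
  have hβD : ∀ y ∈ D, 0 ≤ β y := by
    intro y hy
    have h1 := hy.1
    have h2 : 0 ≤ 1 - ⟪y, e⟫ := sub_nonneg.2 hy.2
    simp only [hβ]
    positivity
  obtain ⟨y, hyD, hy⟩ := hgc.continuous.continuousOn.exists_isMaxOn' hDc (x₀ := x) ⟨hx0, hx1⟩ (by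
    rw [Filter.eventually_inf_principal]
    filter_upwards [hφ0.eventually (gt_mem_nhds hgx)] with y hy hyD
    have := hβD y hyD
    simp only [hg, Pi.sub_apply] at hy ⊢
    linarith)
  have hgy : 0 < g y := hgx.trans_le (hy ⟨hx0, hx1⟩)
  rcases hyD.1.eq_or_lt with h | h
  · have e1 : g y = 0 := by simp [hg, hφ, hβ, ← h, hσfix y h.symm]
    exact hgy.ne' e1
  rcases hyD.2.eq_or_lt with h' | h'
  · have e1 : g y = φ y - 2 * S := by simp [hg, hβ, h']
    linarith [hφ2 y]
  have hloc : IsLocalMax g y := by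
    have hDy : D ∈ 𝓝 y := by
      filter_upwards [hin.continuous.continuousAt.eventually (lt_mem_nhds h),
        hin.continuous.continuousAt.eventually (gt_mem_nhds h')] with z h1 h2
      exact ⟨h1.le, h2.le⟩
    exact hy.isLocalMax hDy
  have hle := laplacian_nonpos_of_isLocalMax hgc hloc
  rw [hg, ContDiffAt.laplacian_sub hφc.contDiffAt hβc.contDiffAt, hφ,
    ContDiffAt.laplacian_sub hw.contDiffAt hwσ.contDiffAt, laplacian_comp_isometry hw σ,
    hβ, laplacian_slab_barrier _ _ he] at hle
  have b1 := neg_abs_le (Laplacian.laplacian w y)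
  have b2 := le_abs_self (Laplacian.laplacian w (σ y))
  have b3 := hb y
  have b4 := hb (σ y)
  linarith

/-- The barrier estimate, centred at x with e in the direction of the gradient, bounds a symmetric
difference quotient; letting the step tend to zero gives the derivative along e. -/
theorem norm_gradient_le_of_laplacian_bound_of_bound (hw : ContDiff ℝ 2 w)
    (h0 : Tendsto w (cocompact E3) (𝓝 0)) {N S : ℝ} (hN : 0 < N)
    (hb : ∀ x, |Laplacian.laplacian w x| ≤ N) (hS : ∀ x, |w x| ≤ S) (x : E3) :
    ‖gradient w x‖ ≤ S + N := by
  have hS0 : 0 ≤ S := (abs_nonneg _).trans (hS 0)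
  rcases eq_or_ne (gradient w x) 0 with h | h
  · rw [h, norm_zero]; positivity
  set e : E3 := ‖gradient w x‖⁻¹ • gradient w x with he_def
  have he : ‖e‖ = 1 := by
    rw [he_def, norm_smul, norm_inv, norm_norm, inv_mul_cancel₀ (norm_ne_zero_iff.2 h)]
  have hd : Differentiable ℝ w := hw.differentiable (by norm_num)
  have hge : fderiv ℝ w x e = ‖gradient w x‖ := by
    have h1 : ⟪gradient w x, e⟫ = fderiv ℝ w x e := toDual_symm_apply
    rw [← h1, he_def, real_inner_smul_right, real_inner_self_eq_norm_sq]
    have := norm_ne_zero_iff.2 h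
    field_simp
  have hshift : ContDiff ℝ 2 fun y => w (x + y) := hw.comp (by fun_prop)
  have h0' : Tendsto (fun y => w (x + y)) (cocompact E3) (𝓝 0) :=
    h0.comp (Homeomorph.addLeft x).isClosedEmbedding.tendsto_cocompact
  have hmain : ∀ s : ℝ, 0 ≤ s → s ≤ 1 → w (x + s • e) - w (x + s • (-e)) ≤ (2 * S + 2 * N) * s := by
    intro s hs0 hs1
    have hse : ⟪s • e, e⟫ = s := by
      rw [real_inner_smul_left, real_inner_self_eq_norm_sq, he]; ring
    have h1 := odd_part_le_barrier hshift h0' hN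
      (fun y => by rw [laplacian_comp_add_left hw]; exact hb _) (fun y => hS _) he
      (x := s • e) (by rw [hse]; exact hs0) (by rw [hse]; exact hs1)
    rw [hse, map_smul, Submodule.reflection_orthogonalComplement_singleton_eq_neg] at h1
    have h2 : 0 ≤ N * s ^ 2 := by positivity
    linarith
  have hD : HasDerivAt (fun s : ℝ => (2 * S + 2 * N) * s - (w (x + s • e) - w (x + s • (-e))))
      ((2 * S + 2 * N) - 2 * ‖gradient w x‖) 0 := by
    have a1 := hasDerivAt_line hd x e 0
    have a2 := hasDerivAt_line hd x (-e) 0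
    refine (((hasDerivAt_id' (0 : ℝ)).const_mul (2 * S + 2 * N)).fun_sub (a1.fun_sub a2)).congr_deriv ?_
    rw [zero_smul, zero_smul, add_zero, map_neg, hge]
    ring
  have hge0 : 0 ≤ (2 * S + 2 * N) - 2 * ‖gradient w x‖ := by
    have hlim := hD.tendsto_slope_zero_right
    refine ge_of_tendsto hlim ?_
    have : Ioc (0 : ℝ) 1 ∈ 𝓝[>] (0 : ℝ) := Ioc_mem_nhdsGT one_pos
    filter_upwards [this] with s hs
    have := hmain s hs.1.le hs.2
    simp only [zero_add, smul_eq_mul, mul_zero, zero_smul, sub_self, sub_zero]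
    exact mul_nonneg (inv_nonneg.2 hs.1.le) (by linarith)
  linarith

/-- Gradient bound for solutions of the Poisson equation vanishing at infinity. -/
theorem norm_gradient_le_of_laplacian_bound (hw : ContDiff ℝ 2 w)
    (h0 : Tendsto w (cocompact E3) (𝓝 0)) {N R : ℝ} (hN : 0 ≤ N)
    (hb : ∀ x, |Laplacian.laplacian w x| ≤ N)
    (hz : ∀ x, R < ‖x‖ → Laplacian.laplacian w x = 0) (x : E3) :
    ‖gradient w x‖ ≤ N * ((√(1 + R ^ 2)) ^ 5 + 1) := by
  have hlt : ∀ N' > N, ‖gradient w x‖ ≤ N' * ((√(1 + R ^ 2)) ^ 5 + 1) := by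
    intro N' hN'
    have hpos : 0 < N' := hN.trans_lt hN'
    have hb' : ∀ x, |Laplacian.laplacian w x| ≤ N' := fun x => (hb x).trans hN'.le
    have := norm_gradient_le_of_laplacian_bound_of_bound hw h0 hpos hb'
      (abs_le_of_laplacian_bound hw h0 hpos hb' hz) x
    linarith
  have hc : Tendsto (fun N' : ℝ => N' * ((√(1 + R ^ 2)) ^ 5 + 1)) (𝓝[>] N)
      (𝓝 (N * ((√(1 + R ^ 2)) ^ 5 + 1))) :=
    (Continuous.tendsto (by fun_prop) N).mono_left nhdsWithin_le_nhds
  exact ge_of_tendsto hc (by filter_upwards [self_mem_nhdsWithin] with N' hN' using hlt N' hN')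

end MaximumPrinciple

/-! ### Propagation of supports -/

section SolutionBasics

variable {f : ℝ → Phase → ℝ} {U : ℝ → E3 → ℝ}

theorem nonpos_of_hasDerivAt_of_le_right {φ : ℝ → ℝ} {a δ : ℝ} (hφ : HasDerivAt φ a 0) (hδ : 0 < δ)
    (h : ∀ s, 0 ≤ s → s ≤ δ → φ s ≤ φ 0) : a ≤ 0 := by
  refine le_of_tendsto hφ.tendsto_slope_zero_right ?_
  have : Ioc (0 : ℝ) δ ∈ 𝓝[>] (0 : ℝ) := Ioc_mem_nhdsGT hδ
  filter_upwards [this] with s hs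
  have h1 := h s hs.1.le hs.2
  simp only [zero_add, smul_eq_mul]
  exact mul_nonpos_of_nonneg_of_nonpos (inv_nonneg.2 hs.1.le) (by linarith)

/-- The total derivative of a time-dependent phase space density, one-sided at the initial time. -/
noncomputable def totalDeriv (f : ℝ → Phase → ℝ) (p : ℝ × Phase) : ℝ × Phase →L[ℝ] ℝ :=
  fderivWithin ℝ (fun p : ℝ × Phase => f p.1 p.2) (Ici 0 ×ˢ univ) p

/-- The time derivative of a time-dependent phase space density. -/
noncomputable def timeDeriv (f : ℝ → Phase → ℝ) (t : ℝ) (z : Phase) : ℝ := totalDeriv f (t, z) (1, 0)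

theorem uniqueDiffOn_timePhase : UniqueDiffOn ℝ (Ici (0 : ℝ) ×ˢ (univ : Set Phase)) :=
  (uniqueDiffOn_Ici 0).prod uniqueDiffOn_univ

namespace IsClassicalSolution

theorem continuousOn_totalDeriv (sol : IsClassicalSolution f U) : ContinuousOn (totalDeriv f) (Ici 0 ×ˢ univ) :=
  sol.contDiff_f.continuousOn_fderivWithin uniqueDiffOn_timePhase le_rfl

theorem continuousOn_timeDeriv (sol : IsClassicalSolution f U) :
    ContinuousOn (fun p : ℝ × Phase => timeDeriv f p.1 p.2) (Ici 0 ×ˢ univ) :=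
  sol.continuousOn_totalDeriv.clm_apply continuousOn_const

theorem hasFDerivWithinAt (sol : IsClassicalSolution f U) {t : ℝ} (ht : 0 ≤ t) (z : Phase) :
    HasFDerivWithinAt (fun p : ℝ × Phase => f p.1 p.2) (totalDeriv f (t, z)) (Ici 0 ×ˢ univ) (t, z) :=
  (sol.contDiff_f.differentiableOn (by norm_num) (t, z) ⟨ht, trivial⟩).hasFDerivWithinAt

theorem hasFDerivAt (sol : IsClassicalSolution f U) {t : ℝ} (ht : 0 < t) (z : Phase) :
    HasFDerivAt (fun p : ℝ × Phase => f p.1 p.2) (totalDeriv f (t, z)) (t, z) :=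
  (sol.hasFDerivWithinAt ht.le z).hasFDerivAt (prod_mem_nhds (Ici_mem_nhds ht) univ_mem)

theorem hasFDerivAt_slice (sol : IsClassicalSolution f U) {t : ℝ} (ht : 0 ≤ t) (z : Phase) :
    HasFDerivAt (f t) ((totalDeriv f (t, z)).comp (ContinuousLinearMap.inr ℝ ℝ Phase)) z := by
  have hm : MapsTo (fun z : Phase => (t, z)) univ (Ici 0 ×ˢ univ) := fun y _ => ⟨ht, trivial⟩
  have h := (sol.hasFDerivWithinAt ht z).comp z (hasFDerivAt_prodMk_right t z).hasFDerivWithinAt hm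
  exact hasFDerivWithinAt_univ.1 h

theorem fderiv_slice (sol : IsClassicalSolution f U) {t : ℝ} (ht : 0 ≤ t) (z w : Phase) :
    fderiv ℝ (f t) z w = totalDeriv f (t, z) (0, w) := by
  rw [(sol.hasFDerivAt_slice ht z).fderiv]
  simp

theorem contDiff_slice (sol : IsClassicalSolution f U) {t : ℝ} (ht : 0 ≤ t) : ContDiff ℝ 1 (f t) := by
  have h1 : ContDiffOn ℝ 1 (fun z : Phase => (t, z)) univ := by fun_prop
  have h2 : MapsTo (fun z : Phase => (t, z)) univ (Ici 0 ×ˢ univ) := fun y _ => ⟨ht, trivial⟩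
  have h := sol.contDiff_f.comp h1 h2
  exact contDiffOn_univ.1 h

theorem continuousOn_fderiv_slice (sol : IsClassicalSolution f U) :
    ContinuousOn (fun p : ℝ × Phase => fderiv ℝ (f p.1) p.2) (Ici 0 ×ˢ univ) := by
  have h : ContinuousOn (fun p : ℝ × Phase =>
      (totalDeriv f p).comp (ContinuousLinearMap.inr ℝ ℝ Phase)) (Ici 0 ×ˢ univ) :=
    sol.continuousOn_totalDeriv.clm_comp continuousOn_const
  exact h.congr fun p hp => (sol.hasFDerivAt_slice hp.1 p.2).fderiv

theorem hasDerivWithinAt_time (sol : IsClassicalSolution f U) {t : ℝ} (ht : 0 ≤ t) (z : Phase) :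
    HasDerivWithinAt (fun s => f s z) (timeDeriv f t z) (Ici 0) t := by
  have h1 : HasDerivWithinAt (fun s : ℝ => (s, z)) ((1 : ℝ), (0 : Phase)) (Ici 0) t :=
    ((hasDerivAt_id' t).prodMk (hasDerivAt_const t z)).hasDerivWithinAt
  have hm : MapsTo (fun s : ℝ => (s, z)) (Ici 0) (Ici 0 ×ˢ univ) := fun s hs => ⟨hs, trivial⟩
  exact (sol.hasFDerivWithinAt ht z).comp_hasDerivWithinAt t h1 hm

theorem hasDerivAt_time (sol : IsClassicalSolution f U) {t : ℝ} (ht : 0 < t) (z : Phase) :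
    HasDerivAt (fun s => f s z) (timeDeriv f t z) t :=
  (sol.hasDerivWithinAt_time ht.le z).hasDerivAt (Ici_mem_nhds ht)

theorem timeDeriv_eq (sol : IsClassicalSolution f U) {t : ℝ} (ht : 0 ≤ t) (z : Phase) :
    timeDeriv f t z = -fderiv ℝ (f t) z (z.2, -gradient (U t) z.1) := by
  obtain ⟨x, v⟩ := z
  have h := sol.vlasov t ht x v
  have hd : HasFDerivAt (f t) (fderiv ℝ (f t) (x, v)) (x, v) :=
    ((sol.contDiff_slice ht).differentiable (by norm_num) _).hasFDerivAt
  have hx : HasFDerivAt (fun y => f t (y, v)) _ x := hd.comp x (hasFDerivAt_prodMk_left x v)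
  have hv : HasFDerivAt (fun w => f t (x, w)) _ v := hd.comp v (hasFDerivAt_prodMk_right x v)
  rw [(sol.hasDerivWithinAt_time ht (x, v)).derivWithin (uniqueDiffOn_Ici 0 t ht),
    hx.fderiv, hv.fderiv] at h
  have e : ((v, -gradient (U t) x) : Phase) = (v, 0) - (0, gradient (U t) x) := by simp
  simp only [ContinuousLinearMap.comp_apply, ContinuousLinearMap.inl_apply,
    ContinuousLinearMap.inr_apply] at h
  simp only [e, map_sub]
  linarith

theorem continuousOn_uncurry (sol : IsClassicalSolution f U) :
    ContinuousOn (fun p : ℝ × Phase => f p.1 p.2) (Ici 0 ×ˢ univ) := sol.contDiff_f.continuousOn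

/-- Along the backward characteristic direction a solution does not change to first order. -/
theorem hasDerivAt_backward (sol : IsClassicalSolution f U) {t : ℝ} (ht : 0 < t) (z : Phase) :
    HasDerivAt (fun s : ℝ => f (t - s) (z - s • ((z.2, -gradient (U t) z.1) : Phase))) 0 0 := by
  set w : Phase := (z.2, -gradient (U t) z.1)
  have h1 : HasDerivAt (fun s : ℝ => (t - s, z - s • w)) ((-1 : ℝ), -w) 0 := by
    have a1 := (hasDerivAt_id' (0 : ℝ)).const_sub t
    have a2 := ((hasDerivAt_id' (0 : ℝ)).smul_const w).const_sub z
    rw [one_smul] at a2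
    exact a1.prodMk a2
  have h2 : HasFDerivAt (fun p : ℝ × Phase => f p.1 p.2) (totalDeriv f (t, z))
      ((fun s : ℝ => (t - s, z - s • w)) 0) := by simpa using sol.hasFDerivAt ht z
  refine (h2.comp_hasDerivAt 0 h1).congr_deriv ?_
  have e : ((-1 : ℝ), -w) = -(((1 : ℝ), (0 : Phase)) + (0, w)) := by simp
  have h3 := sol.timeDeriv_eq ht.le z
  rw [e, map_neg, map_add, ← sol.fderiv_slice ht.le]
  unfold timeDeriv at h3
  rw [h3]
  simp [w]

/-- Bound of a solution by its initial values on the base of the backward cone. -/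
theorem le_of_backward_cone (sol : IsClassicalSolution f U) {T K : ℝ} (hK0 : 0 ≤ K)
    (hK : ∀ t, 0 ≤ t → t ≤ T → ∀ x, ‖gradient (U t) x‖ ≤ K) {t₁ : ℝ} (ht0 : 0 ≤ t₁) (htT : t₁ ≤ T)
    (x₁ v₁ : E3) {c : ℝ} (hc : ∀ x v, ‖v - v₁‖ ≤ K * t₁ → ‖x - (x₁ - t₁ • v₁)‖ ≤ K * T * t₁ →
      f 0 (x, v) ≤ c) : f t₁ (x₁, v₁) ≤ c := by
  -- The set opens backward fast enough that, for fields bounded by K, the backward characteristic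
  -- direction at each of its points stays inside. No flow is needed.
  set C : Set (ℝ × Phase) := {p | 0 ≤ p.1 ∧ p.1 ≤ t₁ ∧ ‖p.2.2 - v₁‖ ≤ K * (t₁ - p.1) ∧
    ‖p.2.1 - (x₁ - (t₁ - p.1) • v₁)‖ ≤ K * T * (t₁ - p.1)} with hC
  have hT : 0 ≤ T := ht0.trans htT
  have hCc : IsClosed C := by
    refine IsClosed.and ?_ (IsClosed.and ?_ (IsClosed.and ?_ ?_)) <;>
    exact isClosed_le (by fun_prop) (by fun_prop)
  have hCb : C ⊆ Icc 0 T ×ˢ (Metric.closedBall x₁ (K * T * T + T * ‖v₁‖) ×ˢ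
      Metric.closedBall v₁ (K * T)) := by
    rintro ⟨t, x, v⟩ ⟨h1, h2, h3, h4⟩
    simp only at h1 h2 h3 h4
    have h5 : t₁ - t ≤ T := by linarith
    have h6 : 0 ≤ t₁ - t := by linarith
    refine ⟨⟨h1, h2.trans htT⟩, ?_, ?_⟩
    · rw [Metric.mem_closedBall, dist_eq_norm]
      have e : x - x₁ = (x - (x₁ - (t₁ - t) • v₁)) - (t₁ - t) • v₁ := by abel
      calc ‖x - x₁‖ ≤ ‖x - (x₁ - (t₁ - t) • v₁)‖ + ‖(t₁ - t) • v₁‖ := by rw [e]; exact norm_sub_le _ _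
        _ ≤ K * T * T + T * ‖v₁‖ := by
          rw [norm_smul, Real.norm_of_nonneg h6]
          gcongr
          exact h4.trans (by gcongr)
    · rw [Metric.mem_closedBall, dist_eq_norm]
      exact h3.trans (by gcongr)
  have hCk : IsCompact C := ((isCompact_Icc.prod ((isCompact_closedBall _ _).prod
    (isCompact_closedBall _ _)))).of_isClosed_subset hCc hCb
  have hp₁ : (t₁, (x₁, v₁)) ∈ C := ⟨ht0, le_rfl, by simp, by simp⟩
  -- The penalty η t makes the function increase strictly in the backward direction, since f is
  -- constant there to first order. Its maximum over C must therefore lie at time zero.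
  have hmain : ∀ η : ℝ, 0 < η → f t₁ (x₁, v₁) - η * t₁ ≤ c := by
    intro η hη
    have hcont : ContinuousOn (fun p : ℝ × Phase => f p.1 p.2 - η * p.1) C :=
      (sol.continuousOn_uncurry.mono fun p hp => ⟨hp.1, trivial⟩).sub (by fun_prop)
    obtain ⟨⟨t, x, v⟩, hp, hmax⟩ := hCk.exists_isMaxOn ⟨_, hp₁⟩ hcont
    have hle := hmax hp₁
    simp only [mem_ofPred_eq] at hle
    refine hle.trans ?_
    rcases hp.1.eq_or_lt with h | h
    · simp only at h
      subst h
      have := hc x v (by simpa using hp.2.2.1) (by simpa using hp.2.2.2)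
      simpa using this
    · exfalso
      simp only at h
      obtain ⟨-, g2, g3, g4⟩ := hp
      simp only at g2 g3 g4
      have hgr := hK t h.le (g2.trans htT) x
      have hder : HasDerivAt (fun s : ℝ => f (t - s) ((x, v) - s • ((v, -gradient (U t) x) : Phase))
          - η * (t - s)) (0 - η * (-1)) 0 :=
        (sol.hasDerivAt_backward h (x, v)).fun_sub (((hasDerivAt_id' (0 : ℝ)).const_sub t).const_mul η)
      have := nonpos_of_hasDerivAt_of_le_right hder h fun s hs0 hs1 => by
        have hmem : (t - s, (x, v) - s • ((v, -gradient (U t) x) : Phase)) ∈ C := by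
          refine ⟨by simpa using hs1, by simp only; linarith, ?_, ?_⟩
          · simp only [Prod.snd_sub, Prod.smul_snd, smul_neg, sub_neg_eq_add]
            calc ‖v + s • gradient (U t) x - v₁‖ = ‖(v - v₁) + s • gradient (U t) x‖ := by congr 1; abel
              _ ≤ ‖v - v₁‖ + ‖s • gradient (U t) x‖ := norm_add_le _ _
              _ ≤ K * (t₁ - t) + s * K := by
                rw [norm_smul, Real.norm_of_nonneg hs0]; gcongr
              _ = K * (t₁ - (t - s)) := by ring
          · simp only [Prod.fst_sub, Prod.smul_fst]
            have e : x - s • v - (x₁ - (t₁ - (t - s)) • v₁)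
                = (x - (x₁ - (t₁ - t) • v₁)) - s • (v - v₁) := by module
            calc ‖x - s • v - (x₁ - (t₁ - (t - s)) • v₁)‖
                ≤ ‖x - (x₁ - (t₁ - t) • v₁)‖ + ‖s • (v - v₁)‖ := by rw [e]; exact norm_sub_le _ _
              _ ≤ K * T * (t₁ - t) + s * (K * T) := by
                rw [norm_smul, Real.norm_of_nonneg hs0]
                gcongr
                exact g3.trans (by gcongr; linarith)
              _ = K * T * (t₁ - (t - s)) := by ring
        have := hmax hmem
        simpa using this
      linarith
  have hlim : Tendsto (fun η : ℝ => f t₁ (x₁, v₁) - η * t₁) (𝓝[>] 0) (𝓝 (f t₁ (x₁, v₁))) := by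
    have : Tendsto (fun η : ℝ => f t₁ (x₁, v₁) - η * t₁) (𝓝 0) (𝓝 (f t₁ (x₁, v₁) - 0 * t₁)) :=
      Continuous.tendsto (by fun_prop) 0
    rw [zero_mul, sub_zero] at this
    exact this.mono_left nhdsWithin_le_nhds
  exact le_of_tendsto hlim (by filter_upwards [self_mem_nhdsWithin] with η hη using hmain η hη)

/-- On compact time intervals the supports stay in a fixed ball. -/
theorem exists_support_bound (sol : IsClassicalSolution f U) (h0 : HasCompactSupport (f 0)) (T : ℝ) :
    ∃ R : ℝ, 0 ≤ R ∧ ∀ t, 0 ≤ t → t ≤ T → ∀ z, R < ‖z‖ → f t z = 0 := by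
  obtain ⟨R₀, hR₀⟩ := h0.isCompact.isBounded.exists_norm_le
  have hout : ∀ z, R₀ < ‖z‖ → f 0 z = 0 := fun z hz => by
    by_contra hne
    exact absurd (hR₀ z (subset_tsupport _ hne)) (not_le.2 hz)
  obtain ⟨K', hK'⟩ := sol.bounded_field T
  set K := max K' 0
  have hK : ∀ t, 0 ≤ t → t ≤ T → ∀ x, ‖gradient (U t) x‖ ≤ K := fun t h1 h2 x =>
    (hK' t h1 h2 x).trans (le_max_left _ _)
  have hK0 : 0 ≤ K := le_max_right _ _
  -- Beyond speed V the backward set meets only velocities larger than R₀ at time zero; below it,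
  -- only positions far out have to be excluded.
  set V := |R₀| + K * |T| with hV
  have hV0 : 0 ≤ V := by positivity
  refine ⟨V + (|R₀| + |T| * V + K * |T| * |T|), by positivity, fun t ht htT z hz => ?_⟩
  have hT : 0 ≤ T := ht.trans htT
  rw [abs_of_nonneg hT] at hz
  refine le_antisymm ?_ (sol.nonneg t ht z)
  obtain ⟨x₁, v₁⟩ := z
  refine sol.le_of_backward_cone hK0 hK ht htT x₁ v₁ fun x v hv hx => (hout _ ?_).le
  have hKt : K * t ≤ K * T := by gcongr
  have hVT : V = |R₀| + K * T := by rw [hV, abs_of_nonneg hT]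
  have hR := le_abs_self R₀
  rw [Prod.norm_mk, lt_max_iff] at hz ⊢
  have e1 : ‖v₁‖ ≤ ‖v‖ + K * T := by
    have := norm_sub_norm_le v₁ v
    rw [norm_sub_rev] at this
    linarith
  rcases lt_or_ge V ‖v₁‖ with hvl | hvl
  · right; linarith
  · left
    rcases hz with hz | hz
    · have e2 : ‖x₁‖ ≤ ‖x‖ + K * T * T + T * V := by
        have a1 : ‖x₁‖ ≤ ‖x‖ + ‖x - (x₁ - t • v₁)‖ + ‖t • v₁‖ := by
          have e : x₁ = x - (x - (x₁ - t • v₁)) + t • v₁ := by abel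
          calc ‖x₁‖ = ‖x - (x - (x₁ - t • v₁)) + t • v₁‖ := congrArg _ e
            _ ≤ ‖x - (x - (x₁ - t • v₁))‖ + ‖t • v₁‖ := norm_add_le _ _
            _ ≤ _ := by gcongr; exact norm_sub_le _ _
        have a2 : ‖t • v₁‖ ≤ T * V := by
          rw [norm_smul, Real.norm_of_nonneg ht]; gcongr
        have a3 : K * T * t ≤ K * T * T := by gcongr
        linarith
      linarith
    · have : 0 ≤ |R₀| + T * V + K * T * T := by positivity
      linarith

end IsClassicalSolution

end SolutionBasics

/-! ### Preservation of spherical symmetry -/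

section Symmetry

variable {f : ℝ → Phase → ℝ} {U : ℝ → E3 → ℝ}

open InnerProductSpace

theorem inner_gradient (w : E3 → ℝ) (x y : E3) : ⟪gradient w x, y⟫ = fderiv ℝ w x y :=
  toDual_symm_apply

theorem gradient_comp_isometry_sub {w : E3 → ℝ} (hw : Differentiable ℝ w) (A : E3 ≃ₗᵢ[ℝ] E3) (x : E3) :
    gradient ((fun x => w (A x)) - w) x = A.symm (gradient w (A x)) - gradient w x := by
  refine ext_inner_right ℝ fun y => ?_
  have h1 : HasFDerivAt (fun x => w (A x)) _ x :=
    (hw (A x)).hasFDerivAt.comp x A.toContinuousLinearEquiv.hasFDerivAt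
  have h2 := h1.sub (hw x).hasFDerivAt
  rw [inner_gradient, h2.fderiv, inner_sub_left, inner_gradient, ← A.inner_map_map (A.symm _),
    A.apply_symm_apply, inner_gradient]
  rfl

theorem norm_map_pair (A : E3 ≃ₗᵢ[ℝ] E3) (z : Phase) : ‖((A z.1, A z.2) : Phase)‖ = ‖z‖ := by
  simp [Prod.norm_def]

theorem rho_map (g : Phase → ℝ) (A : E3 ≃ₗᵢ[ℝ] E3) (x : E3) :
    rho g (A x) = ∫ v, g (A x, A v) :=
  (A.measurePreserving.integral_comp A.toHomeomorph.measurableEmbedding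
    (fun v => g (A x, v))).symm

theorem rho_eq_zero {g : Phase → ℝ} {R : ℝ} (hR : ∀ z, R < ‖z‖ → g z = 0) {x : E3} (hx : R < ‖x‖) :
    rho g x = 0 := by
  unfold rho
  rw [← integral_zero E3 ℝ (μ := volume)]
  congr 1
  ext v
  exact hR _ (hx.trans_le (le_max_left _ _))

theorem abs_rho_map_sub_le {g : Phase → ℝ} (hg : Continuous g) {R : ℝ}
    (hR : ∀ z, R < ‖z‖ → g z = 0) (A : E3 ≃ₗᵢ[ℝ] E3) {m : ℝ}
    (hm : ∀ z : Phase, |g (A z.1, A z.2) - g z| ≤ m) (x : E3) :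
    |rho g (A x) - rho g x| ≤ m * volume.real (Metric.closedBall (0 : E3) R) := by
  have hcs : ∀ φ : E3 → ℝ, Continuous φ → (∀ v, R < ‖v‖ → φ v = 0) → Integrable φ := by
    intro φ hφ h0
    refine hφ.integrable_of_hasCompactSupport ?_
    refine HasCompactSupport.of_support_subset_isCompact (isCompact_closedBall (0 : E3) R) fun v hv => ?_
    rw [mem_closedBall_zero_iff]
    by_contra hc
    exact hv (h0 v (not_le.1 hc))
  have h1 : Integrable fun v => g (A x, A v) := hcs _ (by fun_prop) fun v hv =>
    hR _ (by rw [← A.norm_map v] at hv; exact hv.trans_le (le_max_right _ _))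
  have h2 : Integrable fun v => g (x, v) := hcs _ (by fun_prop) fun v hv =>
    hR _ (hv.trans_le (le_max_right _ _))
  have h3 : rho g (A x) - rho g x = ∫ v in Metric.closedBall (0 : E3) R, (g (A x, A v) - g (x, v)) := by
    rw [rho_map, rho, ← integral_sub h1 h2]
    refine (setIntegral_eq_integral_of_forall_compl_eq_zero fun v hv => ?_).symm
    have hv' : R < ‖v‖ := by simpa using hv
    rw [hR (x, v) (hv'.trans_le (le_max_right _ _)), hR (A x, A v), sub_zero]
    rw [← A.norm_map v] at hv'
    exact hv'.trans_le (le_max_right _ _)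
  rw [h3, ← Real.norm_eq_abs]
  exact norm_setIntegral_le_of_norm_le_const measure_closedBall_lt_top fun v _ => hm (x, v)

namespace IsClassicalSolution

/-- The difference of the rotated and the original potential solves a Poisson equation whose source
is bounded by m and supported in the ball of radius R, so the elliptic gradient bound makes the
asymmetry of the field linear in that of f. -/
theorem norm_gradient_map_sub_le (sol : IsClassicalSolution f U) {t : ℝ} (ht : 0 ≤ t) {R : ℝ}
    (hR : ∀ z, R < ‖z‖ → f t z = 0) (A : E3 ≃ₗᵢ[ℝ] E3) {m : ℝ}
    (hm : ∀ z : Phase, |f t (A z.1, A z.2) - f t z| ≤ m) (x : E3) :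
    ‖A.symm (gradient (U t) (A x)) - gradient (U t) x‖
      ≤ 4 * Real.pi * (m * volume.real (Metric.closedBall (0 : E3) R))
        * ((√(1 + R ^ 2)) ^ 5 + 1) := by
  have hU := sol.contDiff_U t ht
  have hUA : ContDiff ℝ 2 fun x => U t (A x) := hU.comp A.contDiff
  have hm0 : 0 ≤ m := (abs_nonneg _).trans (hm 0)
  rw [← gradient_comp_isometry_sub (hU.differentiable (by norm_num))]
  have hlap : ∀ y, Laplacian.laplacian ((fun x => U t (A x)) - U t) y
      = 4 * Real.pi * (rho (f t) (A y) - rho (f t) y) := fun y => by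
    rw [ContDiffAt.laplacian_sub hUA.contDiffAt hU.contDiffAt, laplacian_comp_isometry hU,
      sol.poisson t ht, sol.poisson t ht]
    ring
  refine norm_gradient_le_of_laplacian_bound (w := (fun x => U t (A x)) - U t) (hUA.sub hU) ?_ (by positivity) (fun y => ?_)
    (fun y hy => ?_) x
  · have := ((sol.vanishing t ht).comp A.toHomeomorph.isClosedEmbedding.tendsto_cocompact).sub
      (sol.vanishing t ht)
    rw [sub_zero] at this
    exact this
  · rw [hlap, abs_mul, abs_of_pos (by positivity)]
    gcongr
    exact abs_rho_map_sub_le (sol.contDiff_slice ht).continuous hR A hm y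
  · rw [hlap, rho_eq_zero hR hy, rho_eq_zero hR (x := A y) (by rwa [A.norm_map]), sub_zero, mul_zero]

/-- Spherical symmetry of the initial data is preserved. -/
theorem map_eq (sol : IsClassicalSolution f U) (h0 : HasCompactSupport (f 0))
    {A : E3 ≃ₗᵢ[ℝ] E3} (hA : ∀ z : Phase, f 0 (A z.1, A z.2) = f 0 z) {t : ℝ} (ht : 0 ≤ t) (z : Phase) :
    f t (A z.1, A z.2) = f t z := by
  by_contra hne
  obtain ⟨R, hR0, hR⟩ := sol.exists_support_bound h0 t
  set g : ℝ → Phase → ℝ := fun s z => f s (A z.1, A z.2) - f s z with hg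
  have hgR : ∀ s, 0 ≤ s → s ≤ t → ∀ z, R < ‖z‖ → g s z = 0 := fun s h1 h2 z hz => by
    simp only [hg]
    rw [hR s h1 h2 z hz, hR s h1 h2 _ (by rwa [norm_map_pair]), sub_zero]
  set Kc : Set (ℝ × Phase) := Icc 0 t ×ˢ Metric.closedBall 0 R with hKc
  have hKk : IsCompact Kc := isCompact_Icc.prod (isCompact_closedBall _ _)
  have hKs : Kc ⊆ Ici 0 ×ˢ univ := fun p hp => ⟨hp.1.1, trivial⟩
  obtain ⟨C', hC'⟩ := hKk.exists_bound_of_continuousOn (sol.continuousOn_fderiv_slice.mono hKs)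
  set C := max C' 0
  have hC0 : 0 ≤ C := le_max_right _ _
  set B : ℝ := 4 * Real.pi * volume.real (Metric.closedBall (0 : E3) R) * ((√(1 + R ^ 2)) ^ 5 + 1) with hB
  -- The weight e^{-ks} is tuned to a Gronwall contradiction. At a positive maximum of e^{-ks}|g|
  -- the phase space gradient of g vanishes, so g changes in time only through the asymmetry of the
  -- field, at a rate of at most C B m < k m.
  set k : ℝ := C * B + 1
  have hgc : ContinuousOn (fun p : ℝ × Phase => g p.1 p.2) (Ici 0 ×ˢ univ) := by
    refine ContinuousOn.sub ?_ sol.continuousOn_uncurry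
    exact sol.continuousOn_uncurry.comp (f := fun p : ℝ × Phase => (p.1, (A p.2.1, A p.2.2)))
      (by fun_prop) (fun p hp => ⟨hp.1, trivial⟩)
  have hcont : ContinuousOn (fun p : ℝ × Phase => Real.exp (-k * p.1) * |g p.1 p.2|) Kc :=
    ContinuousOn.mul (by fun_prop) (hgc.mono hKs).abs
  have hzR : ‖z‖ ≤ R := by
    by_contra hc
    exact hne (sub_eq_zero.1 (hgR t ht le_rfl z (not_le.1 hc)))
  have hp₁ : (t, z) ∈ Kc := ⟨⟨ht, le_rfl⟩, mem_closedBall_zero_iff.2 hzR⟩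
  obtain ⟨⟨s, y⟩, hp, hmax⟩ := hKk.exists_isMaxOn ⟨_, hp₁⟩ hcont
  have hs0 : 0 ≤ s := hp.1.1
  have hst : s ≤ t := hp.1.2
  set m : ℝ := |g s y| with hm
  have hmpos : 0 < m := by
    have h1 := hmax hp₁
    simp only [mem_ofPred_eq] at h1
    have h2 : 0 < |g t z| := abs_pos.2 (sub_ne_zero.2 hne)
    have h3 : 0 < Real.exp (-k * s) * m := lt_of_lt_of_le (by positivity) h1
    exact pos_of_mul_pos_right h3 (Real.exp_pos _).le
  have hspos : 0 < s := by
    refine hs0.lt_of_ne fun h => hmpos.ne' ?_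
    rw [hm, abs_eq_zero, ← h]
    exact sub_eq_zero.2 (hA y)
  have hgm : ∀ z', |g s z'| ≤ m := by
    intro z'
    rcases le_or_gt ‖z'‖ R with h | h
    · have h1 := hmax (show (s, z') ∈ Kc from ⟨hp.1, mem_closedBall_zero_iff.2 h⟩)
      exact le_of_mul_le_mul_left h1 (Real.exp_pos _)
    · rw [hgR s hs0 hst z' h, abs_zero]; exact hmpos.le
  obtain ⟨ς, hς, hςg⟩ : ∃ ς : ℝ, |ς| = 1 ∧ ς * g s y = m := by
    rcases le_total 0 (g s y) with h | h
    · exact ⟨1, by simp, by rw [hm, abs_of_nonneg h, one_mul]⟩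
    · exact ⟨-1, by simp, by rw [hm, abs_of_nonpos h]; ring⟩
  have hςle : ∀ a : ℝ, ς * a ≤ |a| := fun a => by
    calc ς * a ≤ |ς * a| := le_abs_self _
      _ = |a| := by rw [abs_mul, hς, one_mul]
  have hς0 : ς ≠ 0 := by rintro rfl; simp at hς
  -- the derivative with respect to `z` vanishes at the maximum
  have hDeq : ∀ w : Phase, fderiv ℝ (f s) (A y.1, A y.2) (A w.1, A w.2) = fderiv ℝ (f s) y w := by
    have hdf : Differentiable ℝ (f s) := (sol.contDiff_slice hs0).differentiable (by norm_num)
    let L : Phase →L[ℝ] Phase := (A : E3 →L[ℝ] E3).prodMap (A : E3 →L[ℝ] E3)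
    have hd1 : HasFDerivAt (fun z' : Phase => f s (A z'.1, A z'.2))
        ((fderiv ℝ (f s) (A y.1, A y.2)).comp L) y :=
      (hdf (A y.1, A y.2)).hasFDerivAt.comp y L.hasFDerivAt
    have hd2 : HasFDerivAt (fun z' => ς * g s z') _ y := (hd1.fun_sub (hdf y).hasFDerivAt).const_mul ς
    have hloc : IsLocalMax (fun z' => ς * g s z') y :=
      Eventually.of_forall fun z' => ((hςle _).trans (hgm z')).trans hςg.ge
    have hz := hloc.hasFDerivAt_eq_zero hd2
    intro w
    have hw := congrArg (fun ℓ : Phase →L[ℝ] ℝ => ℓ w) hz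
    simp only [smul_apply, sub_apply, smul_eq_mul, zero_apply, mul_eq_zero, hς0, false_or] at hw
    exact sub_eq_zero.1 hw
  -- Transport terms cancel because the gradients at y and at its image correspond under A; only the
  -- difference of the two fields is left.
  have hgt : timeDeriv f s (A y.1, A y.2) - timeDeriv f s y
      = fderiv ℝ (f s) y (0, A.symm (gradient (U s) (A y.1)) - gradient (U s) y.1) := by
    rw [sol.timeDeriv_eq hs0, sol.timeDeriv_eq hs0]
    have e1 : fderiv ℝ (f s) (A y.1, A y.2) (A y.2, -gradient (U s) (A y.1))
        = fderiv ℝ (f s) y (y.2, -A.symm (gradient (U s) (A y.1))) := by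
      rw [← hDeq]; simp
    have e2 : ((0, A.symm (gradient (U s) (A y.1)) - gradient (U s) y.1) : Phase)
        = (y.2, -gradient (U s) y.1) - (y.2, -A.symm (gradient (U s) (A y.1))) := by
      ext1 <;> simp [add_comm, sub_eq_add_neg]
    rw [e1, e2, map_sub]
    ring
  have hbound : |timeDeriv f s (A y.1, A y.2) - timeDeriv f s y| ≤ C * (B * m) := by
    rw [hgt, ← Real.norm_eq_abs]
    refine (ContinuousLinearMap.le_opNorm _ _).trans ?_
    have h1 := hC' (s, y) hp
    have h2 := sol.norm_gradient_map_sub_le hs0 (hR s hs0 hst) A hgm y.1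
    have h3 : ‖((0, A.symm (gradient (U s) (A y.1)) - gradient (U s) y.1) : Phase)‖ ≤ B * m := by
      rw [Prod.norm_mk, norm_zero, max_eq_right (norm_nonneg _)]
      refine h2.trans (le_of_eq ?_)
      rw [hB]; ring
    exact mul_le_mul (h1.trans (le_max_left _ _)) h3 (norm_nonneg _) hC0
  have hder : HasDerivAt (fun r : ℝ => Real.exp (-k * (s - r)) * (ς * g (s - r) y))
      (Real.exp (-k * s) * (k * m - ς * (timeDeriv f s (A y.1, A y.2) - timeDeriv f s y))) 0 := by
    have a0 : HasDerivAt (fun r : ℝ => s - r) (-1) 0 := (hasDerivAt_id' (0 : ℝ)).const_sub s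
    have a1 : HasDerivAt (fun s => g s y) (timeDeriv f s (A y.1, A y.2) - timeDeriv f s y) (s - 0) := by
      rw [sub_zero]
      exact (sol.hasDerivAt_time hspos _).fun_sub (sol.hasDerivAt_time hspos _)
    have a2 := (a1.scomp (0 : ℝ) a0).const_mul ς
    have a3 := (a0.const_mul (-k)).exp
    refine (a3.fun_mul a2).congr_deriv ?_
    simp only [Function.comp, sub_zero, smul_eq_mul, hςg]
    ring
  have hfin := nonpos_of_hasDerivAt_of_le_right hder hspos fun r hr0 hr1 => by
    have h1 := hmax (show (s - r, y) ∈ Kc from ⟨⟨by linarith, by linarith⟩, hp.2⟩)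
    simp only [mem_ofPred_eq] at h1
    rw [sub_zero, hςg]
    exact (mul_le_mul_of_nonneg_left (hςle _) (Real.exp_pos _).le).trans h1
  have h5 := nonpos_of_mul_nonpos_right hfin (Real.exp_pos _)
  have h6 := (hςle _).trans hbound
  have h7 : k * m = C * (B * m) + m := by simp only [k]; ring
  linarith

end IsClassicalSolution

theorem SphericallySymmetric.map_eq {g : Phase → ℝ} (hs : SphericallySymmetric g) (hg : Continuous g)
    {A : E3 ≃ₗᵢ[ℝ] E3} (hA : LinearMap.det (A.toLinearEquiv : E3 →ₗ[ℝ] E3) = 1) (z : Phase) :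
    g (A z.1, A z.2) = g z := by
  have hc : Continuous fun z : Phase => g (A z.1, A z.2) := by fun_prop
  exact congrFun ((hc.ae_eq_iff_eq (μ := volume) hg).1 (hs A hA)) z

end Symmetry

/-! ### Radial solutions of the Poisson equation -/

section RadialPotential

open InnerProductSpace

/-- The half-turn about the axis x + y exchanges x and y, and half-turns have determinant (−1)² = 1.
For y = −x ≠ 0 the axis is taken orthogonal to x. -/
theorem exists_rotation_map_eq {x y : E3} (h : ‖x‖ = ‖y‖) : ∃ A : E3 ≃ₗᵢ[ℝ] E3,
    LinearMap.det (A.toLinearEquiv : E3 →ₗ[ℝ] E3) = 1 ∧ A x = y := by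
  have hdet : ∀ n : E3, n ≠ 0 →
      LinearMap.det ((ℝ ∙ n).reflection.toLinearEquiv : E3 →ₗ[ℝ] E3) = 1 := by
    intro n hn
    have : Fact (Module.finrank ℝ E3 = 2 + 1) := ⟨by simp⟩
    have h1 := (ℝ ∙ n).det_reflection
    rw [Submodule.finrank_orthogonal_span_singleton (n := 2) hn] at h1
    refine Eq.trans ?_ (h1.trans (by norm_num))
    rfl
  rcases eq_or_ne (x + y) 0 with h0 | h0
  · have hy : y = -x := (neg_eq_of_add_eq_zero_right h0).symm
    rcases eq_or_ne x 0 with hx | hx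
    · exact ⟨LinearIsometryEquiv.refl ℝ E3, LinearMap.det_id, by simp [hy, hx]⟩
    · have : Fact (Module.finrank ℝ E3 = 2 + 1) := ⟨by simp⟩
      have h2 : (ℝ ∙ x)ᗮ ≠ ⊥ := by
        intro hb
        have := Submodule.finrank_orthogonal_span_singleton (𝕜 := ℝ) (n := 2) hx
        rw [hb, finrank_bot] at this
        norm_num at this
      obtain ⟨n, hn, hn0⟩ := Submodule.exists_mem_ne_zero_of_ne_bot h2
      refine ⟨(ℝ ∙ n).reflection, hdet n hn0, ?_⟩
      rw [hy]
      refine Submodule.reflection_mem_subspace_orthogonalComplement_eq_neg ?_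
      rw [Submodule.mem_orthogonal_singleton_iff_inner_left] at hn ⊢
      rwa [real_inner_comm]
  · refine ⟨(ℝ ∙ (x + y)).reflection, hdet _ h0, ?_⟩
    rw [Submodule.reflection_singleton_apply]
    have h1 : ⟪x + y, x⟫ / ‖x + y‖ ^ 2 = 1 / 2 := by
      have h2 : ‖x + y‖ ^ 2 ≠ 0 := pow_ne_zero 2 (norm_ne_zero_iff.2 h0)
      rw [div_eq_div_iff h2 two_ne_zero, norm_add_sq_real, inner_add_left, real_inner_self_eq_norm_sq,
        ← h, real_inner_comm x y]
      ring
    simp only [RCLike.ofReal_real_eq_id, id_eq]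
    rw [h1]
    module

variable {w : E3 → ℝ}

/-- For y orthogonal to x the points x ± s y have equal norm, so the derivative in the direction y
is its own negative. -/
theorem inner_gradient_eq_zero_of_radial (hw : Differentiable ℝ w)
    (hrad : ∀ x y, ‖x‖ = ‖y‖ → w x = w y) {x y : E3} (hxy : ⟪x, y⟫ = 0) : ⟪gradient w x, y⟫ = 0 := by
  have h1 := hasDerivAt_line hw x y 0
  have h2 := hasDerivAt_line hw x (-y) 0
  have h3 : (fun s : ℝ => w (x + s • -y)) = fun s : ℝ => w (x + s • y) := by
    ext s
    refine hrad _ _ ?_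
    rw [← sq_eq_sq₀ (norm_nonneg _) (norm_nonneg _), norm_add_sq_real, norm_add_sq_real]
    simp [real_inner_smul_right, hxy]
  rw [h3] at h2
  have h4 := h1.unique h2
  rw [inner_gradient]
  simp only [zero_smul, add_zero, map_neg] at h4
  linarith

theorem contDiff_profile (hw : ContDiff ℝ 2 w) : ContDiff ℝ 2 fun s : ℝ => w (s • unitVec) :=
  hw.comp (by fun_prop)

/-- The Laplacian of a radial function in terms of its profile. -/
theorem laplacian_of_radial (hw : ContDiff ℝ 2 w) (hrad : ∀ x y, ‖x‖ = ‖y‖ → w x = w y) {s : ℝ}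
    (hs : 0 < s) :
    Laplacian.laplacian w (s • unitVec) = deriv (deriv fun s : ℝ => w (s • unitVec)) s
      + 2 / s * deriv (fun s : ℝ => w (s • unitVec)) s := by
  set u : ℝ → ℝ := fun s => w (s • unitVec) with hu
  have huc : ContDiff ℝ 2 u := contDiff_profile hw
  have hud : Differentiable ℝ u := huc.differentiable (by norm_num)
  have hud2 : Differentiable ℝ (deriv u) :=
    ((contDiff_succ_iff_deriv (n := 1)).1 (by rw [one_add_one_eq_two]; exact huc)).2.2.differentiable (by norm_num)
  -- In each of the two transversal directions the radius is √(s² + h²), which contributes u'(s)/s.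
  have key : ∀ i : Fin 3, i ≠ 0 → deriv (deriv fun h : ℝ =>
      w (s • unitVec + h • (EuclideanSpace.basisFun (Fin 3) ℝ) i)) 0 = 1 / s * deriv u s := by
    intro i hi
    have hq : ∀ h : ℝ, 0 < s ^ 2 + h ^ 2 := fun h => by positivity
    have e1 : ∀ h : ℝ, w (s • unitVec + h • (EuclideanSpace.basisFun (Fin 3) ℝ) i)
        = u (√(s ^ 2 + h ^ 2)) := by
      intro h
      refine hrad _ _ ?_
      rw [← sq_eq_sq₀ (norm_nonneg _) (norm_nonneg _), norm_add_sq_real, norm_smul, norm_smul, norm_smul,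
        norm_unitVec, real_inner_smul_left, real_inner_smul_right]
      have : ⟪unitVec, (EuclideanSpace.basisFun (Fin 3) ℝ) i⟫ = 0 := by
        simp [unitVec, EuclideanSpace.inner_single_left, hi.symm]
      rw [this]
      simp only [OrthonormalBasis.norm_eq_one, mul_one, Real.norm_eq_abs, sq_abs, mul_zero, add_zero]
      rw [Real.sq_sqrt (hq h).le]
    simp only [e1]
    have d0 : ∀ h : ℝ, HasDerivAt (fun h : ℝ => √(s ^ 2 + h ^ 2)) (h / √(s ^ 2 + h ^ 2)) h := by
      intro h
      have a1 := ((hasDerivAt_pow 2 h).const_add (s ^ 2)).sqrt (hq h).ne'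
      refine a1.congr_deriv ?_
      have := Real.sqrt_pos.2 (hq h)
      field_simp
      simp
    have e2 : (deriv fun h : ℝ => u (√(s ^ 2 + h ^ 2)))
        = fun h => deriv u (√(s ^ 2 + h ^ 2)) * (h / √(s ^ 2 + h ^ 2)) := by
      ext h
      exact ((hud _).hasDerivAt.comp h (d0 h)).deriv
    rw [e2]
    have hs0 : √(s ^ 2 + 0 ^ 2) = s := by
      rw [zero_pow two_ne_zero, add_zero, Real.sqrt_sq hs.le]
    have d1 := (hud2 (√(s ^ 2 + 0 ^ 2))).hasDerivAt.comp (0 : ℝ) (d0 0)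
    have d2 := (hasDerivAt_id' (0 : ℝ)).fun_div (d0 0) (by rw [hs0]; exact hs.ne')
    refine ((d1.fun_mul d2).congr_deriv ?_).deriv
    simp only [Function.comp, hs0]
    field_simp
    ring
  rw [laplacian_eq_sum_deriv hw (EuclideanSpace.basisFun (Fin 3) ℝ), Fin.sum_univ_three,
    key 1 (by decide), key 2 (by decide)]
  have e0 : ∀ h : ℝ, w (s • unitVec + h • (EuclideanSpace.basisFun (Fin 3) ℝ) 0) = u (s + h) := by
    intro h
    simp only [hu, add_smul, unitVec, EuclideanSpace.basisFun_apply]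
  simp only [e0]
  have e3 : (deriv fun h : ℝ => u (s + h)) = fun h => deriv u (s + h) := by
    ext h
    exact deriv_comp_const_add u s h
  rw [e3, deriv_comp_const_add, add_zero]
  ring

/-- For a radial potential the mass in a ball is read off from the field at its boundary. -/
theorem massIn_eq_of_poisson {g : Phase → ℝ} (hw : ContDiff ℝ 2 w)
    (hrad : ∀ x y, ‖x‖ = ‖y‖ → w x = w y)
    (hp : ∀ x, Laplacian.laplacian w x = 4 * Real.pi * rho g x) {r : ℝ} (hr : 0 ≤ r) :
    massIn g r = r ^ 2 * deriv (fun s : ℝ => w (s • unitVec)) r := by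
  set u : ℝ → ℝ := fun s => w (s • unitVec) with hu
  have huc : ContDiff ℝ 2 u := contDiff_profile hw
  have hu1 : ContDiff ℝ 1 (deriv u) :=
    ((contDiff_succ_iff_deriv (n := 1)).1 (by rw [one_add_one_eq_two]; exact huc)).2.2
  have hud2 : Differentiable ℝ (deriv u) := hu1.differentiable (by norm_num)
  have hc1 : Continuous (deriv u) := hu1.continuous
  have hc2 : Continuous (deriv (deriv u)) := hu1.continuous_deriv le_rfl
  have hpi := Real.pi_pos
  have hlr : ∀ x y : E3, ‖x‖ = ‖y‖ → Laplacian.laplacian w x = Laplacian.laplacian w y := by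
    intro x y h
    obtain ⟨A, -, hA⟩ := exists_rotation_map_eq h
    have hwA : (fun z => w (A z)) = w := funext fun z => hrad _ _ (A.norm_map z)
    rw [← hA, ← laplacian_comp_isometry hw A, hwA]
  set φ : ℝ → ℝ := (Iic r).indicator fun s => (4 * Real.pi)⁻¹ * Laplacian.laplacian w (s • unitVec)
    with hφ
  have h1 : massIn g r = ∫ x : E3, φ ‖x‖ := by
    rw [massIn, ← integral_indicator Metric.isClosed_closedBall.measurableSet]
    congr 1
    ext x
    by_cases hx : ‖x‖ ≤ r
    · rw [indicator_of_mem (by simpa using hx), hφ, indicator_of_mem (by simpa using hx),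
        hlr (‖x‖ • unitVec) x (by simp [norm_smul, norm_unitVec]), hp]
      field_simp
    · rw [indicator_of_notMem (by simpa using hx), hφ, indicator_of_notMem (by simpa using hx)]
  -- Gauss's law in radial form: s² times the Laplacian is the derivative of s² u'.
  have hder : ∀ s, HasDerivAt (fun s => s ^ 2 * deriv u s)
      (2 * s * deriv u s + s ^ 2 * deriv (deriv u) s) s := fun s => by
    refine ((hasDerivAt_pow 2 s).fun_mul (hud2 s).hasDerivAt).congr_deriv ?_
    simp
  have h2 : ∫ s in (0 : ℝ)..r, (2 * s * deriv u s + s ^ 2 * deriv (deriv u) s) = r ^ 2 * deriv u r := by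
    rw [intervalIntegral.integral_eq_sub_of_hasDerivAt (fun s _ => hder s)
      (Continuous.intervalIntegrable (by fun_prop) _ _)]
    simp
  rw [h1, integral_radial, ← h2, intervalIntegral.integral_of_le hr, ← integral_const_mul]
  rw [← integral_indicator measurableSet_Ioi, ← integral_indicator measurableSet_Ioc]
  congr 1
  ext s
  by_cases h0 : 0 < s
  · by_cases hsr : s ≤ r
    · rw [indicator_of_mem (mem_Ioi.2 h0), indicator_of_mem (mem_Ioc.2 ⟨h0, hsr⟩), hφ,
        indicator_of_mem (mem_Iic.2 hsr), laplacian_of_radial hw hrad h0]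
      simp only [← hu]
      field_simp
      ring
    · rw [indicator_of_mem (mem_Ioi.2 h0), indicator_of_notMem (fun h => hsr h.2), hφ,
        indicator_of_notMem (by simpa using hsr)]
      ring
  · rw [indicator_of_notMem (by simpa using h0), indicator_of_notMem (fun h => h0 h.1)]

/-- The profile has derivative m(s)/s² ≥ 0 and vanishes at infinity, so integrating from ‖x‖ outward
recovers it; the sign supplies integrability. -/
theorem eq_potOf_of_poisson {g : Phase → ℝ} (hw : ContDiff ℝ 2 w)
    (hrad : ∀ x y, ‖x‖ = ‖y‖ → w x = w y) (hg : ∀ z, 0 ≤ g z)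
    (hp : ∀ x, Laplacian.laplacian w x = 4 * Real.pi * rho g x)
    (h0 : Tendsto w (cocompact E3) (𝓝 0)) (x : E3) : w x = potOf g x := by
  set u : ℝ → ℝ := fun s => w (s • unitVec) with hu
  have huc : ContDiff ℝ 2 u := contDiff_profile hw
  have hud : Differentiable ℝ u := huc.differentiable (by norm_num)
  have hx : w x = u ‖x‖ := hrad _ _ (by simp [norm_smul, norm_unitVec])
  have hder : ∀ s ∈ Ioi ‖x‖, HasDerivAt u (massIn g s / s ^ 2) s := by
    intro s hs
    have hs0 : 0 < s := (norm_nonneg x).trans_lt hs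
    rw [massIn_eq_of_poisson hw hrad hp hs0.le, mul_div_cancel_left₀ _ (by positivity)]
    exact (hud s).hasDerivAt
  have hlim : Tendsto u atTop (𝓝 0) := by
    refine h0.comp ?_
    rw [← Metric.cobounded_eq_cocompact, ← comap_norm_atTop, tendsto_comap_iff]
    refine tendsto_abs_atTop_atTop.congr fun s => ?_
    simp [norm_smul, norm_unitVec]
  rw [hx, potOf, integral_Ioi_of_hasDerivAt_of_nonneg hud.continuous.continuousWithinAt hder
    (fun s hs => ?_) hlim]
  · ring
  · have : 0 ≤ massIn g s := integral_nonneg fun y => integral_nonneg fun v => hg _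
    positivity

end RadialPotential

/-! ### The potential of a symmetric solution -/

namespace IsClassicalSolution

variable {f : ℝ → Phase → ℝ} {U : ℝ → E3 → ℝ}

theorem potential_radial (sol : IsClassicalSolution f U) (h0 : HasCompactSupport (f 0))
    (hs : SphericallySymmetric (f 0)) {t : ℝ} (ht : 0 ≤ t) (x y : E3) (hxy : ‖x‖ = ‖y‖) :
    U t x = U t y := by
  obtain ⟨A, hdet, rfl⟩ := exists_rotation_map_eq hxy
  have hA := fun z => sol.map_eq h0
    (fun z => hs.map_eq (sol.contDiff_slice le_rfl).continuous hdet z) ht z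
  have hU := sol.contDiff_U t ht
  have hUA : ContDiff ℝ 2 fun x => U t (A x) := hU.comp A.contDiff
  -- The difference is harmonic, because the density is now known to be symmetric, and it vanishes
  -- at infinity.
  have hz : U t (A x) - U t x = 0 := by
    refine eq_zero_of_laplacian_eq_zero (w := (fun x => U t (A x)) - U t) (hUA.sub hU) ?_
      (fun y => ?_) x
    · have := ((sol.vanishing t ht).comp A.toHomeomorph.isClosedEmbedding.tendsto_cocompact).sub
        (sol.vanishing t ht)
      rw [sub_zero] at this
      exact this
    · rw [ContDiffAt.laplacian_sub hUA.contDiffAt hU.contDiffAt, laplacian_comp_isometry hU,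
        sol.poisson t ht, sol.poisson t ht, rho_map]
      simp only [fun v => hA (y, v)]
      rw [rho, sub_self]
  linarith

theorem potential_eq (sol : IsClassicalSolution f U) (h0 : HasCompactSupport (f 0))
    (hs : SphericallySymmetric (f 0)) {t : ℝ} (ht : 0 ≤ t) (x : E3) : U t x = potOf (f t) x :=
  eq_potOf_of_poisson (sol.contDiff_U t ht) (sol.potential_radial h0 hs ht) (sol.nonneg t ht)
    (sol.poisson t ht) (sol.vanishing t ht) x

end IsClassicalSolution

/-! ### Divergence-free transport -/

section Liouville

theorem integral_eq_zero_of_hasLineDerivAt {H H' : Phase → ℝ} {w : Phase} (hH : Integrable H)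
    (hH' : Integrable H') (hd : ∀ z, HasLineDerivAt ℝ H (H' z) z w) : ∫ z, H' z = 0 := by
  have : (volume : Measure Phase).IsAddHaarMeasure :=
    inferInstanceAs ((volume : Measure E3).prod (volume : Measure E3)).IsAddHaarMeasure
  have h := integral_bilinear_hasLineDerivAt_right_eq_neg_left_of_integrable (μ := (volume : Measure Phase))
    (f := H) (f' := H') (g := fun _ => (1 : ℝ)) (g' := fun _ => 0) (v := w)
    (B := ContinuousLinearMap.mul ℝ ℝ) (by simpa using hH') (by simp) (by simpa using hH)
    (fun z _ => hd z) (fun z _ => hasDerivAt_const _ _)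
  simpa using h.symm

/-- The coefficient is constant along w, so the integrand is the line derivative of aG; a itself
only needs to be continuous. -/
theorem integral_mul_fderiv_eq_zero {G a : Phase → ℝ} (hG : ContDiff ℝ 1 G) (hGc : HasCompactSupport G)
    (ha : Continuous a) {w : Phase} (hw : ∀ z (s : ℝ), a (z + s • w) = a z) :
    Integrable (fun z => a z * fderiv ℝ G z w) ∧ ∫ z, a z * fderiv ℝ G z w = 0 := by
  have hcd : Continuous fun z => fderiv ℝ G z w := (hG.continuous_fderiv (by norm_num)).clm_apply continuous_const
  have hcs : HasCompactSupport fun z => fderiv ℝ G z w := hGc.fderiv_apply ℝ w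
  have h1 : Integrable fun z => a z * fderiv ℝ G z w :=
    (ha.mul hcd).integrable_of_hasCompactSupport hcs.mul_left
  refine ⟨h1, integral_eq_zero_of_hasLineDerivAt (H := fun z => a z * G z) (w := w)
    ((ha.mul hG.continuous).integrable_of_hasCompactSupport hGc.mul_left) h1 fun z => ?_⟩
  have h2 : HasLineDerivAt ℝ G (fderiv ℝ G z w) z w :=
    (hG.differentiable (by norm_num) z).hasFDerivAt.hasLineDerivAt w
  unfold HasLineDerivAt at h2 ⊢
  simp only [hw]
  exact h2.const_mul (a z)

/-- The characteristic vector field of a force field is divergence free. -/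
theorem integral_fderiv_characteristic_eq_zero {G : Phase → ℝ} (hG : ContDiff ℝ 1 G)
    (hGc : HasCompactSupport G) {b : E3 → E3} (hb : Continuous b) :
    ∫ z, fderiv ℝ G z (z.2, -b z.1) = 0 := by
  set e : Fin 3 → E3 := fun i => EuclideanSpace.basisFun (Fin 3) ℝ i
  have hsum : ∀ v : E3, v = ∑ i, v i • e i := fun v => by
    exact ((EuclideanSpace.basisFun (Fin 3) ℝ).sum_repr v).symm
  have hx : ∀ i, Integrable (fun z : Phase => z.2 i * fderiv ℝ G z (e i, 0)) ∧
      ∫ z : Phase, z.2 i * fderiv ℝ G z (e i, 0) = 0 := fun i =>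
    integral_mul_fderiv_eq_zero hG hGc (a := fun z => z.2 i) (by fun_prop) fun z s => by simp
  have hv : ∀ i, Integrable (fun z : Phase => b z.1 i * fderiv ℝ G z (0, e i)) ∧
      ∫ z : Phase, b z.1 i * fderiv ℝ G z (0, e i) = 0 := fun i =>
    integral_mul_fderiv_eq_zero hG hGc (a := fun z => b z.1 i) (by fun_prop) fun z s => by simp
  -- In coordinates the velocity components multiply x-derivatives and the force components multiply
  -- v-derivatives, so every coefficient is constant in the direction of its derivative.
  have hdec : ∀ z : Phase, fderiv ℝ G z (z.2, -b z.1)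
      = ∑ i, (z.2 i * fderiv ℝ G z (e i, 0) - b z.1 i * fderiv ℝ G z (0, e i)) := by
    intro z
    have h1 : ((z.2, -b z.1) : Phase) = ∑ i, (z.2 i • ((e i, 0) : Phase) - b z.1 i • ((0, e i) : Phase)) := by
      rw [Finset.sum_sub_distrib]
      ext1
      · simp only [Prod.fst_sub, Prod.fst_sum, Prod.smul_fst, smul_zero, Finset.sum_const_zero, sub_zero]
        exact hsum _
      · simp only [Prod.snd_sub, Prod.snd_sum, Prod.smul_snd, smul_zero, Finset.sum_const_zero, zero_sub]
        rw [← hsum]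
    rw [h1, map_sum]
    simp only [map_sub, map_smul, smul_eq_mul]
  simp only [hdec]
  rw [integral_finsetSum _ fun i _ => by exact (hx i).1.sub (hv i).1]
  refine Finset.sum_eq_zero fun i _ => ?_
  rw [integral_sub (hx i).1 (hv i).1, (hx i).2, (hv i).2, sub_zero]

end Liouville

/-! ### Integrals depending on time with uniformly bounded support -/

section ParametricIntegral

variable {Ψ Ψ' : ℝ → Phase → ℝ} {T R : ℝ}

theorem exists_indicator_bound (hΨ : ContinuousOn (fun p : ℝ × Phase => Ψ p.1 p.2) (Icc 0 T ×ˢ univ))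
    (hR : ∀ t ∈ Icc 0 T, ∀ z, R < ‖z‖ → Ψ t z = 0) :
    ∃ C : ℝ, 0 ≤ C ∧ ∀ t ∈ Icc 0 T, ∀ z, ‖Ψ t z‖ ≤ (Metric.closedBall 0 R).indicator (fun _ => C) z := by
  have hk : IsCompact (Icc 0 T ×ˢ Metric.closedBall (0 : Phase) R) :=
    isCompact_Icc.prod (isCompact_closedBall _ _)
  obtain ⟨C, hC⟩ := hk.exists_bound_of_continuousOn (hΨ.mono (prod_mono_right (subset_univ _)))
  refine ⟨max C 0, le_max_right _ _, fun t ht z => ?_⟩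
  by_cases hz : z ∈ Metric.closedBall (0 : Phase) R
  · rw [indicator_of_mem hz]
    exact (hC (t, z) ⟨ht, hz⟩).trans (le_max_left _ _)
  · rw [indicator_of_notMem hz, hR t ht z (by simpa using hz), norm_zero]

theorem continuous_slice (hΨ : ContinuousOn (fun p : ℝ × Phase => Ψ p.1 p.2) (Icc 0 T ×ˢ univ))
    {t : ℝ} (ht : t ∈ Icc 0 T) : Continuous (Ψ t) := by
  rw [← continuousOn_univ]
  exact hΨ.comp (f := fun z : Phase => (t, z)) (by fun_prop) fun z _ => ⟨ht, trivial⟩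

variable (μ : Measure Phase) [IsFiniteMeasureOnCompacts μ]

theorem integrable_indicator_closedBall (C : ℝ) :
    Integrable ((Metric.closedBall (0 : Phase) R).indicator fun _ => C) μ :=
  (integrable_indicator_iff Metric.isClosed_closedBall.measurableSet).2
    (integrableOn_const (isCompact_closedBall _ _).measure_lt_top.ne)

theorem continuousOn_integral_of_support
    (hΨ : ContinuousOn (fun p : ℝ × Phase => Ψ p.1 p.2) (Icc 0 T ×ˢ univ))
    (hR : ∀ t ∈ Icc 0 T, ∀ z, R < ‖z‖ → Ψ t z = 0) :
    ContinuousOn (fun t => ∫ z, Ψ t z ∂μ) (Icc 0 T) := by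
  obtain ⟨C, -, hC⟩ := exists_indicator_bound hΨ hR
  refine continuousOn_of_dominated (fun t ht => (continuous_slice hΨ ht).aestronglyMeasurable)
    (fun t ht => Eventually.of_forall (hC t ht)) (integrable_indicator_closedBall μ C)
    (Eventually.of_forall fun z => ?_)
  exact hΨ.comp (f := fun t : ℝ => (t, z)) (by fun_prop) fun t ht => ⟨ht, trivial⟩

theorem hasDerivAt_integral_of_support
    (hΨ : ContinuousOn (fun p : ℝ × Phase => Ψ p.1 p.2) (Icc 0 T ×ˢ univ))
    (hΨ' : ContinuousOn (fun p : ℝ × Phase => Ψ' p.1 p.2) (Icc 0 T ×ˢ univ))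
    (hR : ∀ t ∈ Icc 0 T, ∀ z, R < ‖z‖ → Ψ t z = 0)
    (hR' : ∀ t ∈ Icc 0 T, ∀ z, R < ‖z‖ → Ψ' t z = 0)
    (hd : ∀ t ∈ Ioo 0 T, ∀ z, HasDerivAt (fun s => Ψ s z) (Ψ' t z) t) {t : ℝ} (ht : t ∈ Ioo 0 T) :
    HasDerivAt (fun t => ∫ z, Ψ t z ∂μ) (∫ z, Ψ' t z ∂μ) t := by
  obtain ⟨C, -, hC⟩ := exists_indicator_bound hΨ hR
  obtain ⟨C', -, hC'⟩ := exists_indicator_bound hΨ' hR'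
  have hn : Ioo 0 T ∈ 𝓝 t := Ioo_mem_nhds ht.1 ht.2
  have hm : ∀ s ∈ Ioo 0 T, AEStronglyMeasurable (Ψ s) μ := fun s hs =>
    (continuous_slice hΨ (Ioo_subset_Icc_self hs)).aestronglyMeasurable
  exact (hasDerivAt_integral_of_dominated_loc_of_deriv_le hn
    (by filter_upwards [hn] with s hs using hm s hs)
    ((integrable_indicator_closedBall μ C).mono' (hm t ht)
      (Eventually.of_forall (hC t (Ioo_subset_Icc_self ht))))
    (continuous_slice hΨ' (Ioo_subset_Icc_self ht)).aestronglyMeasurable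
    (Eventually.of_forall fun z s hs => hC' s (Ioo_subset_Icc_self hs) z)
    (integrable_indicator_closedBall μ C') (Eventually.of_forall fun z s hs => hd s hs z)).2

theorem eq_of_hasDerivAt_zero {I : ℝ → ℝ} (hT : 0 ≤ T) (hc : ContinuousOn I (Icc 0 T))
    (hd : ∀ t ∈ Ioo 0 T, HasDerivAt I 0 t) : I T = I 0 := by
  rcases hT.eq_or_lt with h | h
  · rw [h]
  · obtain ⟨c, hc, hs⟩ := exists_hasDerivAt_eq_slope I (fun _ => 0) h hc hd
    rw [eq_comm, div_eq_zero_iff] at hs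
    rcases hs with hs | hs <;> linarith

end ParametricIntegral

/-! ### Conservation of smooth functionals of L and f -/

section Conservation

theorem contDiff_angL {n : WithTop ℕ∞} : ContDiff ℝ n angL := by
  unfold angL
  exact ((contDiff_fst.norm_sq ℝ).mul (contDiff_snd.norm_sq ℝ)).sub
    ((contDiff_fst.inner ℝ contDiff_snd).pow 2)

/-- Angular momentum does not change in the characteristic direction of a radial force field. -/
theorem fderiv_angL_characteristic {x v b : E3} (hb : ∀ y, ⟪x, y⟫ = 0 → ⟪b, y⟫ = 0) :
    fderiv ℝ angL (x, v) (v, -b) = 0 := by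
  have h1 := ((contDiff_angL (n := 1)).differentiable (by norm_num) (x, v)).hasFDerivAt.hasLineDerivAt
    (v, -b)
  have hx : HasDerivAt (fun s : ℝ => x + s • v) v 0 := by
    simpa using ((hasDerivAt_id' (0 : ℝ)).smul_const v).const_add x
  have hv : HasDerivAt (fun s : ℝ => v + s • -b) (-b) 0 := by
    simpa using ((hasDerivAt_id' (0 : ℝ)).smul_const (-b)).const_add v
  have h2 := (hx.norm_sq.fun_mul hv.norm_sq).fun_sub ((hx.inner ℝ hv).fun_pow 2)
  have h3 := HasDerivAt.unique (f := fun s : ℝ => angL ((x, v) + s • (v, -b))) h1 h2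
  rw [h3]
  have h4 : ⟪b, ‖x‖ ^ 2 • v - ⟪x, v⟫ • x⟫ = 0 := by
    refine hb _ ?_
    rw [inner_sub_right, real_inner_smul_right, real_inner_smul_right, real_inner_self_eq_norm_sq]
    ring
  rw [inner_sub_right, real_inner_smul_right, real_inner_smul_right] at h4
  simp only [zero_smul, add_zero, inner_neg_right, real_inner_self_eq_norm_sq]
  rw [real_inner_comm] at h4
  rw [real_inner_comm b x]
  simp
  linear_combination (-2) * h4

variable {f : ℝ → Phase → ℝ} {U : ℝ → E3 → ℝ}

namespace IsClassicalSolution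

theorem timeDeriv_eq_zero (sol : IsClassicalSolution f U) {t R : ℝ} (ht : 0 ≤ t)
    (hR : ∀ z, R < ‖z‖ → f t z = 0) {z : Phase} (hz : R < ‖z‖) : timeDeriv f t z = 0 := by
  have h1 : f t =ᶠ[𝓝 z] fun _ => 0 := by
    filter_upwards [continuous_norm.continuousAt.eventually (lt_mem_nhds hz)] with y hy using hR y hy
  rw [sol.timeDeriv_eq ht, h1.fderiv_eq]
  simp

theorem hasCompactSupport_slice (sol : IsClassicalSolution f U) (h0 : HasCompactSupport (f 0)) {t : ℝ}
    (ht : 0 ≤ t) : HasCompactSupport (f t) := by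
  obtain ⟨R, -, hR⟩ := sol.exists_support_bound h0 t
  refine HasCompactSupport.of_support_subset_isCompact (isCompact_closedBall (0 : Phase) R) fun z hz => ?_
  rw [mem_closedBall_zero_iff]
  by_contra hc
  exact hz (hR t ht le_rfl z (not_le.1 hc))

theorem continuous_gradient (sol : IsClassicalSolution f U) {t : ℝ} (ht : 0 ≤ t) :
    Continuous (gradient (U t)) :=
  (InnerProductSpace.toDual ℝ E3).symm.continuous.comp ((sol.contDiff_U t ht).continuous_fderiv (by norm_num))

/-- Conservation of smooth functionals of the density and the angular momentum. -/
theorem integral_comp_eq (sol : IsClassicalSolution f U) (h0 : HasCompactSupport (f 0))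
    (hs : SphericallySymmetric (f 0)) {Φ : ℝ × ℝ → ℝ} (hΦ : ContDiff ℝ 1 Φ) (hΦ0 : ∀ a, Φ (a, 0) = 0)
    {t : ℝ} (ht : 0 ≤ t) : ∫ z, Φ (angL z, f t z) = ∫ z, Φ (angL z, f 0 z) := by
  obtain ⟨R, hR0, hR⟩ := sol.exists_support_bound h0 t
  have hsub : Icc 0 t ×ˢ (univ : Set Phase) ⊆ Ici 0 ×ˢ univ := prod_mono_left Icc_subset_Ici_self
  have hfc := sol.continuousOn_uncurry.mono hsub
  have hc2 : ContinuousOn (fun p : ℝ × Phase => (angL p.2, f p.1 p.2)) (Icc 0 t ×ˢ univ) :=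
    (continuous_angL.comp continuous_snd).continuousOn.prodMk hfc
  have hΦd : Differentiable ℝ Φ := hΦ.differentiable (by norm_num)
  set Ψ : ℝ → Phase → ℝ := fun s z => Φ (angL z, f s z) with hΨ
  set Ψ' : ℝ → Phase → ℝ := fun s z => fderiv ℝ Φ (angL z, f s z) (0, timeDeriv f s z) with hΨ'
  have hΨc : ContinuousOn (fun p : ℝ × Phase => Ψ p.1 p.2) (Icc 0 t ×ˢ univ) :=
    hΦ.continuous.comp_continuousOn hc2
  have hΨc' : ContinuousOn (fun p : ℝ × Phase => Ψ' p.1 p.2) (Icc 0 t ×ˢ univ) :=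
    ((hΦ.continuous_fderiv (by norm_num)).comp_continuousOn hc2).clm_apply
      (continuousOn_const.prodMk (sol.continuousOn_timeDeriv.mono hsub))
  have hz : ∀ s ∈ Icc 0 t, ∀ z, R < ‖z‖ → Ψ s z = 0 := fun s hs z hz => by
    simp only [hΨ, hR s hs.1 hs.2 z hz, hΦ0]
  have hz' : ∀ s ∈ Icc 0 t, ∀ z, R < ‖z‖ → Ψ' s z = 0 := fun s hs z hz => by
    simp only [hΨ', sol.timeDeriv_eq_zero hs.1 (hR s hs.1 hs.2) hz]
    exact map_zero _
  have hd : ∀ s ∈ Ioo 0 t, ∀ z, HasDerivAt (fun s => Ψ s z) (Ψ' s z) s := fun s hs z =>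
    (hΦd _).hasFDerivAt.comp_hasDerivAt s ((hasDerivAt_const s _).prodMk (sol.hasDerivAt_time hs.1 z))
  refine eq_of_hasDerivAt_zero (I := fun s => ∫ z, Ψ s z) ht
    (continuousOn_integral_of_support volume hΨc hz) fun s hs' => ?_
  have h1 := hasDerivAt_integral_of_support volume hΨc hΨc' hz hz' hd hs'
  refine h1.congr_deriv ?_
  have hs0 : 0 ≤ s := hs'.1.le
  have hfs := sol.contDiff_slice hs0
  have hG : ContDiff ℝ 1 (Ψ s) := hΦ.comp (contDiff_angL.prodMk hfs)
  have hGc : HasCompactSupport (Ψ s) :=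
    HasCompactSupport.of_support_subset_isCompact (isCompact_closedBall (0 : Phase) R) fun z hz1 => by
      rw [mem_closedBall_zero_iff]
      by_contra hc
      exact hz1 (hz s ⟨hs0, hs'.2.le⟩ z (not_le.1 hc))
  have h2 := integral_fderiv_characteristic_eq_zero hG hGc (sol.continuous_gradient hs0)
  -- Both arguments of Φ are transported: f by the Vlasov equation, and L because the force is
  -- radial. The time derivative is thus a pure transport term, whose integral vanishes.
  have h3 : ∀ z : Phase, Ψ' s z = -fderiv ℝ (Ψ s) z (z.2, -gradient (U s) z.1) := by
    intro z
    have d1 : HasFDerivAt (fun z => (angL z, f s z))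
        ((fderiv ℝ angL z).prod (fderiv ℝ (f s) z)) z :=
      ((contDiff_angL (n := 1)).differentiable (by norm_num) z).hasFDerivAt.prodMk
        (hfs.differentiable (by norm_num) z).hasFDerivAt
    have d2 : HasFDerivAt (Ψ s) _ z := (hΦd (angL z, f s z)).hasFDerivAt.comp z d1
    have d3 : fderiv ℝ angL z (z.2, -gradient (U s) z.1) = 0 :=
      fderiv_angL_characteristic fun y hy => inner_gradient_eq_zero_of_radial
        ((sol.contDiff_U s hs0).differentiable (by norm_num)) (sol.potential_radial h0 hs hs0) hy
    rw [d2.fderiv, ContinuousLinearMap.comp_apply, ContinuousLinearMap.prod_apply, d3, ← map_neg,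
      Prod.neg_mk, neg_zero, ← sol.timeDeriv_eq hs0]
  simp only [h3]
  rw [integral_neg, h2, neg_zero]

end IsClassicalSolution

end Conservation

/-! ### The conserved joint law of L and f -/

section InvariantLaw

variable {g : Phase → ℝ}

/-- The joint distribution of the angular momentum and the density, weighted with the density. -/
noncomputable def invariantLaw (g : Phase → ℝ) : Measure (ℝ × ℝ) :=
  (volume.withDensity fun z => ENNReal.ofReal (g z)).map fun z => (angL z, g z)

theorem integrable_invariantLaw_iff {E : Type*} [NormedAddCommGroup E] [NormedSpace ℝ E]
    (hg : Continuous g) (hg0 : ∀ z, 0 ≤ g z) {Θ : ℝ × ℝ → E} (hΘ : StronglyMeasurable Θ) :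
    Integrable Θ (invariantLaw g) ↔ Integrable fun z => g z • Θ (angL z, g z) := by
  rw [invariantLaw, integrable_map_measure hΘ.aestronglyMeasurable
    (measurable_angL.prodMk hg.measurable).aemeasurable,
    integrable_withDensity_iff_integrable_smul' hg.measurable.ennreal_ofReal
      (Eventually.of_forall fun _ => ENNReal.ofReal_lt_top)]
  simp only [ENNReal.toReal_ofReal (hg0 _), Function.comp]

theorem integral_invariantLaw {E : Type*} [NormedAddCommGroup E] [NormedSpace ℝ E]
    (hg : Continuous g) (hg0 : ∀ z, 0 ≤ g z) {Θ : ℝ × ℝ → E} (hΘ : StronglyMeasurable Θ) :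
    ∫ p, Θ p ∂invariantLaw g = ∫ z, g z • Θ (angL z, g z) := by
  rw [invariantLaw, integral_map (measurable_angL.prodMk hg.measurable).aemeasurable
    hΘ.aestronglyMeasurable, integral_withDensity_eq_integral_toReal_smul hg.measurable.ennreal_ofReal
      (Eventually.of_forall fun _ => ENNReal.ofReal_lt_top)]
  simp only [ENNReal.toReal_ofReal (hg0 _)]

theorem isFiniteMeasure_invariantLaw (hg : Continuous g) (hg0 : ∀ z, 0 ≤ g z) (hi : Integrable g) :
    IsFiniteMeasure (invariantLaw g) := by
  have h := (integrable_invariantLaw_iff (E := ℝ) hg hg0 (Θ := fun _ => 1) stronglyMeasurable_const).2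
    (by simpa using hi)
  rcases (integrable_const_iff (c := (1 : ℝ))).1 h with h | h
  · norm_num at h
  · exact h

end InvariantLaw

namespace IsClassicalSolution

variable {f : ℝ → Phase → ℝ} {U : ℝ → E3 → ℝ}

theorem integrable_slice (sol : IsClassicalSolution f U) (h0 : HasCompactSupport (f 0)) {t : ℝ}
    (ht : 0 ≤ t) : Integrable (f t) :=
  (sol.contDiff_slice ht).continuous.integrable_of_hasCompactSupport (sol.hasCompactSupport_slice h0 ht)

/-- The real and imaginary parts of the characteristic function are integrals of f cos ℓ(L, f) and f
sin ℓ(L, f), smooth functionals that vanish with f and are therefore conserved. Passing to the law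
extends conservation to merely measurable functions, as needed for the Casimir density, which may be
singular at L = 0. -/
theorem invariantLaw_eq (sol : IsClassicalSolution f U) (h0 : HasCompactSupport (f 0))
    (hs : SphericallySymmetric (f 0)) {t : ℝ} (ht : 0 ≤ t) :
    invariantLaw (f t) = invariantLaw (f 0) := by
  have hfin : ∀ s, 0 ≤ s → IsFiniteMeasure (invariantLaw (f s)) := fun s hs =>
    isFiniteMeasure_invariantLaw (sol.contDiff_slice hs).continuous (sol.nonneg s hs)
      (sol.integrable_slice h0 hs)
  have := hfin t ht
  have := hfin 0 le_rfl
  refine Measure.ext_of_charFunDual (funext fun ℓ => ?_)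
  have hcos : ContDiff ℝ 1 fun p : ℝ × ℝ => p.2 * Real.cos (ℓ p) := by fun_prop
  have hsin : ContDiff ℝ 1 fun p : ℝ × ℝ => p.2 * Real.sin (ℓ p) := by fun_prop
  have hval : ∀ s, 0 ≤ s → charFunDual (invariantLaw (f s)) ℓ
      = ((∫ z, f s z * Real.cos (ℓ (angL z, f s z)) : ℝ) : ℂ)
        + ((∫ z, f s z * Real.sin (ℓ (angL z, f s z)) : ℝ) : ℂ) * Complex.I := by
    intro s hs
    have hc := (sol.contDiff_slice hs).continuous
    have hcs := sol.hasCompactSupport_slice h0 hs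
    have hℓ : Continuous fun z => ℓ (angL z, f s z) := ℓ.continuous.comp (continuous_angL.prodMk hc)
    rw [charFunDual_apply, integral_invariantLaw hc (sol.nonneg s hs)
      (Continuous.stronglyMeasurable (by fun_prop)), ← integral_complex_ofReal, ← integral_complex_ofReal,
      ← integral_mul_const, ← integral_add]
    · congr 1
      ext z
      rw [Complex.exp_mul_I, Complex.real_smul]
      push_cast
      ring
    · exact ((hc.mul (Real.continuous_cos.comp hℓ)).integrable_of_hasCompactSupport hcs.mul_right).ofReal
    · exact ((hc.mul (Real.continuous_sin.comp hℓ)).integrable_of_hasCompactSupport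
        hcs.mul_right).ofReal.mul_const _
  rw [hval t ht, hval 0 le_rfl, sol.integral_comp_eq h0 hs hcos (by simp) ht,
    sol.integral_comp_eq h0 hs hsin (by simp) ht]

theorem integral_mul_comp_eq (sol : IsClassicalSolution f U) (h0 : HasCompactSupport (f 0))
    (hs : SphericallySymmetric (f 0)) {Θ : ℝ × ℝ → ℝ} (hΘ : Measurable Θ) {t : ℝ} (ht : 0 ≤ t) :
    ∫ z, f t z * Θ (angL z, f t z) = ∫ z, f 0 z * Θ (angL z, f 0 z) := by
  have h : ∀ s, 0 ≤ s → ∫ p, Θ p ∂invariantLaw (f s) = ∫ z, f s z * Θ (angL z, f s z) := fun s hs =>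
    integral_invariantLaw (sol.contDiff_slice hs).continuous (sol.nonneg s hs) hΘ.stronglyMeasurable
  rw [← h t ht, ← h 0 le_rfl, sol.invariantLaw_eq h0 hs ht]

theorem integrable_mul_comp_iff (sol : IsClassicalSolution f U) (h0 : HasCompactSupport (f 0))
    (hs : SphericallySymmetric (f 0)) {Θ : ℝ × ℝ → ℝ} (hΘ : Measurable Θ) {t : ℝ} (ht : 0 ≤ t) :
    Integrable (fun z => f t z * Θ (angL z, f t z)) ↔
      Integrable (fun z => f 0 z * Θ (angL z, f 0 z)) := by
  have h : ∀ s, 0 ≤ s → (Integrable Θ (invariantLaw (f s)) ↔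
      Integrable fun z => f s z * Θ (angL z, f s z)) := fun s hs =>
    integrable_invariantLaw_iff (sol.contDiff_slice hs).continuous (sol.nonneg s hs)
      hΘ.stronglyMeasurable
  rw [← h t ht, ← h 0 le_rfl, sol.invariantLaw_eq h0 hs ht]

/-- The Casimir density as a function of the angular momentum and the density. -/
theorem exists_casimirDensity_eq {l : ℝ} {Q : ℝ → ℝ} (hQ : CasimirAssumptions l Q) :
    ∃ Θ : ℝ × ℝ → ℝ, Measurable Θ ∧ ∀ g : Phase → ℝ, (∀ z, 0 ≤ g z) →
      casimirDensity l Q g = fun z => g z * Θ (angL z, g z) := by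
  have hQc : Continuous fun y : ℝ => Q (max y 0) :=
    hQ.continuousOn.comp_continuous (by fun_prop) fun y => mem_Ici.2 (le_max_right y 0)
  -- Dividing by the density is harmless: where it vanishes both sides are zero, because Q(0) = 0.
  -- The maximum with 0 gives measurability from continuity of Q on the half-line alone.
  refine ⟨fun p => Q (max (p.1 ^ (-l) * p.2) 0) * p.1 ^ l / p.2, ?_, fun g hg => ?_⟩
  · have h1 : Measurable fun p : ℝ × ℝ => p.1 ^ (-l) * p.2 := by fun_prop
    exact ((hQc.measurable.comp h1).mul (by fun_prop)).div measurable_snd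
  · ext z
    have hnn : 0 ≤ angL z ^ (-l) * g z := mul_nonneg (Real.rpow_nonneg (angL_nonneg z) _) (hg z)
    simp only [casimirDensity]
    rw [max_eq_left hnn]
    rcases eq_or_ne (g z) 0 with h | h
    · rw [h, mul_zero, hQ.map_zero, zero_mul, zero_mul]
    · field_simp

variable {l γ M : ℝ} {Q : ℝ → ℝ}

theorem casimir_eq (sol : IsClassicalSolution f U) (hQ : CasimirAssumptions l Q)
    (h0 : HasCompactSupport (f 0)) (hs : SphericallySymmetric (f 0)) {t : ℝ} (ht : 0 ≤ t) :
    casimir l Q (f t) = casimir l Q (f 0) := by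
  obtain ⟨Θ, hΘ, h⟩ := exists_casimirDensity_eq hQ
  simp only [casimir, h _ (sol.nonneg t ht), h _ (sol.nonneg 0 le_rfl)]
  exact sol.integral_mul_comp_eq h0 hs hΘ ht

theorem integral_angL_mul_eq (sol : IsClassicalSolution f U)
    (h0 : HasCompactSupport (f 0)) (hs : SphericallySymmetric (f 0)) {t : ℝ} (ht : 0 ≤ t) :
    ∫ z, angL z * f t z = ∫ z, angL z * f 0 z := by
  simpa only [mul_comm] using sol.integral_mul_comp_eq h0 hs measurable_fst ht

theorem memF (sol : IsClassicalSolution f U) (hQ : CasimirAssumptions l Q)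
    (h0 : HasCompactSupport (f 0)) (hf : MemF l Q γ M (f 0)) {t : ℝ} (ht : 0 ≤ t) :
    MemF l Q γ M (f t) where
  integrable := sol.integrable_slice h0 ht
  nonneg := Eventually.of_forall (sol.nonneg t ht)
  mass := by
    rw [← hf.mass]
    simpa using sol.integral_mul_comp_eq h0 hf.symm (measurable_const (a := (1 : ℝ))) ht
  finite_angL := ((continuous_angL.mul (sol.contDiff_slice ht).continuous).integrable_of_hasCompactSupport
    (sol.hasCompactSupport_slice h0 ht).mul_left).const_mul γ
  finite_casimir := by
    obtain ⟨Θ, hΘ, h⟩ := exists_casimirDensity_eq hQ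
    have h1 := hf.finite_casimir
    rw [h _ (sol.nonneg 0 le_rfl)] at h1
    rw [h _ (sol.nonneg t ht)]
    exact (sol.integrable_mul_comp_iff h0 hf.symm hΘ ht).2 h1
  finite_kin := Continuous.integrable_of_hasCompactSupport
    ((continuous_snd.norm.pow 2).mul (sol.contDiff_slice ht).continuous)
    (sol.hasCompactSupport_slice h0 ht).mul_left
  symm := fun _A hA => Eventually.of_forall fun z => sol.map_eq h0
    (fun z => hf.symm.map_eq (sol.contDiff_slice le_rfl).continuous hA z) ht z

end IsClassicalSolution

/-! ### Time dependence of the field energy -/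

section FieldEnergy

theorem integrableOn_min_pow_sq_div :
    IntegrableOn (fun s : ℝ => (min (s ^ 3) 1) ^ 2 / s ^ 2) (Ioi 0) := by
  have hi : Integrable fun s : ℝ => 2 * (1 + s ^ 2)⁻¹ := integrable_inv_one_add_sq.const_mul 2
  refine hi.integrableOn.mono' (Measurable.aestronglyMeasurable (by fun_prop)) ?_
  refine (ae_restrict_iff' measurableSet_Ioi).2 (ae_of_all _ fun s hs => ?_)
  have hs0 : 0 < s := hs
  rw [Real.norm_of_nonneg (by positivity), ← div_eq_mul_inv, div_le_div_iff₀ (by positivity) (by positivity)]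
  rcases le_total s 1 with h | h
  · have h3 : s ^ 3 ≤ 1 := pow_le_one₀ hs0.le h
    have h2 : s ^ 2 ≤ 1 := pow_le_one₀ hs0.le h
    rw [min_eq_left h3]
    have h4 : s ^ 4 ≤ 1 := pow_le_one₀ hs0.le h
    calc (s ^ 3) ^ 2 * (1 + s ^ 2) = s ^ 4 * (1 + s ^ 2) * s ^ 2 := by ring
      _ ≤ 1 * (1 + 1) * s ^ 2 := by gcongr
      _ = 2 * s ^ 2 := by ring
  · rw [min_eq_right (one_le_pow₀ h)]
    have : 1 ≤ s ^ 2 := one_le_pow₀ h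
    linarith

/-- A bounded density with bounded support has mass function O(s³) near the origin and bounded at
infinity. No sign is assumed, so that time derivatives are covered too. -/
theorem exists_abs_massIn_le {R : ℝ} (hR : 0 ≤ R) : ∃ K : ℝ, 0 ≤ K ∧ ∀ C : ℝ, 0 ≤ C → ∀ h : Phase → ℝ,
    Integrable h → (∀ z, ‖h z‖ ≤ (Metric.closedBall 0 R).indicator (fun _ => C) z) →
    ∀ s, 0 ≤ s → |massIn h s| ≤ C * (K * min (s ^ 3) 1) := by
  set c : ℝ := volume.real (Metric.ball (0 : E3) 1) with hc
  have hc0 : 0 ≤ c := measureReal_nonneg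
  have hball : ∀ r : ℝ, 0 ≤ r → volume.real (Metric.closedBall (0 : E3) r) = r ^ 3 * c := by
    intro r hr
    have := Measure.addHaar_real_closedBall (volume : Measure E3) 0 hr
    rw [finrank_E3] at this
    exact this
  refine ⟨max (R ^ 3) 1 * c * (R ^ 3 * c), by positivity, fun C hC h hi hb s hs => ?_⟩
  set B : Set Phase := Metric.closedBall (0 : E3) (min s R) ×ˢ Metric.closedBall (0 : E3) R with hB
  have hBm : MeasurableSet B :=
    Metric.isClosed_closedBall.measurableSet.prod Metric.isClosed_closedBall.measurableSet
  have hBc : IsCompact B := (isCompact_closedBall _ _).prod (isCompact_closedBall _ _)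
  have hBv : volume.real B = (min s R) ^ 3 * c * (R ^ 3 * c) := by
    rw [hB, Measure.volume_eq_prod, measureReal_prod_prod, hball _ (le_min hs hR), hball _ hR]
  have h1 : |massIn h s| ≤ ∫ z, B.indicator (fun _ => C) z := by
    rw [massIn_eq_setIntegral hi, ← integral_indicator (measurableSet_norm_fst_le s), ← Real.norm_eq_abs]
    refine norm_integral_le_of_norm_le ((integrable_indicator_iff hBm).2
      (integrableOn_const hBc.measure_lt_top.ne)) (ae_of_all _ fun z => ?_)
    by_cases hz : ‖z.1‖ ≤ s
    · rw [indicator_of_mem (show z ∈ {z : Phase | ‖z.1‖ ≤ s} from hz)]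
      refine (hb z).trans ?_
      by_cases hzR : z ∈ Metric.closedBall (0 : Phase) R
      · have h2 : ‖z‖ ≤ R := mem_closedBall_zero_iff.1 hzR
        have h3 : z ∈ B := ⟨mem_closedBall_zero_iff.2 (le_min hz ((norm_fst_le z).trans h2)),
          mem_closedBall_zero_iff.2 ((norm_snd_le z).trans h2)⟩
        rw [indicator_of_mem hzR, indicator_of_mem h3]
      · rw [indicator_of_notMem hzR]
        exact indicator_nonneg (fun _ _ => hC) z
    · rw [indicator_of_notMem (show z ∉ {z : Phase | ‖z.1‖ ≤ s} from hz), norm_zero]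
      exact indicator_nonneg (fun _ _ => hC) z
  rw [integral_indicator hBm, setIntegral_const, hBv, smul_eq_mul] at h1
  refine h1.trans ?_
  have h4 : (min s R) ^ 3 ≤ max (R ^ 3) 1 * min (s ^ 3) 1 := by
    have hm : 0 ≤ min s R := le_min hs hR
    rcases le_total (s ^ 3) 1 with h | h
    · rw [min_eq_left h]
      calc (min s R) ^ 3 ≤ 1 * s ^ 3 := by rw [one_mul]; gcongr; exact min_le_left _ _
        _ ≤ _ := by gcongr; exact le_max_right _ _
    · rw [min_eq_right h, mul_one]
      exact (pow_le_pow_left₀ hm (min_le_right _ _) 3).trans (le_max_left _ _)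
  calc (min s R) ^ 3 * c * (R ^ 3 * c) * C
      ≤ max (R ^ 3) 1 * min (s ^ 3) 1 * c * (R ^ 3 * c) * C := by gcongr
    _ = _ := by ring

variable {Ψ Ψ' : ℝ → Phase → ℝ} {T R : ℝ}

theorem abs_mul_div_sq_le {a b C C' K s : ℝ} (hs : 0 < s) (hC : 0 ≤ C) (hK : 0 ≤ K)
    (ha : |a| ≤ C * (K * min (s ^ 3) 1)) (hb : |b| ≤ C' * (K * min (s ^ 3) 1)) :
    ‖a * b / s ^ 2‖ ≤ C * C' * K ^ 2 * ((min (s ^ 3) 1) ^ 2 / s ^ 2) := by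
  rw [norm_div, norm_mul, Real.norm_eq_abs, Real.norm_eq_abs, norm_pow, Real.norm_of_nonneg hs.le]
  calc |a| * |b| / s ^ 2 ≤ C * (K * min (s ^ 3) 1) * (C' * (K * min (s ^ 3) 1)) / s ^ 2 := by gcongr
    _ = _ := by ring

theorem integrable_of_support
    (hΨ : ContinuousOn (fun p : ℝ × Phase => Ψ p.1 p.2) (Icc 0 T ×ˢ univ))
    (hR : ∀ t ∈ Icc 0 T, ∀ z, R < ‖z‖ → Ψ t z = 0) {t : ℝ} (ht : t ∈ Icc 0 T) : Integrable (Ψ t) := by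
  obtain ⟨C, hC0, hC⟩ := exists_indicator_bound hΨ hR
  exact (integrable_indicator_closedBall volume C).mono' (continuous_slice hΨ ht).aestronglyMeasurable
    (ae_of_all _ (hC t ht))

/-- Continuity and differentiability in time of the field energy. -/
theorem fieldEnergy_regularity (hR0 : 0 ≤ R)
    (hΨ : ContinuousOn (fun p : ℝ × Phase => Ψ p.1 p.2) (Icc 0 T ×ˢ univ))
    (hΨ' : ContinuousOn (fun p : ℝ × Phase => Ψ' p.1 p.2) (Icc 0 T ×ˢ univ))
    (hR : ∀ t ∈ Icc 0 T, ∀ z, R < ‖z‖ → Ψ t z = 0)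
    (hR' : ∀ t ∈ Icc 0 T, ∀ z, R < ‖z‖ → Ψ' t z = 0)
    (hd : ∀ t ∈ Ioo 0 T, ∀ z, HasDerivAt (fun s => Ψ s z) (Ψ' t z) t) :
    ContinuousOn (fun t => ∫ s in Ioi (0 : ℝ), massIn (Ψ t) s ^ 2 / s ^ 2) (Icc 0 T) ∧
    ∀ t ∈ Ioo 0 T, HasDerivAt (fun t => ∫ s in Ioi (0 : ℝ), massIn (Ψ t) s ^ 2 / s ^ 2)
      (2 * ∫ s in Ioi (0 : ℝ), massIn (Ψ t) s * massIn (Ψ' t) s / s ^ 2) t := by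
  obtain ⟨C, hC0, hC⟩ := exists_indicator_bound hΨ hR
  obtain ⟨C', hC0', hC'⟩ := exists_indicator_bound hΨ' hR'
  obtain ⟨K, hK, hKb⟩ := exists_abs_massIn_le hR0
  have hi : ∀ t ∈ Icc 0 T, Integrable (Ψ t) := fun t ht => integrable_of_support hΨ hR ht
  have hi' : ∀ t ∈ Icc 0 T, Integrable (Ψ' t) := fun t ht => integrable_of_support hΨ' hR' ht
  have hb : ∀ t ∈ Icc 0 T, ∀ s, 0 < s → |massIn (Ψ t) s| ≤ C * (K * min (s ^ 3) 1) := fun t ht s hs =>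
    hKb C hC0 _ (hi t ht) (hC t ht) s hs.le
  have hb' : ∀ t ∈ Icc 0 T, ∀ s, 0 < s → |massIn (Ψ' t) s| ≤ C' * (K * min (s ^ 3) 1) := fun t ht s hs =>
    hKb C' hC0' _ (hi' t ht) (hC' t ht) s hs.le
  have hmeas : ∀ t ∈ Icc 0 T, ∀ g : Phase → ℝ, Integrable g →
      AEStronglyMeasurable (fun s => massIn (Ψ t) s * massIn g s / s ^ 2) (volume.restrict (Ioi 0)) :=
    fun t ht g hg => (((continuous_massIn (hi t ht)).measurable.mul (continuous_massIn hg).measurable).div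
      (by fun_prop)).aestronglyMeasurable
  have hcont : ∀ s, ContinuousOn (fun t => massIn (Ψ t) s) (Icc 0 T) := fun s =>
    (continuousOn_integral_of_support (volume.restrict {z : Phase | ‖z.1‖ ≤ s}) hΨ hR).congr
      fun t ht => massIn_eq_setIntegral (hi t ht) s
  have hder : ∀ s, ∀ t ∈ Ioo 0 T, HasDerivAt (fun t => massIn (Ψ t) s) (massIn (Ψ' t) s) t := by
    intro s t ht
    have h1 := hasDerivAt_integral_of_support (volume.restrict {z : Phase | ‖z.1‖ ≤ s}) hΨ hΨ' hR hR' hd ht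
    rw [massIn_eq_setIntegral (hi' t (Ioo_subset_Icc_self ht))]
    refine h1.congr_of_eventuallyEq ?_
    filter_upwards [Ioo_mem_nhds ht.1 ht.2] with τ hτ
    exact massIn_eq_setIntegral (hi τ (Ioo_subset_Icc_self hτ)) s
  have hres : ∀ {p : ℝ → Prop}, (∀ s, 0 < s → p s) → ∀ᵐ s ∂volume.restrict (Ioi (0 : ℝ)), p s :=
    fun h => (ae_restrict_iff' measurableSet_Ioi).2 (ae_of_all _ h)
  have hint : ∀ c : ℝ, Integrable (fun s : ℝ => c * ((min (s ^ 3) 1) ^ 2 / s ^ 2))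
      (volume.restrict (Ioi 0)) := fun c => integrableOn_min_pow_sq_div.const_mul c
  simp only [sq (massIn _ _)]
  refine ⟨continuousOn_of_dominated (fun t ht => hmeas t ht _ (hi t ht))
    (fun t ht => hres fun s hs => abs_mul_div_sq_le hs hC0 hK (hb t ht s hs) (hb t ht s hs))
    (hint _) (ae_of_all _ fun s => ((hcont s).mul (hcont s)).div_const _), fun t ht => ?_⟩
  have hn : Ioo 0 T ∈ 𝓝 t := Ioo_mem_nhds ht.1 ht.2
  have htc := Ioo_subset_Icc_self ht
  have hmain := (hasDerivAt_integral_of_dominated_loc_of_deriv_le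
    (μ := volume.restrict (Ioi (0 : ℝ))) (F := fun t s => massIn (Ψ t) s * massIn (Ψ t) s / s ^ 2)
    (F' := fun t s => 2 * (massIn (Ψ t) s * massIn (Ψ' t) s / s ^ 2))
    (bound := fun s => 2 * (C * C' * K ^ 2 * ((min (s ^ 3) 1) ^ 2 / s ^ 2))) hn
    (by filter_upwards [hn] with τ hτ using
      hmeas τ (Ioo_subset_Icc_self hτ) _ (hi τ (Ioo_subset_Icc_self hτ)))
    ((hint _).mono' (hmeas t htc _ (hi t htc))
      (hres fun s hs => abs_mul_div_sq_le hs hC0 hK (hb t htc s hs) (hb t htc s hs)))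
    ((hmeas t htc _ (hi' t htc)).const_mul 2)
    (hres fun s hs τ hτ => by
      rw [norm_mul, Real.norm_two]
      gcongr
      exact abs_mul_div_sq_le hs hC0 hK (hb τ (Ioo_subset_Icc_self hτ) s hs)
        (hb' τ (Ioo_subset_Icc_self hτ) s hs))
    ((hint _).const_mul 2)
    (ae_of_all _ fun s τ hτ =>
      (((hder s τ hτ).fun_mul (hder s τ hτ)).div_const (s ^ 2)).congr_deriv (by ring))).2
  exact hmain.congr_deriv (integral_const_mul _ _)

theorem integral_mul_potOf_of_bounded {g h : Phase → ℝ} (hR0 : 0 ≤ R) {C C' : ℝ} (hC : 0 ≤ C)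
    (hC' : 0 ≤ C') (hg : Integrable g) (hg0 : ∀ z, 0 ≤ g z) (hh : Integrable h)
    (hbg : ∀ z, ‖g z‖ ≤ (Metric.closedBall 0 R).indicator (fun _ => C) z)
    (hbh : ∀ z, ‖h z‖ ≤ (Metric.closedBall 0 R).indicator (fun _ => C') z) :
    Integrable (fun z => h z * potOf g z.1) ∧
      ∫ z, h z * potOf g z.1 = -∫ s in Ioi (0 : ℝ), massIn g s * massIn h s / s ^ 2 := by
  obtain ⟨K, hK, hKb⟩ := exists_abs_massIn_le hR0
  have hN : Measurable fun s => massIn g s / s ^ 2 := (continuous_massIn hg).measurable.div (by fun_prop)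
  have hN0 : ∀ s, 0 ≤ massIn g s / s ^ 2 := fun s => by
    have := massIn_nonneg hg (ae_of_all _ hg0) s
    positivity
  have hint : IntegrableOn (fun s => massIn g s / s ^ 2 * massIn (fun z => ‖h z‖) s) (Ioi 0) := by
    refine (integrableOn_min_pow_sq_div.const_mul (C * C' * K ^ 2)).mono'
      (hN.mul (continuous_massIn hh.norm).measurable).aestronglyMeasurable
      ((ae_restrict_iff' measurableSet_Ioi).2 (ae_of_all _ fun s hs => ?_))
    rw [div_mul_eq_mul_div]
    exact abs_mul_div_sq_le hs hC hK (hKb C hC g hg hbg s (le_of_lt hs))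
      (hKb C' hC' _ hh.norm (fun z => by rw [norm_norm]; exact hbh z) s (le_of_lt hs))
  obtain ⟨h1, h2⟩ := integral_mul_radial_potential hh hN hN0 hint
  simp only [potOf, mul_neg]
  refine ⟨h1.neg, ?_⟩
  rw [integral_neg, h2]
  simp only [div_mul_eq_mul_div]

end FieldEnergy

/-! ### Conservation of energy and of the energy-Casimir functional -/

namespace IsClassicalSolution

variable {f : ℝ → Phase → ℝ} {U : ℝ → E3 → ℝ}

/-- The power of the force field is balanced. -/
theorem integral_energy_mul_timeDeriv (sol : IsClassicalSolution f U) (h0 : HasCompactSupport (f 0))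
    {t : ℝ} (ht : 0 ≤ t) : ∫ z : Phase, (1 / 2 * ‖z.2‖ ^ 2 + U t z.1) * timeDeriv f t z = 0 := by
  have hU : ContDiff ℝ 1 (U t) := (sol.contDiff_U t ht).of_le (by norm_num)
  have hf := sol.contDiff_slice ht
  have he : ContDiff ℝ 1 fun z : Phase => 1 / 2 * ‖z.2‖ ^ 2 + U t z.1 :=
    (contDiff_const.mul (contDiff_snd.norm_sq ℝ)).add (hU.comp contDiff_fst)
  have hGc : HasCompactSupport fun z : Phase => (1 / 2 * ‖z.2‖ ^ 2 + U t z.1) * f t z :=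
    (sol.hasCompactSupport_slice h0 ht).mul_left
  have h1 := integral_fderiv_characteristic_eq_zero (he.mul hf) hGc (sol.continuous_gradient ht)
  have h2 : ∀ z : Phase, (1 / 2 * ‖z.2‖ ^ 2 + U t z.1) * timeDeriv f t z
      = -fderiv ℝ (fun z : Phase => (1 / 2 * ‖z.2‖ ^ 2 + U t z.1) * f t z) z
        (z.2, -gradient (U t) z.1) := by
    intro z
    have d1 : HasFDerivAt (fun z : Phase => 1 / 2 * ‖z.2‖ ^ 2 + U t z.1)
        ((1 / 2 : ℝ) • (2 • (innerSL ℝ z.2).comp (ContinuousLinearMap.snd ℝ E3 E3))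
          + (fderiv ℝ (U t) z.1).comp (ContinuousLinearMap.fst ℝ E3 E3)) z :=
      ((hasFDerivAt_snd (p := z)).norm_sq.const_mul (1 / 2)).add
        ((hU.differentiable (by norm_num) z.1).hasFDerivAt.comp z hasFDerivAt_fst)
    have d2 := d1.fun_mul (hf.differentiable (by norm_num) z).hasFDerivAt
    have hp : fderiv ℝ (U t) z.1 z.2 = ⟪z.2, gradient (U t) z.1⟫ := by
      rw [← inner_gradient, real_inner_comm]
    have hD : (1 / 2 : ℝ) * (2 • ⟪z.2, -gradient (U t) z.1⟫) + fderiv ℝ (U t) z.1 z.2 = 0 := by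
      rw [hp, inner_neg_right, two_nsmul]
      ring
    rw [d2.fderiv, sol.timeDeriv_eq ht, add_apply, smul_apply, smul_apply, smul_eq_mul, smul_eq_mul]
    change _ = -(_ + f t z * ((1 / 2 : ℝ) * (2 • ⟪z.2, -gradient (U t) z.1⟫)
      + fderiv ℝ (U t) z.1 z.2))
    rw [hD]
    ring
  simp only [h2]
  rw [integral_neg, h1, neg_zero]

/-- Differentiating the quadratic field energy produces twice the interaction of f with its time
derivative. Fubini turns this into ∫ U ∂ₜf, as U is the radial potential of f, and the sum with the
kinetic term is the balanced power. -/
theorem energy_eq (sol : IsClassicalSolution f U) (h0 : HasCompactSupport (f 0))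
    (hs : SphericallySymmetric (f 0)) {t : ℝ} (ht : 0 ≤ t) :
    Ekin (f t) + Epot (f t) = Ekin (f 0) + Epot (f 0) := by
  obtain ⟨R, hR0, hR⟩ := sol.exists_support_bound h0 t
  have hsub : Icc 0 t ×ˢ (univ : Set Phase) ⊆ Ici 0 ×ˢ univ := prod_mono_left Icc_subset_Ici_self
  have hfc := sol.continuousOn_uncurry.mono hsub
  have hfc' := sol.continuousOn_timeDeriv.mono hsub
  have hz : ∀ s ∈ Icc 0 t, ∀ z, R < ‖z‖ → f s z = 0 := fun s hs z hz => hR s hs.1 hs.2 z hz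
  have hz' : ∀ s ∈ Icc 0 t, ∀ z, R < ‖z‖ → timeDeriv f s z = 0 := fun s hs z hz =>
    sol.timeDeriv_eq_zero hs.1 (hR s hs.1 hs.2) hz
  have hd : ∀ s ∈ Ioo 0 t, ∀ z, HasDerivAt (fun s => f s z) (timeDeriv f s z) s := fun s hs z =>
    sol.hasDerivAt_time hs.1 z
  have hv : ContinuousOn (fun p : ℝ × Phase => ‖p.2.2‖ ^ 2) (Icc 0 t ×ˢ univ) :=
    Continuous.continuousOn (by fun_prop)
  have hkz : ∀ s ∈ Icc 0 t, ∀ z : Phase, R < ‖z‖ → ‖z.2‖ ^ 2 * f s z = 0 := fun s hs z h => by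
    rw [hz s hs z h, mul_zero]
  have hkz' : ∀ s ∈ Icc 0 t, ∀ z : Phase, R < ‖z‖ → ‖z.2‖ ^ 2 * timeDeriv f s z = 0 := fun s hs z h => by
    rw [hz' s hs z h, mul_zero]
  have hkc := continuousOn_integral_of_support (Ψ := fun s z => ‖z.2‖ ^ 2 * f s z) volume
    (hv.mul hfc) hkz
  have hkd : ∀ s ∈ Ioo 0 t, _ := fun s hs => hasDerivAt_integral_of_support
    (Ψ := fun s z => ‖z.2‖ ^ 2 * f s z) (Ψ' := fun s z => ‖z.2‖ ^ 2 * timeDeriv f s z) volume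
    (hv.mul hfc) (hv.mul hfc') hkz hkz' (fun s hs z => (hd s hs z).const_mul _) hs
  obtain ⟨hpc, hpd⟩ := fieldEnergy_regularity hR0 hfc hfc' hz hz' hd
  simp only [Ekin, Epot_eq]
  refine eq_of_hasDerivAt_zero (I := fun s => 1 / 2 * (∫ z : Phase, ‖z.2‖ ^ 2 * f s z)
    + -(1 / 2) * ∫ r in Ioi (0 : ℝ), massIn (f s) r ^ 2 / r ^ 2) ht
    ((hkc.const_mul _).add (hpc.const_mul _)) fun s hs' => ?_
  have hsc := Ioo_subset_Icc_self hs'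
  refine (((hkd s hs').const_mul (1 / 2)).fun_add ((hpd s hs').const_mul (-(1 / 2)))).congr_deriv ?_
  obtain ⟨C, hC0, hC⟩ := exists_indicator_bound hfc hz
  obtain ⟨C', hC0', hC'⟩ := exists_indicator_bound hfc' hz'
  obtain ⟨i1, e1⟩ := integral_mul_potOf_of_bounded hR0 hC0 hC0' (integrable_of_support hfc hz hsc)
    (sol.nonneg s hsc.1) (integrable_of_support hfc' hz' hsc) (hC s hsc) (hC' s hsc)
  have i2 : Integrable fun z : Phase => ‖z.2‖ ^ 2 * timeDeriv f s z :=
    integrable_of_support (Ψ := fun s z => ‖z.2‖ ^ 2 * timeDeriv f s z) (hv.mul hfc') hkz' hsc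
  have h1 := sol.integral_energy_mul_timeDeriv h0 hsc.1
  have h2 : ∀ z : Phase, (1 / 2 * ‖z.2‖ ^ 2 + U s z.1) * timeDeriv f s z
      = 1 / 2 * (‖z.2‖ ^ 2 * timeDeriv f s z) + timeDeriv f s z * potOf (f s) z.1 := fun z => by
    rw [sol.potential_eq h0 hs hsc.1]; ring
  simp only [h2] at h1
  rw [integral_add (i2.const_mul _) i1, integral_const_mul, e1] at h1
  linarith

variable {l γ M : ℝ} {Q : ℝ → ℝ}

theorem energyCasimir_eq (sol : IsClassicalSolution f U) (hQ : CasimirAssumptions l Q)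
    (h0 : HasCompactSupport (f 0)) (hs : SphericallySymmetric (f 0)) {t : ℝ} (ht : 0 ≤ t) :
    energyCasimir l Q γ (f t) = energyCasimir l Q γ (f 0) := by
  have h1 := sol.energy_eq h0 hs ht
  simp only [energyCasimir, posPart]
  rw [sol.casimir_eq hQ h0 hs ht, sol.integral_angL_mul_eq h0 hs ht]
  linarith

end IsClassicalSolution

/-! ### Stability -/

section Stability

variable {l γ M : ℝ} {Q : ℝ → ℝ}

theorem fieldDistSq_nonneg (f g : Phase → ℝ) : 0 ≤ fieldDistSq f g :=
  integral_nonneg fun _ => by positivity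

theorem MemF.energyCasimir_sub_le_deviation {f f₀ : Phase → ℝ} (hl : -1 < l)
    (hQ : CasimirAssumptions l Q) (hf : MemF l Q γ M f) (h₀ : MemF l Q γ M f₀) :
    energyCasimir l Q γ f - energyCasimir l Q γ f₀ ≤ deviation l Q γ M f f₀ := by
  rw [hf.deviation_eq hl hQ h₀]
  have h1 := fieldDistSq_nonneg f f₀
  have h2 : 0 ≤ 1 / (4 * Real.pi) * fieldDistSq f f₀ := by positivity
  linarith

/-- Solutions starting close to a minimizer stay close to the set of minimizers. -/
theorem exists_minimizer_near_solution (hl : -1 < l) (hQ : CasimirAssumptions l Q) (hγ : 0 ≤ γ)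
    {f₀ : Phase → ℝ} (h₀ : IsMinimizer l Q γ M f₀) (hneg : energyCasimir l Q γ f₀ < 0) {ε : ℝ}
    (hε : 0 < ε) : ∃ δ : ℝ, 0 < δ ∧ ∀ (f : ℝ → Phase → ℝ) (U : ℝ → E3 → ℝ), IsClassicalSolution f U →
      HasCompactSupport (f 0) → MemF l Q γ M (f 0) →
      ∀ g, IsMinimizer l Q γ M g → deviation l Q γ M (f 0) g < δ → ∀ t, 0 ≤ t →
        MemF l Q γ M (f t) ∧ ∃ g, IsMinimizer l Q γ M g ∧ deviation l Q γ M (f t) g < ε := by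
  obtain ⟨δ, hδ, h⟩ := exists_minimizer_near hl hQ hγ h₀ hneg hε
  refine ⟨δ, hδ, fun f U sol hc hf g hg hdev t ht => ?_⟩
  have hmem := sol.memF hQ hc hf ht
  have hmin : energyCasimir l Q γ g = energyCasimir l Q γ f₀ := le_antisymm (hg.2 _ h₀.1) (h₀.2 _ hg.1)
  -- The excess energy is at most the initial deviation and is conserved, so at time t the state is
  -- still almost minimal.
  obtain ⟨k, hk, hkε⟩ := h (f t) hmem (by
    have := hf.energyCasimir_sub_le_deviation hl hQ hg.1
    rw [sol.energyCasimir_eq hQ hc hf.symm ht]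
    linarith)
  refine ⟨hmem, k, hk, ?_⟩
  have hmin' : energyCasimir l Q γ k = energyCasimir l Q γ f₀ := le_antisymm (hk.2 _ h₀.1) (h₀.2 _ hk.1)
  rw [hmem.deviation_eq hl hQ hk.1, hmin']
  exact hkε

end Stability

end CammStability

open CammStability

theorem theorem5p1 (l : ℝ) (hl : -1 < l) (Q : ℝ → ℝ) (hQ : CasimirAssumptions l Q)
    (M : ℝ) (hM : 0 < M) :
    ∃ γ₀ : ℝ, 0 < γ₀ ∧ ∀ γ : ℝ, 0 ≤ γ → γ < γ₀ →
      -- stability of a unique minimizer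
      (∀ f₀ : Phase → ℝ, IsMinimizer l Q γ M f₀ →
        (∀ g : Phase → ℝ, IsMinimizer l Q γ M g → g =ᵐ[volume] f₀) →
        ∀ ε : ℝ, 0 < ε → ∃ δ : ℝ, 0 < δ ∧
          ∀ (f : ℝ → Phase → ℝ) (U : ℝ → E3 → ℝ), IsClassicalSolution f U →
            ContDiff ℝ 1 (f 0) → HasCompactSupport (f 0) → MemF l Q γ M (f 0) →
            deviation l Q γ M (f 0) f₀ < δ →
            ∀ t : ℝ, 0 ≤ t → deviation l Q γ M (f t) f₀ < ε) ∧
      -- stability of the set of all minimizers, without uniqueness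
      (∀ ε : ℝ, 0 < ε → ∃ δ : ℝ, 0 < δ ∧
        ∀ (f : ℝ → Phase → ℝ) (U : ℝ → E3 → ℝ), IsClassicalSolution f U →
          ContDiff ℝ 1 (f 0) → HasCompactSupport (f 0) → MemF l Q γ M (f 0) →
          (⨅ f₀ ∈ {g : Phase → ℝ | IsMinimizer l Q γ M g},
            ((deviation l Q γ M (f 0) f₀ : ℝ) : EReal)) < (δ : EReal) →
          ∀ t : ℝ, 0 ≤ t →
            (⨅ f₀ ∈ {g : Phase → ℝ | IsMinimizer l Q γ M g},
              ((deviation l Q γ M (f t) f₀ : ℝ) : EReal)) < (ε : EReal)) := by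
  obtain ⟨γ₀, hγ₀, hg⟩ := exists_gamma_bound hl hQ hM
  refine ⟨γ₀, hγ₀, fun γ hγ hγ' => ?_⟩
  obtain ⟨k, hk, hkneg⟩ := hg γ hγ hγ'
  have hneg : ∀ f₀, IsMinimizer l Q γ M f₀ → energyCasimir l Q γ f₀ < 0 := fun f₀ h₀ =>
    (h₀.2 k hk).trans_lt hkneg
  refine ⟨fun f₀ h₀ huniq ε hε => ?_, fun ε hε => ?_⟩
  · obtain ⟨δ, hδ, h⟩ := exists_minimizer_near_solution hl hQ hγ h₀ (hneg f₀ h₀) hε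
    refine ⟨δ, hδ, fun f U sol _ hc hf hdev t ht => ?_⟩
    -- The nearby minimizer g equals f₀ almost everywhere, hence has the same field and the same
    -- energy, and the deviation formula depends on nothing else.
    obtain ⟨hmem, g, hg, hgε⟩ := h f U sol hc hf f₀ h₀ hdev t ht
    rw [hmem.deviation_eq hl hQ hg.1, fieldDistSq_congr (huniq g hg)] at hgε
    rwa [hmem.deviation_eq hl hQ h₀.1, le_antisymm (h₀.2 g hg.1) (hg.2 f₀ h₀.1)]
  · by_cases hex : ∃ f₀, IsMinimizer l Q γ M f₀
    · obtain ⟨f₀, h₀⟩ := hex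
      obtain ⟨δ, hδ, h⟩ := exists_minimizer_near_solution hl hQ hγ h₀ (hneg f₀ h₀) hε
      refine ⟨δ, hδ, fun f U sol _ hc hf hdev t ht => ?_⟩
      simp only [iInf_lt_iff] at hdev ⊢
      obtain ⟨g, hg, hgδ⟩ := hdev
      obtain ⟨-, g', hg', hgε⟩ := h f U sol hc hf g hg (EReal.coe_lt_coe_iff.1 hgδ) t ht
      exact ⟨g', hg', EReal.coe_lt_coe_iff.2 hgε⟩
    -- Without minimizers the extended infimum is ⊤, so no initial state satisfies the smallness
    -- condition and any δ works.
    · refine ⟨1, one_pos, fun f U _ _ _ _ hdev t _ => ?_⟩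
      simp only [iInf_lt_iff] at hdev
      obtain ⟨g, hg, -⟩ := hdev
      exact absurd ⟨g, hg⟩ hex
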